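/- Let $M>0$. For $u\in\mathbb{R}$ let $r(u)\in(2M,\infty)$ be the unique solution of $u=r+2M\log\left(\frac{r}{2M}-1\right)$, and let $$V_0(u)=\left(1-\frac{2M}{r(u)}\right)\frac{2M}{r(u)^3}$$ (the potential for angular mode $l=0$). For $\omega\in\mathbb{R}\setminus\{0\}$ let $\grave\phi_\omega=\sum_{k\ge 0}\phi_\omega^{(k)}$, where $$\phi^{(0)}_\omega(u)=e^{-i\omega u},\qquad \phi^{(k+1)}_\omega(u)=-\int_u^\infty \frac{1}{\omega}\sin(\omega(u-v))\,V_0(v)\,\phi^{(k)}_\omega(v)\,dv .$$ Then $\grave\phi_\omega$ is the Jost solution at $+\infty$, that is, a $C^2$ solution on $\mathbb{R}$ of $(-\partial_u^2-\omega^2+V_0(u))\grave\phi_\omega(u)=0$ with $e^{i\omega u}\grave\phi_\omega(u)\to 1$ and $(e^{i\omega u}\grave\phi_\omega(u))'\to 0$ as $u\to+\infty$. Moreover, let $n\ge 3$ be an integer and fix $u>0$. Then there are functions $g_0(\cdot,u)$ and $g_{ijk}(\cdot,u)$, for integers $j,k\ge 0$ and $i$ with $1\le j+k\le i\le n$, from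 $\mathbb{R}$ to $\mathbb{C}$, all of class $C^n(\mathbb{R})$, such that for all $\omega\in\mathbb{R}\setminus\{0\}$ $$\grave\phi_\omega(u)=e^{-i\omega u}+g_0(\omega,u)+\sum_{1\le j+k\le i\le n}(2i\omega)^i\,\log^j(2i\omega)\,\log^k(-2i\omega)\,g_{ijk}(\omega,u),$$ where $\log$ is the principal branch of the complex logarithm (and the $i$ in $2i\omega$ is the imaginary unit). -/

import Mathlib

namespace Schwarzschild

/-- The Regge-Wheeler coordinate `u(r) = r + 2M log(r/(2M) - 1)`, meaningful for `r > 2M`. -/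
noncomputable def reggeWheeler (M r : ℝ) : ℝ :=
  r + 2 * M * Real.log (r / (2 * M) - 1)

/-- For `M > 0` the Regge-Wheeler coordinate maps `(2M, ∞)` bijectively onto `ℝ`. -/
theorem bijOn_reggeWheeler {M : ℝ} (hM : 0 < M) :
    Set.BijOn (reggeWheeler M) (Set.Ioi (2 * M)) Set.univ := by
  refine ⟨fun _ _ => Set.mem_univ _, ?_, ?_⟩
  · have hmono : StrictMonoOn (reggeWheeler M) (Set.Ioi (2 * M)) := by
      intro r hr s _ hrs
      have h2M : 0 < 2 * M := by positivity
      have h1 : 0 < r / (2 * M) - 1 := by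
        rw [sub_pos, one_lt_div h2M]
        exact hr
      have h2 : r / (2 * M) - 1 < s / (2 * M) - 1 := by
        gcongr
      have h3 := Real.log_lt_log h1 h2
      unfold reggeWheeler
      gcongr
    exact hmono.injOn
  · intro u _
    have hcont : Continuous fun t : ℝ => 2 * M * (1 + Real.exp t + t) := by fun_prop
    have htop : Filter.Tendsto (fun t : ℝ => 2 * M * (1 + Real.exp t + t))
        Filter.atTop Filter.atTop := by
      apply Filter.Tendsto.const_mul_atTop (by positivity)
      refine Filter.tendsto_atTop_mono (fun t => ?_) Filter.tendsto_id
      have := Real.exp_pos t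
      simp only [id]
      linarith
    have hbot : Filter.Tendsto (fun t : ℝ => 2 * M * (1 + Real.exp t + t))
        Filter.atBot Filter.atBot := by
      apply Filter.Tendsto.const_mul_atBot (by positivity)
      refine Filter.tendsto_atBot_mono' _ ?_
        (Filter.tendsto_atBot_add_const_left _ 2 Filter.tendsto_id)
      filter_upwards [Filter.eventually_le_atBot (0 : ℝ)] with t ht
      have := Real.exp_le_one_iff.mpr ht
      simp only [id]
      linarith
    obtain ⟨t, ht⟩ := hcont.surjective htop hbot u
    refine ⟨2 * M * (1 + Real.exp t), ?_, ?_⟩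
    · have := Real.exp_pos t
      simp only [Set.mem_Ioi]
      nlinarith
    · have h : 2 * M * (1 + Real.exp t) / (2 * M) - 1 = Real.exp t := by
        field_simp
        ring
      simp only [reggeWheeler, h, Real.log_exp]
      simp only at ht
      linarith

/-- The Schwarzschild radius `r(u) ∈ (2M, ∞)` as a function of the Regge-Wheeler coordinate,
the inverse of `reggeWheeler M` on `(2M, ∞)`. -/
noncomputable def radius (M u : ℝ) : ℝ :=
  Function.invFunOn (reggeWheeler M) (Set.Ioi (2 * M)) u

theorem two_mul_lt_radius {M : ℝ} (hM : 0 < M) (u : ℝ) : 2 * M < radius M u :=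
  Function.invFunOn_mem ((bijOn_reggeWheeler hM).surjOn (Set.mem_univ u))

theorem reggeWheeler_radius {M : ℝ} (hM : 0 < M) (u : ℝ) : reggeWheeler M (radius M u) = u :=
  Function.invFunOn_eq ((bijOn_reggeWheeler hM).surjOn (Set.mem_univ u))

/-- The potential `V_l(u) = (1 - 2M/r) (2M/r³ + l(l+1)/r²)` with `r = r(u)`. -/
noncomputable def potential (M : ℝ) (l : ℕ) (u : ℝ) : ℝ :=
  (1 - 2 * M / radius M u) *
    (2 * M / radius M u ^ 3 + (l : ℝ) * ((l : ℝ) + 1) / radius M u ^ 2)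

/-- The iterates `φ⁽ᵏ⁾` of the Jost integral equation with boundary conditions at `+∞`:
`φ⁽⁰⁾(u) = exp(-iωu)` and
`φ⁽ᵏ⁺¹⁾(u) = - ∫_u^∞ (1/ω) sin(ω(u - v)) V_l(v) φ⁽ᵏ⁾(v) dv`. -/
noncomputable def jostIterate (M : ℝ) (l : ℕ) (ω : ℂ) : ℕ → ℝ → ℂ
  | 0, u => Complex.exp (-Complex.I * ω * u)
  | k + 1, u => -∫ v in Set.Ioi u,
      1 / ω * Complex.sin (ω * ((u : ℂ) - v)) * (potential M l v : ℂ) * jostIterate M l ω k v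

/-- The Jost solution at `+∞`, `φ = ∑ₖ φ⁽ᵏ⁾`. -/
noncomputable def jostSolution (M : ℝ) (l : ℕ) (ω : ℂ) (u : ℝ) : ℂ :=
  ∑' k, jostIterate M l ω k u

/-- `φ` is a solution of the Schrödinger equation `(-∂ᵤ² - ω² + V_l(u)) φ(u) = 0` on `ℝ` with the
boundary conditions `exp(iωu) φ(u) → 1` and `(exp(iωu) φ(u))' → 0` as `u → +∞`. -/
structure IsJostSolution (M : ℝ) (l : ℕ) (ω : ℂ) (φ : ℝ → ℂ) : Prop where
  contDiff : ContDiff ℝ 2 φ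
  schroedinger : ∀ u : ℝ,
    -deriv (deriv φ) u + (-ω ^ 2 + (potential M l u : ℂ)) * φ u = 0
  tendsto_one : Filter.Tendsto (fun u : ℝ => Complex.exp (Complex.I * ω * u) * φ u)
    Filter.atTop (nhds 1)
  tendsto_deriv : Filter.Tendsto
    (deriv fun u : ℝ => Complex.exp (Complex.I * ω * u) * φ u)
    Filter.atTop (nhds 0)

end Schwarzschild

/-!
In the radial coordinate the problem is explicit. Put `φ(u) = e^(-iωu) F(r(u))` and `z = 2iω`. The
Schrödinger equation becomes `((1 - 2M/r) F')' - z F' = (2M/r³) F` with `F → 1` as `r → ∞`, and the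
ansatz `F(r) = 1 + ∫₀^∞ e^(-p r) B(p) dp` turns it into the Volterra equation
`p (p + z) B(p) = M (p² + ∫₀^p (p² + q²) B(q) dq)` (`borel_volterra`, `laplace_equation`).

*The Jost solution.* Iterating the Volterra equation gives `B = ∑ₖ p^k β_k(log(z/p))` with
`β₀(w) = M / (1 + e^w)`, each further step being an average over `(0, p)` followed by the factor
`M / (1 + z/p)` (`borelCoeff`). For `Re z ≥ 0` this factor is at most `M` in norm, so that
`|B(p)| ≤ M e^(2Mp)` and the Laplace integral converges for all `r > 2M`, that is, on the whole
line in `u`. The function so obtained solves the differential equation with the Jost asymptotics,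
hence also the integral equation (`jost_integral_equation`); bounded solutions of the latter are
sums of the Picard series because `∫_u^∞ V₀ = M / r²` is finite (`hasSum_jostIterate`). This
identifies it with the given series (`jostSolution_eq_jostLaplace`).

*Low frequencies.* The `β_k` are holomorphic and bounded in `w = log z` on a strip
`|Im w| < π/2 + δ`, so `F` extends holomorphically to a sector larger than the right half plane; `δ`
is chosen depending on `r`, since the bound for `B` deteriorates to `e^(2Mp / cos δ)`. On that
sector `F` has an expansion `∑ c_{ij} z^i log^j z + O(|z|^(n + 1/2))` over `j ≤ i ≤ n`. To see this,
`HasLogExp` packages an expansion with a bound for its coefficients and remainder, and the three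
operations that build `F` are followed through it. Division by `1 + z` has norm arbitrarily close
to `1` for suitable weights (`exists_calibration`). The average `∫₀¹ t^q f(z/t) dt` solves the
Euler equation `z y' = (q + 1) y - f` and produces a new power of `log z` only at the resonant
exponent `z^(q + 1)` (`HasLogExp.powAvg`); since `q ≥ k` at step `k`, this gives `j ≤ i`, and after
step `n` there are no resonances left and the norms decay like `1 / m!`, which makes the sum over
`k` converge. The Laplace integral over `p` is a convolution of the same type, whose behaviour at
`p = 0` is reduced to averages by a Taylor expansion of `e^(-p r)`
(`exists_hasLogExp_jostComponent`).

The remainder is holomorphic and `O(|z|^(n + 1/2))` on a sector that contains the imaginary axis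
minus the origin in its interior, so by Cauchy's estimate its `m`-th derivative is
`O(|ω|^(n + 1/2 - m))` and it is of class `C^n` in `ω ∈ ℝ` (`contDiff_logPullback`). Because the
imaginary axis lies in a single sector for the principal branch of `log z`, the expansion only
involves powers of `log (2iω)`: the coefficients `g_{ijk}` with `k ≠ 0` may be taken to vanish, and
`g_{ij0}` to be `c_{ij} e^(-iωu)`.
-/

namespace JostBorel

open Set Filter Topology MeasureTheory Schwarzschild

/-! ### Horizontal strips and multiplicative averages -/

/-- The open horizontal strip `|Im w| < b`, the image under the logarithm of the sector
`|arg z| < b`. -/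
def strip (b : ℝ) : Set ℂ := {w | |w.im| < b}

theorem isOpen_strip (b : ℝ) : IsOpen (strip b) :=
  isOpen_lt (Complex.continuous_im.abs) continuous_const

theorem convex_strip (b : ℝ) : Convex ℝ (strip b) := by
  have h : strip b = Complex.imLm ⁻¹' (Ioo (-b) b) := by
    ext w; simp [strip, abs_lt]
  rw [h]
  exact (convex_Ioo _ _).linear_preimage _

theorem sub_ofReal_mem_strip {b : ℝ} {w : ℂ} (hw : w ∈ strip b) (x : ℝ) : w - x ∈ strip b := by
  simpa [strip] using hw

theorem strip_mono {b c : ℝ} (h : b ≤ c) : strip b ⊆ strip c := fun _ hw => lt_of_lt_of_le hw h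

theorem closedBall_subset_strip {b ε : ℝ} {w : ℂ} (h : |w.im| + ε < b) :
    Metric.closedBall w ε ⊆ strip b := by
  intro v hv
  rw [Metric.mem_closedBall, dist_eq_norm] at hv
  have h1 := Complex.abs_im_le_norm (v - w)
  rw [Complex.sub_im] at h1
  have h2 := abs_sub_abs_le_abs_sub v.im w.im
  show |v.im| < b
  linarith

theorem norm_deriv_le_of_closedBall_subset {b ε C : ℝ} {f : ℂ → ℂ} {w : ℂ}
    (hf : DifferentiableOn ℂ f (strip b)) (hε : 0 < ε) (hC : ∀ v ∈ Metric.closedBall w ε, ‖f v‖ ≤ C)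
    (h : |w.im| + ε < b) : ‖deriv f w‖ ≤ C / ε := by
  have hsub := closedBall_subset_strip h
  refine Complex.norm_deriv_le_of_forall_mem_sphere_norm_le hε ?_ ?_
  · refine DifferentiableOn.diffContOnCl ?_
    rw [closure_ball _ hε.ne']
    exact hf.mono hsub
  · intro v hv
    exact hC v (Metric.sphere_subset_closedBall hv)

/-- The multiplicative convolution `w ↦ ∫₀^∞ G(p) f(w - log p) dp`: with `w = log z` it sends
`f(log z)` to `∫₀^∞ G(p) f(log (z / p)) dp`. -/
noncomputable def mellinOp (G : ℝ → ℝ) (f : ℂ → ℂ) (w : ℂ) : ℂ :=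
  ∫ p in Ioi (0 : ℝ), (G p : ℂ) * f (w - (Real.log p : ℝ))

theorem continuousOn_comp_sub_log {b : ℝ} {f : ℂ → ℂ} (hf : ContinuousOn f (strip b)) {w : ℂ}
    (hw : w ∈ strip b) : ContinuousOn (fun p : ℝ => f (w - (Real.log p : ℝ))) (Ioi 0) := by
  refine hf.comp ?_ fun p _ => sub_ofReal_mem_strip hw _
  refine continuousOn_const.sub (Complex.continuous_ofReal.comp_continuousOn ?_)
  exact Real.continuousOn_log.mono fun p hp => (ne_of_gt hp : p ≠ 0)

theorem aestronglyMeasurable_comp_sub_log {b : ℝ} {f : ℂ → ℂ} (hf : ContinuousOn f (strip b))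
    {w : ℂ} (hw : w ∈ strip b) :
    AEStronglyMeasurable (fun p : ℝ => f (w - (Real.log p : ℝ))) (volume.restrict (Ioi 0)) :=
  (continuousOn_comp_sub_log hf hw).aestronglyMeasurable measurableSet_Ioi

theorem integrable_mellinOp {b C : ℝ} {G : ℝ → ℝ} {f : ℂ → ℂ} (hG : IntegrableOn G (Ioi 0))
    (hf : ContinuousOn f (strip b)) {w : ℂ} (hw : w ∈ strip b)
    (hC : ∀ p : ℝ, 0 < p → ‖f (w - (Real.log p : ℝ))‖ ≤ C) :
    IntegrableOn (fun p : ℝ => (G p : ℂ) * f (w - (Real.log p : ℝ))) (Ioi 0) := by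
  refine Integrable.mul_bdd (c := C) hG.ofReal (aestronglyMeasurable_comp_sub_log hf hw) ?_
  filter_upwards [ae_restrict_mem measurableSet_Ioi] with p hp using hC p hp

theorem norm_mellinOp_le {C : ℝ} {G : ℝ → ℝ} {f : ℂ → ℂ} (hG : IntegrableOn G (Ioi 0))
    {w : ℂ} (hC : ∀ p : ℝ, 0 < p → ‖f (w - (Real.log p : ℝ))‖ ≤ C) :
    ‖mellinOp G f w‖ ≤ C * ∫ p in Ioi (0 : ℝ), |G p| := by
  rw [← integral_const_mul]
  refine norm_integral_le_of_norm_le (hG.abs.const_mul C) ?_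
  filter_upwards [ae_restrict_mem measurableSet_Ioi] with p hp
  rw [norm_mul, Complex.norm_real, Real.norm_eq_abs, mul_comm]
  exact mul_le_mul_of_nonneg_right (hC p hp) (abs_nonneg _)

/-- Multiplicative convolutions of a bounded holomorphic function are holomorphic, and may be
differentiated under the integral. -/
theorem hasDerivAt_mellinOp {b C : ℝ} {G : ℝ → ℝ} {f : ℂ → ℂ} (hG : IntegrableOn G (Ioi 0))
    (hf : DifferentiableOn ℂ f (strip b)) (hC : ∀ v ∈ strip b, ‖f v‖ ≤ C) {w : ℂ}
    (hw : w ∈ strip b) :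
    IntegrableOn (fun p : ℝ => (G p : ℂ) * deriv f (w - (Real.log p : ℝ))) (Ioi 0) ∧
      HasDerivAt (mellinOp G f) (mellinOp G (deriv f) w) w := by
  have hw' : |w.im| < b := hw
  set ε := (b - |w.im|) / 3 with hε
  have hε0 : 0 < ε := by rw [hε]; linarith
  have hball : ∀ x ∈ Metric.ball w ε, |x.im| + ε < b := by
    intro x hx
    rw [Metric.mem_ball, dist_eq_norm] at hx
    have h1 := Complex.abs_im_le_norm (x - w)
    rw [Complex.sub_im] at h1
    have h2 := abs_sub_abs_le_abs_sub x.im w.im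
    have : 3 * ε = b - |w.im| := by rw [hε]; ring
    linarith
  have hball' : ∀ x ∈ Metric.ball w ε, x ∈ strip b := fun x hx => by
    have := hball x hx
    show |x.im| < b
    linarith
  have hdf : DifferentiableOn ℂ (deriv f) (strip b) := hf.deriv (isOpen_strip b)
  have key := hasDerivAt_integral_of_dominated_loc_of_deriv_le
    (μ := volume.restrict (Ioi (0 : ℝ))) (𝕜 := ℂ)
    (F := fun (x : ℂ) (p : ℝ) => (G p : ℂ) * f (x - (Real.log p : ℝ)))
    (F' := fun (x : ℂ) (p : ℝ) => (G p : ℂ) * deriv f (x - (Real.log p : ℝ)))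
    (x₀ := w) (s := Metric.ball w ε) (bound := fun p => |G p| * (C / ε))
    (Metric.ball_mem_nhds _ hε0) ?_ ?_ ?_ ?_ ?_ ?_
  · exact key
  · filter_upwards [Metric.ball_mem_nhds w hε0] with x hx
    exact hG.ofReal.aestronglyMeasurable.mul
      (aestronglyMeasurable_comp_sub_log hf.continuousOn (hball' x hx))
  · exact integrable_mellinOp hG hf.continuousOn hw
      fun p _ => hC _ (sub_ofReal_mem_strip hw _)
  · exact hG.ofReal.aestronglyMeasurable.mul
      (aestronglyMeasurable_comp_sub_log hdf.continuousOn hw)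
  · refine ae_of_all _ fun p x hx => ?_
    rw [norm_mul, Complex.norm_real, Real.norm_eq_abs]
    refine mul_le_mul_of_nonneg_left ?_ (abs_nonneg _)
    have h : |(x - (Real.log p : ℝ)).im| + ε < b := by simpa using hball x hx
    exact norm_deriv_le_of_closedBall_subset hf hε0
      (fun v hv => hC v (closedBall_subset_strip h hv)) h
  · exact hG.abs.mul_const _
  · refine ae_of_all _ fun p x hx => ?_
    have h : x - (Real.log p : ℝ) ∈ strip b := sub_ofReal_mem_strip (hball' x hx) _
    have h1 := (hf.differentiableAt ((isOpen_strip b).mem_nhds h)).hasDerivAt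
    have h2 : HasDerivAt (fun x : ℂ => x - (Real.log p : ℝ)) 1 x :=
      (hasDerivAt_id x).sub_const _
    simpa using (h1.comp x h2).const_mul (G p : ℂ)

/-- The kernel `p ^ q` on `(0, 1)`. -/
noncomputable def powKer (q : ℕ) : ℝ → ℝ := (Iio (1 : ℝ)).indicator fun p => p ^ q

theorem integral_powKer_mul (q : ℕ) (f : ℝ → ℂ) :
    ∫ p in Ioi (0 : ℝ), (powKer q p : ℂ) * f p = ∫ p in Ioo (0 : ℝ) 1, (p : ℂ) ^ q * f p := by
  have h : ∀ p, (powKer q p : ℂ) * f p =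
      (Iio (1 : ℝ)).indicator (fun p => (p : ℂ) ^ q * f p) p := by
    intro p
    by_cases hp : p ∈ Iio (1 : ℝ) <;> simp [powKer, hp]
  simp_rw [h]
  rw [setIntegral_indicator measurableSet_Iio, Ioi_inter_Iio]

theorem integrableOn_powKer (q : ℕ) : IntegrableOn (powKer q) (Ioi 0) := by
  unfold powKer
  rw [IntegrableOn, integrable_indicator_iff measurableSet_Iio, IntegrableOn,
    Measure.restrict_restrict measurableSet_Iio, inter_comm, Ioi_inter_Iio]
  exact ((continuous_pow q).integrableOn_Icc (a := 0) (b := 1)).mono_set Ioo_subset_Icc_self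

theorem integral_abs_powKer (q : ℕ) : ∫ p in Ioi (0 : ℝ), |powKer q p| = 1 / (q + 1) := by
  have h : ∀ p ∈ Ioi (0 : ℝ), |powKer q p| = (Iio (1 : ℝ)).indicator (fun p => p ^ q) p := by
    intro p hp
    have hp0 : (0 : ℝ) < p := hp
    by_cases hp1 : p ∈ Iio (1 : ℝ) <;> simp [powKer, hp1, abs_of_pos hp0]
  rw [setIntegral_congr_fun measurableSet_Ioi h, setIntegral_indicator measurableSet_Iio,
    Ioi_inter_Iio, ← integral_Ioc_eq_integral_Ioo,
    ← intervalIntegral.integral_of_le zero_le_one, integral_pow]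
  simp

/-- The multiplicative average `∫₀¹ t ^ q f(w - log t) dt`. -/
noncomputable def powAvg (q : ℕ) (f : ℂ → ℂ) (w : ℂ) : ℂ := mellinOp (powKer q) f w

theorem powAvg_eq (q : ℕ) (f : ℂ → ℂ) (w : ℂ) :
    powAvg q f w = ∫ p in Ioo (0 : ℝ) 1, (p : ℂ) ^ q * f (w - (Real.log p : ℝ)) :=
  integral_powKer_mul q fun p => f (w - (Real.log p : ℝ))

theorem norm_powAvg_le {C : ℝ} {f : ℂ → ℂ} (q : ℕ) {w : ℂ}
    (hC : ∀ p : ℝ, 0 < p → ‖f (w - (Real.log p : ℝ))‖ ≤ C) :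
    ‖powAvg q f w‖ ≤ C / (q + 1) := by
  have := norm_mellinOp_le (integrableOn_powKer q) hC
  rwa [integral_abs_powKer, mul_one_div] at this

/-- The average `powAvg q f` solves the Euler type equation `y' = (q + 1) y - f`. -/
theorem hasDerivAt_powAvg {b C : ℝ} {f : ℂ → ℂ} (q : ℕ)
    (hf : DifferentiableOn ℂ f (strip b)) (hC : ∀ v ∈ strip b, ‖f v‖ ≤ C) {w : ℂ}
    (hw : w ∈ strip b) :
    HasDerivAt (powAvg q f) (((q : ℂ) + 1) * powAvg q f w - f w) w := by
  obtain ⟨hint, hder⟩ := hasDerivAt_mellinOp (integrableOn_powKer q) hf hC hw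
  refine hder.congr_deriv (Eq.symm ?_)
  have hmem : ∀ p : ℝ, w - (Real.log p : ℝ) ∈ strip b := sub_ofReal_mem_strip hw
  set Φ : ℝ → ℂ := fun p => (p : ℂ) ^ (q + 1) * f (w - (Real.log p : ℝ)) with hΦ
  have hΦd : ∀ p ∈ Ioo (0 : ℝ) 1, HasDerivAt Φ
      (((q : ℂ) + 1) * ((p : ℂ) ^ q * f (w - (Real.log p : ℝ))) -
        (p : ℂ) ^ q * deriv f (w - (Real.log p : ℝ))) p := by
    intro p hp
    have hp0 : (p : ℂ) ≠ 0 := by exact_mod_cast hp.1.ne'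
    have h1 := (hf.differentiableAt ((isOpen_strip b).mem_nhds (hmem p))).hasDerivAt
    have h2 : HasDerivAt (fun p : ℝ => w - ((Real.log p : ℝ) : ℂ)) (-((p⁻¹ : ℝ) : ℂ)) p :=
      (Real.hasDerivAt_log hp.1.ne').ofReal_comp.const_sub w
    have h3 := HasDerivAt.scomp p h1 h2
    have h4 : HasDerivAt (fun p : ℝ => (p : ℂ) ^ (q + 1)) (((q : ℂ) + 1) * (p : ℂ) ^ q) p := by
      simpa using (hasDerivAt_pow (q + 1) (p : ℂ)).comp_ofReal
    refine (h4.mul h3).congr_deriv ?_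
    simp only [smul_eq_mul, Function.comp_apply]
    push_cast
    field_simp
    ring
  have hint1 : IntegrableOn (fun p : ℝ => (p : ℂ) ^ q * deriv f (w - (Real.log p : ℝ)))
      (Ioo 0 1) := by
    refine IntegrableOn.congr_fun (hint.mono_set Ioo_subset_Ioi_self) (fun p hp => ?_)
      measurableSet_Ioo
    simp [powKer, hp.2]
  have hint2 : IntegrableOn (fun p : ℝ => (p : ℂ) ^ q * f (w - (Real.log p : ℝ)))
      (Ioo 0 1) := by
    refine IntegrableOn.congr_fun ((integrable_mellinOp (integrableOn_powKer q) hf.continuousOn hw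
      fun p _ => hC _ (hmem p)).mono_set Ioo_subset_Ioi_self) (fun p hp => ?_) measurableSet_Ioo
    simp [powKer, hp.2]
  have hcont : ContinuousOn Φ (Icc 0 1) := by
    intro p hp
    rcases hp.1.eq_or_lt with h0 | h0
    · rw [← h0]
      have : Φ 0 = 0 := by simp [hΦ]
      rw [ContinuousWithinAt, this]
      have hlim : Tendsto (fun p : ℝ => |p| ^ (q + 1) * C) (𝓝[Icc 0 1] 0) (𝓝 0) := by
        have hc : Continuous fun p : ℝ => |p| ^ (q + 1) * C := by fun_prop
        have := hc.tendsto 0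
        simp only [abs_zero, ne_eq, Nat.add_eq_zero_iff, one_ne_zero, and_false, not_false_eq_true,
          zero_pow, zero_mul] at this
        exact this.mono_left nhdsWithin_le_nhds
      refine squeeze_zero_norm (fun p => ?_) hlim
      rw [hΦ]
      simp only [norm_mul, norm_pow, Complex.norm_real, Real.norm_eq_abs]
      exact mul_le_mul_of_nonneg_left (hC _ (hmem p)) (by positivity)
    · refine ContinuousAt.continuousWithinAt ?_
      refine ContinuousAt.mul (by fun_prop) ?_
      exact (continuousOn_comp_sub_log hf.continuousOn hw).continuousAt (Ioi_mem_nhds h0)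
  have hftc := intervalIntegral.integral_eq_sub_of_hasDerivAt_of_le zero_le_one hcont hΦd
    (by
      rw [intervalIntegrable_iff_integrableOn_Ioo_of_le zero_le_one]
      exact (hint2.const_mul _).sub hint1)
  rw [intervalIntegral.integral_of_le zero_le_one, integral_Ioc_eq_integral_Ioo,
    integral_sub (hint2.const_mul _) hint1, integral_const_mul] at hftc
  have e1 : Φ 1 - Φ 0 = f w := by simp [hΦ]
  rw [e1] at hftc
  have e2 : mellinOp (powKer q) (deriv f) w =
      ∫ p in Ioo (0 : ℝ) 1, (p : ℂ) ^ q * deriv f (w - (Real.log p : ℝ)) := powAvg_eq q (deriv f) w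
  rw [powAvg_eq, e2, ← hftc]
  ring

/-! ### The homogeneous components of the Borel transform -/

/-- The distance of the sector `|arg z| ≤ π / 2 + δ` from `-1` is `cos δ`. -/
theorem cos_le_norm_one_add_exp {δ : ℝ} (h1 : δ < Real.pi / 2) {w : ℂ}
    (hw : |w.im| ≤ Real.pi / 2 + δ) : Real.cos δ ≤ ‖1 + Complex.exp w‖ := by
  have hcos : -Real.sin δ ≤ Real.cos w.im := by
    rw [← Real.cos_abs w.im, ← Real.cos_add_pi_div_two, add_comm]
    exact Real.cos_le_cos_of_nonneg_of_le_pi (abs_nonneg _) (by linarith) hw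
  have hsq : ‖1 + Complex.exp w‖ ^ 2 =
      1 + 2 * Real.exp w.re * Real.cos w.im + Real.exp w.re ^ 2 := by
    rw [← Complex.normSq_eq_norm_sq, Complex.normSq_apply]
    simp only [Complex.add_re, Complex.one_re, Complex.add_im, Complex.one_im, Complex.exp_re,
      Complex.exp_im]
    have := Real.sin_sq_add_cos_sq w.im
    linear_combination (Real.exp w.re ^ 2) * this
  refine le_of_sq_le_sq ?_ (norm_nonneg _)
  rw [hsq]
  have h2 := Real.sin_sq_add_cos_sq δ
  have h3 := mul_le_mul_of_nonneg_left hcos (Real.exp_pos w.re).le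
  nlinarith [sq_nonneg (Real.exp w.re - Real.sin δ)]

/-- With `z = exp w`, the Borel transform of the Jost solution at `p` is
`∑ₖ p ^ k * borelCoeff M k (w - log p)`: its `k`-th component is homogeneous of degree `k` in
`(p, z)`, and `borelCoeff M k` is that component at `p = 1`. -/
noncomputable def borelCoeff (M : ℝ) : ℕ → ℂ → ℂ
  | 0, w => M / (1 + Complex.exp w)
  | k + 1, w => M / (1 + Complex.exp w) *
      (powAvg k (borelCoeff M k) w + powAvg (k + 2) (borelCoeff M k) w)

theorem norm_borelCoeff_le {M κ : ℝ} (hM : 0 < M) (hκ : 0 < κ) (k : ℕ) {w : ℂ}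
    (h : ∀ x : ℝ, κ ≤ ‖1 + Complex.exp (w - x)‖) :
    ‖borelCoeff M k w‖ ≤ M / κ * ((2 * M / κ) ^ k / k.factorial) := by
  induction k generalizing w with
  | zero =>
    have h0 := h 0
    simp only [Complex.ofReal_zero, sub_zero] at h0
    simp only [borelCoeff, norm_div, Complex.norm_real, Real.norm_eq_abs, abs_of_pos hM,
      pow_zero, Nat.factorial_zero, Nat.cast_one, div_one, mul_one]
    gcongr
  | succ k ih =>
    have h0 := h 0
    simp only [Complex.ofReal_zero, sub_zero] at h0
    set C := M / κ * ((2 * M / κ) ^ k / k.factorial) with hC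
    have hC0 : 0 ≤ C := by positivity
    have hb : ∀ p : ℝ, 0 < p → ‖borelCoeff M k (w - (Real.log p : ℝ))‖ ≤ C := fun p _ =>
      ih fun x => by simpa [sub_sub] using h (Real.log p + x)
    have h1 := norm_powAvg_le k hb
    have h2 := norm_powAvg_le (k + 2) hb
    have h3 : C / (((k + 2 : ℕ) : ℝ) + 1) ≤ C / (k + 1) := by
      push_cast
      gcongr
      linarith
    simp only [borelCoeff, norm_mul, norm_div, Complex.norm_real, Real.norm_eq_abs, abs_of_pos hM]
    calc M / ‖1 + Complex.exp w‖ *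
          ‖powAvg k (borelCoeff M k) w + powAvg (k + 2) (borelCoeff M k) w‖
        ≤ M / κ * (C / (k + 1) + C / (k + 1)) := by
          gcongr
          exact (norm_add_le _ _).trans (add_le_add h1 (h2.trans h3))
      _ = _ := by
          rw [hC, Nat.factorial_succ, pow_succ]
          push_cast
          field_simp
          ring

theorem cos_le_norm_of_mem_strip {δ : ℝ} (h1 : δ < Real.pi / 2) {w : ℂ}
    (hw : w ∈ strip (Real.pi / 2 + δ)) (x : ℝ) : Real.cos δ ≤ ‖1 + Complex.exp (w - x)‖ :=
  cos_le_norm_one_add_exp h1 (le_of_lt (sub_ofReal_mem_strip hw x))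

theorem one_add_exp_ne_zero {δ : ℝ} (h0 : 0 ≤ δ) (h1 : δ < Real.pi / 2) {w : ℂ}
    (hw : w ∈ strip (Real.pi / 2 + δ)) : 1 + Complex.exp w ≠ 0 := by
  have h := cos_le_norm_of_mem_strip h1 hw 0
  have hc : 0 < Real.cos δ := Real.cos_pos_of_mem_Ioo ⟨by linarith [Real.pi_pos], h1⟩
  simp only [Complex.ofReal_zero, sub_zero] at h
  exact norm_pos_iff.mp (hc.trans_le h)

theorem norm_borelCoeff_le_of_mem_strip {M δ : ℝ} (hM : 0 < M) (h0 : 0 ≤ δ)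
    (h1 : δ < Real.pi / 2) (k : ℕ) {w : ℂ} (hw : w ∈ strip (Real.pi / 2 + δ)) :
    ‖borelCoeff M k w‖ ≤ M / Real.cos δ * ((2 * M / Real.cos δ) ^ k / k.factorial) :=
  norm_borelCoeff_le hM (Real.cos_pos_of_mem_Ioo ⟨by linarith [Real.pi_pos], h1⟩) k
    fun x => cos_le_norm_of_mem_strip h1 hw x

theorem differentiableOn_borelCoeff {M δ : ℝ} (hM : 0 < M) (h0 : 0 ≤ δ) (h1 : δ < Real.pi / 2)
    (k : ℕ) : DifferentiableOn ℂ (borelCoeff M k) (strip (Real.pi / 2 + δ)) := by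
  have hpre : DifferentiableOn ℂ (fun w => (M : ℂ) / (1 + Complex.exp w))
      (strip (Real.pi / 2 + δ)) := by
    refine DifferentiableOn.div (differentiableOn_const _) ?_
      fun w hw => one_add_exp_ne_zero h0 h1 hw
    exact (Complex.differentiable_exp.const_add 1).differentiableOn
  induction k with
  | zero => exact hpre
  | succ k ih =>
    have havg : ∀ q, DifferentiableOn ℂ (powAvg q (borelCoeff M k)) (strip (Real.pi / 2 + δ)) :=
      fun q w hw => (hasDerivAt_powAvg q ih
        (fun v hv => norm_borelCoeff_le_of_mem_strip hM h0 h1 k hv)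
        hw).differentiableAt.differentiableWithinAt
    exact hpre.mul ((havg k).add (havg (k + 2)))

theorem continuousOn_borelCoeff_sub_log {M : ℝ} (hM : 0 < M) (k : ℕ) {w : ℂ}
    (hw : |w.im| ≤ Real.pi / 2) :
    ContinuousOn (fun p : ℝ => borelCoeff M k (w - (Real.log p : ℝ))) (Ioi 0) :=
  continuousOn_comp_sub_log (differentiableOn_borelCoeff hM (δ := Real.pi / 4)
    (by positivity) (by linarith [Real.pi_pos]) k).continuousOn
    (show |w.im| < _ by linarith [Real.pi_pos])

theorem norm_borelCoeff_sub_log_le {M : ℝ} (hM : 0 < M) (k : ℕ) {w : ℂ}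
    (hw : |w.im| ≤ Real.pi / 2) (x : ℝ) :
    ‖borelCoeff M k (w - x)‖ ≤ M * ((2 * M) ^ k / k.factorial) := by
  have h := norm_borelCoeff_le (w := w - x) hM one_pos k fun y => ?_
  · simpa using h
  · have := cos_le_norm_one_add_exp (δ := 0) (by positivity) (w := w - x - y) (by simpa using hw)
    simpa using this

theorem norm_pow_mul_borelCoeff_le {M : ℝ} (hM : 0 < M) (k : ℕ) {w : ℂ}
    (hw : |w.im| ≤ Real.pi / 2) {p : ℝ} (hp : 0 ≤ p) :
    ‖(p : ℂ) ^ k * borelCoeff M k (w - (Real.log p : ℝ))‖ ≤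
      M * ((2 * M * p) ^ k / k.factorial) := by
  rw [norm_mul, norm_pow, Complex.norm_real, Real.norm_eq_abs, abs_of_nonneg hp]
  calc p ^ k * _ ≤ p ^ k * (M * ((2 * M) ^ k / k.factorial)) := by
        gcongr
        exact norm_borelCoeff_sub_log_le hM k hw _
    _ = _ := by rw [mul_pow (2 * M)]; ring

/-- The Borel transform of the Jost solution, as a function of the Laplace variable `p`, for the
spectral parameter `z = exp w`. -/
noncomputable def borel (M : ℝ) (w : ℂ) (p : ℝ) : ℂ :=
  ∑' k, (p : ℂ) ^ k * borelCoeff M k (w - (Real.log p : ℝ))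

theorem summable_borel_bound (M p : ℝ) :
    Summable fun k : ℕ => M * ((2 * M * p) ^ k / k.factorial) :=
  (Real.summable_pow_div_factorial _).mul_left _

theorem hasSum_borel {M : ℝ} (hM : 0 < M) {w : ℂ} (hw : |w.im| ≤ Real.pi / 2) {p : ℝ}
    (hp : 0 ≤ p) : HasSum (fun k => (p : ℂ) ^ k * borelCoeff M k (w - (Real.log p : ℝ)))
      (borel M w p) :=
  (Summable.of_norm_bounded (summable_borel_bound M p)
    fun k => norm_pow_mul_borelCoeff_le hM k hw hp).hasSum

theorem norm_borel_le {M : ℝ} (hM : 0 < M) {w : ℂ} (hw : |w.im| ≤ Real.pi / 2) {p : ℝ}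
    (hp : 0 ≤ p) : ‖borel M w p‖ ≤ M * Real.exp (2 * M * p) := by
  refine tsum_of_norm_bounded ?_ fun k => norm_pow_mul_borelCoeff_le hM k hw hp
  have := (NormedSpace.expSeries_div_hasSum_exp (𝔸 := ℝ) (2 * M * p)).mul_left M
  rwa [← Real.exp_eq_exp_ℝ] at this

theorem continuousOn_borel {M : ℝ} (hM : 0 < M) {w : ℂ} (hw : |w.im| ≤ Real.pi / 2) :
    ContinuousOn (borel M w) (Ioi 0) := by
  have hk : ∀ R : ℝ, ContinuousOn (borel M w) (Ioo 0 R) := by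
    intro R
    refine continuousOn_tsum (fun k => ?_) (summable_borel_bound M R) fun k p hp => ?_
    · exact ContinuousOn.mul (by fun_prop)
        ((continuousOn_borelCoeff_sub_log hM k hw).mono Ioo_subset_Ioi_self)
    · refine (norm_pow_mul_borelCoeff_le hM k hw hp.1.le).trans ?_
      have := hp.1
      have := hp.2
      gcongr
  intro p hp
  have hp0 : (0 : ℝ) < p := hp
  exact ((hk (p + 1)).continuousAt (Ioo_mem_nhds hp0 (by linarith))).continuousWithinAt

theorem setIntegral_Ioo_eq_mul {p : ℝ} (hp : 0 < p) (g : ℝ → ℂ) :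
    ∫ q in Ioo 0 p, g q = p * ∫ t in Ioo (0 : ℝ) 1, g (p * t) := by
  rw [← integral_Ioc_eq_integral_Ioo, ← integral_Ioc_eq_integral_Ioo,
    ← intervalIntegral.integral_of_le zero_le_one, ← intervalIntegral.integral_of_le hp.le]
  have := intervalIntegral.smul_integral_comp_mul_left (a := 0) (b := 1) g p
  simp only [mul_zero, mul_one] at this
  rw [← this, Complex.real_smul]

theorem integrableOn_Ioo_of_continuousOn_of_norm_le {g : ℝ → ℂ} {p C : ℝ}
    (hg : ContinuousOn g (Ioi 0)) (hC : ∀ q ∈ Ioo 0 p, ‖g q‖ ≤ C) : IntegrableOn g (Ioo 0 p) := by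
  refine IntegrableOn.of_bound (by simp)
    ((hg.mono Ioo_subset_Ioi_self).aestronglyMeasurable measurableSet_Ioo) C ?_
  filter_upwards [ae_restrict_mem measurableSet_Ioo] with q hq using hC q hq

theorem integral_sq_add_sq_mul_component {M : ℝ} (hM : 0 < M) (k : ℕ) {w : ℂ}
    (hw : |w.im| ≤ Real.pi / 2) {p : ℝ} (hp : 0 < p) :
    ∫ q in Ioo 0 p, ((p : ℂ) ^ 2 + (q : ℂ) ^ 2) *
        ((q : ℂ) ^ k * borelCoeff M k (w - (Real.log q : ℝ))) =
      (p : ℂ) ^ (k + 3) * (powAvg k (borelCoeff M k) (w - (Real.log p : ℝ)) +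
        powAvg (k + 2) (borelCoeff M k) (w - (Real.log p : ℝ))) := by
  have hint : ∀ q : ℕ, IntegrableOn (fun t : ℝ => (t : ℂ) ^ q *
      borelCoeff M k (w - (Real.log p : ℝ) - (Real.log t : ℝ))) (Ioo 0 1) := by
    intro q
    have hw' : |(w - (Real.log p : ℝ)).im| ≤ Real.pi / 2 := by simpa using hw
    refine integrableOn_Ioo_of_continuousOn_of_norm_le (C := M * ((2 * M) ^ k / k.factorial)) ?_ ?_
    · exact ContinuousOn.mul (by fun_prop) (continuousOn_borelCoeff_sub_log hM k hw')
    · intro t ht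
      rw [norm_mul, norm_pow, Complex.norm_real, Real.norm_eq_abs, abs_of_pos ht.1]
      calc t ^ q * _ ≤ 1 * (M * ((2 * M) ^ k / k.factorial)) := by
            gcongr
            · exact pow_le_one₀ ht.1.le ht.2.le
            · exact norm_borelCoeff_sub_log_le hM k hw' _
        _ = _ := one_mul _
  rw [setIntegral_Ioo_eq_mul hp, powAvg_eq, powAvg_eq, ← integral_add (hint _) (hint _),
    ← integral_const_mul, ← integral_const_mul]
  refine setIntegral_congr_fun measurableSet_Ioo fun t ht => ?_
  have hlog : w - ((Real.log (p * t) : ℝ) : ℂ) =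
      w - (Real.log p : ℝ) - (Real.log t : ℝ) := by
    rw [Real.log_mul hp.ne' ht.1.ne']
    push_cast
    ring
  simp only [hlog]
  push_cast
  ring

/-- The Volterra equation of the Borel transform,
`p (p + z) B(p) = M (p² + ∫₀^p (p² + q²) B(q) dq)`; it is the Borel transform of the radial
equation, see `laplace_equation`. -/
theorem borel_volterra {M : ℝ} (hM : 0 < M) {w : ℂ} (hw : |w.im| ≤ Real.pi / 2) {p : ℝ}
    (hp : 0 < p) :
    (p : ℂ) * (p + Complex.exp w) * borel M w p =
      M * ((p : ℂ) ^ 2 + ∫ q in Ioo 0 p, ((p : ℂ) ^ 2 + (q : ℂ) ^ 2) * borel M w q) := by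
  have hpc : (p : ℂ) ≠ 0 := by exact_mod_cast hp.ne'
  have hexp : Complex.exp (w - (Real.log p : ℝ)) = Complex.exp w / p := by
    rw [Complex.exp_sub, ← Complex.ofReal_exp, Real.exp_log hp]
  have hne : 1 + Complex.exp (w - (Real.log p : ℝ)) ≠ 0 := by
    refine one_add_exp_ne_zero (δ := Real.pi / 4) (by positivity) (by linarith [Real.pi_pos]) ?_
    refine sub_ofReal_mem_strip (show |w.im| < _ by linarith [Real.pi_pos]) _
  set I : ℕ → ℂ := fun k => ∫ q in Ioo 0 p, ((p : ℂ) ^ 2 + (q : ℂ) ^ 2) *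
    ((q : ℂ) ^ k * borelCoeff M k (w - (Real.log q : ℝ))) with hI
  have hbound : ∀ k, ∀ q ∈ Ioo 0 p, ‖((p : ℂ) ^ 2 + (q : ℂ) ^ 2) *
      ((q : ℂ) ^ k * borelCoeff M k (w - (Real.log q : ℝ)))‖ ≤
        (p ^ 2 + p ^ 2) * (M * ((2 * M * p) ^ k / k.factorial)) := by
    intro k q hq
    have hq0 := hq.1
    have hq1 := hq.2
    rw [norm_mul]
    refine mul_le_mul ?_ ((norm_pow_mul_borelCoeff_le hM k hw hq.1.le).trans ?_)
      (norm_nonneg _) (by positivity)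
    · refine (norm_add_le _ _).trans ?_
      simp only [norm_pow, Complex.norm_real, Real.norm_eq_abs, sq_abs]
      gcongr
    · gcongr
  have hcont : ∀ k, ContinuousOn (fun q : ℝ => ((p : ℂ) ^ 2 + (q : ℂ) ^ 2) *
      ((q : ℂ) ^ k * borelCoeff M k (w - (Real.log q : ℝ)))) (Ioi 0) := fun k =>
    ContinuousOn.mul (by fun_prop)
      (ContinuousOn.mul (by fun_prop) (continuousOn_borelCoeff_sub_log hM k hw))
  have hsumI : HasSum I (∫ q in Ioo 0 p, ((p : ℂ) ^ 2 + (q : ℂ) ^ 2) * borel M w q) := by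
    have h := hasSum_integral_of_summable_integral_norm (μ := volume.restrict (Ioo 0 p))
      (F := fun (k : ℕ) (q : ℝ) => ((p : ℂ) ^ 2 + (q : ℂ) ^ 2) *
        ((q : ℂ) ^ k * borelCoeff M k (w - (Real.log q : ℝ))))
      (fun k => integrableOn_Ioo_of_continuousOn_of_norm_le (hcont k) (hbound k)) ?_
    · have h2 : ∫ q in Ioo 0 p, ((p : ℂ) ^ 2 + (q : ℂ) ^ 2) * borel M w q =
          ∫ q in Ioo 0 p, ∑' k : ℕ, ((p : ℂ) ^ 2 + (q : ℂ) ^ 2) *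
            ((q : ℂ) ^ k * borelCoeff M k (w - (Real.log q : ℝ))) :=
        setIntegral_congr_fun measurableSet_Ioo fun q hq =>
          ((hasSum_borel hM hw hq.1.le).mul_left _).tsum_eq.symm
      rw [h2]
      exact h
    · refine Summable.of_nonneg_of_le (fun k => integral_nonneg fun q => norm_nonneg _)
        (fun k => ?_) ((summable_borel_bound M p).mul_left ((p ^ 2 + p ^ 2) * p))
      have h1 : ∫ q in Ioo 0 p, ‖((p : ℂ) ^ 2 + (q : ℂ) ^ 2) *
          ((q : ℂ) ^ k * borelCoeff M k (w - (Real.log q : ℝ)))‖ ≤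
          ∫ q in Ioo 0 p, (p ^ 2 + p ^ 2) * (M * ((2 * M * p) ^ k / k.factorial)) := by
        refine setIntegral_mono_on
          (integrableOn_Ioo_of_continuousOn_of_norm_le (hcont k) (hbound k)).norm
          (integrableOn_const (by simp)) measurableSet_Ioo (hbound k)
      refine h1.trans_eq ?_
      rw [setIntegral_const, Real.volume_real_Ioo_of_le hp.le, smul_eq_mul]
      ring
  have hB := hasSum_borel hM hw hp.le
  have hB' := (hasSum_nat_add_iff' 1).mpr hB
  have hstep : ∀ k, (p : ℂ) ^ (k + 1) * borelCoeff M (k + 1) (w - (Real.log p : ℝ)) =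
      M / (p * (p + Complex.exp w)) * I k := by
    intro k
    rw [hI]
    simp only
    rw [integral_sq_add_sq_mul_component hM k hw hp, borelCoeff]
    rw [hexp] at hne ⊢
    have : (p : ℂ) + Complex.exp w ≠ 0 := by
      intro h
      apply hne
      field_simp
      rw [h, mul_zero]
    field_simp
    ring
  simp_rw [hstep] at hB'
  have huniq := hB'.unique (hsumI.mul_left _)
  simp only [Finset.range_one, Finset.sum_singleton, pow_zero, one_mul, borelCoeff] at huniq
  rw [hexp] at hne huniq
  have hne' : (p : ℂ) + Complex.exp w ≠ 0 := by
    intro h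
    apply hne
    field_simp
    rw [h, mul_zero]
  rw [sub_eq_iff_eq_add] at huniq
  rw [huniq]
  field_simp
  ring

/-! ### The Laplace transform of the Borel transform -/

theorem integrableOn_pow_mul_exp_neg (j : ℕ) {c : ℝ} (hc : 0 < c) :
    IntegrableOn (fun p : ℝ => p ^ j * Real.exp (-(c * p))) (Ioi 0) := by
  have h := integrableOn_rpow_mul_exp_neg_mul_rpow (p := 1) (s := j) (b := c)
    (by have : (0 : ℝ) ≤ j := j.cast_nonneg
        linarith) one_pos hc
  refine h.congr_fun (fun p hp => ?_) measurableSet_Ioi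
  simp

theorem integral_pow_mul_exp_neg (j : ℕ) {c : ℝ} (hc : 0 < c) :
    ∫ p in Ioi (0 : ℝ), p ^ j * Real.exp (-(c * p)) = j.factorial / c ^ (j + 1) := by
  have h := Real.integral_rpow_mul_exp_neg_mul_Ioi (a := (j : ℝ) + 1) (r := c) (by positivity) hc
  rw [Real.Gamma_nat_eq_factorial] at h
  have e : ((j : ℝ) + 1) = ((j + 1 : ℕ) : ℝ) := by push_cast; ring
  rw [add_sub_cancel_right, e, Real.rpow_natCast, one_div, inv_pow] at h
  simp only [Real.rpow_natCast] at h
  rw [h]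
  ring

/-- The moments `∫₀^∞ p ^ j e ^ (-p r) B(p) dp` of the Borel transform `B = borel M w`; up to sign
these are the derivatives of its Laplace transform. -/
noncomputable def laplaceBorel (M : ℝ) (w : ℂ) (j : ℕ) (r : ℝ) : ℂ :=
  ∫ p in Ioi (0 : ℝ), (p : ℂ) ^ j * Complex.exp (-(p * r)) * borel M w p

theorem norm_laplace_integrand_le {M : ℝ} (hM : 0 < M) {w : ℂ} (hw : |w.im| ≤ Real.pi / 2)
    (j : ℕ) (r : ℝ) {p : ℝ} (hp : 0 ≤ p) :
    ‖(p : ℂ) ^ j * Complex.exp (-(p * r)) * borel M w p‖ ≤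
      M * (p ^ j * Real.exp (-((r - 2 * M) * p))) := by
  have h1 : ‖Complex.exp (-((p : ℂ) * r))‖ = Real.exp (-(p * r)) := by
    rw [Complex.norm_exp]; simp
  have h2 : Real.exp (-((r - 2 * M) * p)) = Real.exp (-(p * r)) * Real.exp (2 * M * p) := by
    rw [← Real.exp_add]; congr 1; ring
  rw [norm_mul, norm_mul, norm_pow, Complex.norm_real, Real.norm_eq_abs, abs_of_nonneg hp, h1, h2]
  calc p ^ j * Real.exp (-(p * r)) * ‖borel M w p‖
      ≤ p ^ j * Real.exp (-(p * r)) * (M * Real.exp (2 * M * p)) := by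
        gcongr
        exact norm_borel_le hM hw hp
    _ = _ := by ring

theorem aestronglyMeasurable_laplace_integrand {M : ℝ} (hM : 0 < M) {w : ℂ}
    (hw : |w.im| ≤ Real.pi / 2) (j : ℕ) (r : ℝ) :
    AEStronglyMeasurable (fun p : ℝ => (p : ℂ) ^ j * Complex.exp (-(p * r)) * borel M w p)
      (volume.restrict (Ioi 0)) := by
  refine ContinuousOn.aestronglyMeasurable ?_ measurableSet_Ioi
  exact ContinuousOn.mul (by fun_prop) (continuousOn_borel hM hw)

theorem integrableOn_laplace {M : ℝ} (hM : 0 < M) {w : ℂ} (hw : |w.im| ≤ Real.pi / 2) (j : ℕ)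
    {r : ℝ} (hr : 2 * M < r) :
    IntegrableOn (fun p : ℝ => (p : ℂ) ^ j * Complex.exp (-(p * r)) * borel M w p) (Ioi 0) := by
  refine Integrable.mono' ((integrableOn_pow_mul_exp_neg j (sub_pos.mpr hr)).const_mul M)
    (aestronglyMeasurable_laplace_integrand hM hw j r) ?_
  filter_upwards [ae_restrict_mem measurableSet_Ioi] with p hp
  exact norm_laplace_integrand_le hM hw j r (le_of_lt hp)

theorem norm_laplaceBorel_le {M : ℝ} (hM : 0 < M) {w : ℂ} (hw : |w.im| ≤ Real.pi / 2) (j : ℕ)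
    {r : ℝ} (hr : 2 * M < r) :
    ‖laplaceBorel M w j r‖ ≤ M * (j.factorial / (r - 2 * M) ^ (j + 1)) := by
  rw [← integral_pow_mul_exp_neg j (sub_pos.mpr hr), ← integral_const_mul]
  refine norm_integral_le_of_norm_le
    ((integrableOn_pow_mul_exp_neg j (sub_pos.mpr hr)).const_mul M) ?_
  filter_upwards [ae_restrict_mem measurableSet_Ioi] with p hp
  exact norm_laplace_integrand_le hM hw j r (le_of_lt hp)

theorem tendsto_laplaceBorel {M : ℝ} (hM : 0 < M) {w : ℂ} (hw : |w.im| ≤ Real.pi / 2) (j : ℕ) :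
    Tendsto (laplaceBorel M w j) atTop (𝓝 0) := by
  have h : Tendsto (fun r : ℝ => M * (j.factorial / (r - 2 * M) ^ (j + 1))) atTop (𝓝 0) := by
    rw [← mul_zero M]
    refine Tendsto.const_mul M (Tendsto.const_div_atTop ?_ _)
    refine (tendsto_pow_atTop (Nat.succ_ne_zero j)).comp ?_
    exact tendsto_atTop_add_const_right _ (-(2 * M)) tendsto_id
  refine squeeze_zero_norm' ?_ h
  filter_upwards [Ioi_mem_atTop (2 * M)] with r hr
  exact norm_laplaceBorel_le hM hw j hr

theorem hasDerivAt_laplaceBorel {M : ℝ} (hM : 0 < M) {w : ℂ} (hw : |w.im| ≤ Real.pi / 2) (j : ℕ)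
    {r : ℝ} (hr : 2 * M < r) :
    HasDerivAt (laplaceBorel M w j) (-laplaceBorel M w (j + 1) r) r := by
  set s := (2 * M + r) / 2 with hs
  have hs1 : 2 * M < s := by rw [hs]; linarith
  have hs2 : s < r := by rw [hs]; linarith
  have key := hasDerivAt_integral_of_dominated_loc_of_deriv_le
    (μ := volume.restrict (Ioi (0 : ℝ))) (𝕜 := ℝ)
    (F := fun (x : ℝ) (p : ℝ) => (p : ℂ) ^ j * Complex.exp (-(p * x)) * borel M w p)
    (F' := fun (x : ℝ) (p : ℝ) =>
      -((p : ℂ) ^ (j + 1) * Complex.exp (-(p * x)) * borel M w p))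
    (x₀ := r) (s := Ioi s)
    (bound := fun p => M * (p ^ (j + 1) * Real.exp (-((s - 2 * M) * p))))
    (Ioi_mem_nhds hs2) ?_ ?_ ?_ ?_ ?_ ?_
  · have h := key.2
    rw [integral_neg] at h
    exact h
  · exact Eventually.of_forall fun x => aestronglyMeasurable_laplace_integrand hM hw j x
  · exact integrableOn_laplace hM hw j hr
  · exact (aestronglyMeasurable_laplace_integrand hM hw (j + 1) r).neg
  · filter_upwards [ae_restrict_mem measurableSet_Ioi] with p hp x hx
    have hp0 : (0 : ℝ) < p := hp
    have hx0 : s < x := hx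
    rw [norm_neg]
    refine (norm_laplace_integrand_le hM hw (j + 1) x hp0.le).trans ?_
    gcongr
  · exact (integrableOn_pow_mul_exp_neg _ (sub_pos.mpr hs1)).const_mul M
  · refine ae_of_all _ fun p x _ => ?_
    have h1 : HasDerivAt (fun x : ℝ => -((p : ℂ) * x)) (-(p : ℂ)) x := by
      have h0 : HasDerivAt (fun x : ℝ => (x : ℂ)) 1 x := Complex.ofRealCLM.hasDerivAt
      simpa using (h0.const_mul (p : ℂ)).fun_neg
    have h2 := ((h1.cexp).const_mul ((p : ℂ) ^ j)).mul_const (borel M w p)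
    refine h2.congr_deriv ?_
    ring

/-- Laplace transform of the Volterra equation `borel_volterra`. The contribution of the integral
operator is evaluated by exhibiting a primitive of the difference of both sides. -/
theorem laplace_equation {M : ℝ} (hM : 0 < M) {w : ℂ} (hw : |w.im| ≤ Real.pi / 2)
    {r : ℝ} (hr : 2 * M < r) :
    laplaceBorel M w 2 r + Complex.exp w * laplaceBorel M w 1 r =
      2 * M * ((1 + laplaceBorel M w 0 r) / (r : ℂ) ^ 3 + laplaceBorel M w 1 r / (r : ℂ) ^ 2 +
        laplaceBorel M w 2 r / r) := by
  have hr0 : 0 < r := by linarith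
  have hrc : (r : ℂ) ≠ 0 := by exact_mod_cast hr0.ne'
  have hMc : (M : ℂ) ≠ 0 := by exact_mod_cast hM.ne'
  set B := borel M w with hB
  have hBc : ContinuousOn B (Ioi 0) := continuousOn_borel hM hw
  have hint : ∀ (a : ℕ) (p : ℝ), 0 ≤ p →
      IntervalIntegrable (fun q : ℝ => (q : ℂ) ^ a * B q) volume 0 p := by
    intro a p hp
    rw [intervalIntegrable_iff_integrableOn_Ioo_of_le hp]
    refine integrableOn_Ioo_of_continuousOn_of_norm_le (C := p ^ a * (M * Real.exp (2 * M * p)))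
      (ContinuousOn.mul (by fun_prop) hBc) fun q hq => ?_
    rw [norm_mul, norm_pow, Complex.norm_real, Real.norm_eq_abs, abs_of_pos hq.1]
    have h0 := hq.1
    have h1 := hq.2
    refine mul_le_mul (by gcongr) ((norm_borel_le hM hw hq.1.le).trans (by gcongr))
      (norm_nonneg _) (by positivity)
  -- the integral term of the Volterra equation is `p ^ 2 * P 0 p + P 2 p`
  set P : ℕ → ℝ → ℂ := fun a p => ∫ q in (0 : ℝ)..p, (q : ℂ) ^ a * B q with hP
  have hPd : ∀ a, ∀ p ∈ Ioi (0 : ℝ), HasDerivAt (P a) ((p : ℂ) ^ a * B p) p := by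
    intro a p hp
    have hc : ContinuousOn (fun q : ℝ => (q : ℂ) ^ a * B q) (Ioi 0) :=
      ContinuousOn.mul (by fun_prop) hBc
    exact intervalIntegral.integral_hasDerivAt_right (hint a p (le_of_lt hp))
      (hc.stronglyMeasurableAtFilter isOpen_Ioi p hp) (hc.continuousAt (Ioi_mem_nhds hp))
  have hPn : ∀ a, ∀ p : ℝ, 0 ≤ p → ‖P a p‖ ≤ M * Real.exp (2 * M * p) * p ^ (a + 1) := by
    intro a p hp
    have h := intervalIntegral.norm_integral_le_of_norm_le_const (a := 0) (b := p)
      (f := fun q : ℝ => (q : ℂ) ^ a * B q) (C := M * Real.exp (2 * M * p) * p ^ a) ?_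
    · rw [sub_zero, abs_of_nonneg hp] at h
      refine h.trans_eq ?_
      ring
    · intro q hq
      rw [uIoc_of_le hp] at hq
      have h0 := hq.1
      have h1 := hq.2
      rw [norm_mul, norm_pow, Complex.norm_real, Real.norm_eq_abs, abs_of_pos hq.1, mul_comm]
      refine mul_le_mul ((norm_borel_le hM hw hq.1.le).trans (by gcongr)) (by gcongr)
        (by positivity) (by positivity)
  set K : ℕ → ℝ → ℂ := fun j p => (p : ℂ) ^ j * Complex.exp (-(p * r)) * B p with hK
  have hKint : ∀ j, IntegrableOn (K j) (Ioi 0) := fun j => integrableOn_laplace hM hw j hr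
  have hKI : ∀ j, ∫ p in Ioi (0 : ℝ), K j p = laplaceBorel M w j r := fun j => rfl
  set Q : ℝ → ℂ := fun p => (p : ℂ) ^ 2 * Complex.exp (-(p * r)) with hQ
  have hQeq : ∀ p : ℝ, Q p = ((p ^ 2 * Real.exp (-(r * p)) : ℝ) : ℂ) := by
    intro p
    rw [hQ]
    push_cast
    rw [mul_comm (r : ℂ)]
  have hQint : IntegrableOn Q (Ioi 0) := by
    have := (integrableOn_pow_mul_exp_neg 2 hr0).ofReal (𝕜 := ℂ)
    exact this.congr (ae_of_all _ fun p => (hQeq p).symm)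
  have hQI : ∫ p in Ioi (0 : ℝ), Q p = 2 / (r : ℂ) ^ 3 := by
    simp_rw [hQeq]
    rw [integral_complex_ofReal, integral_pow_mul_exp_neg 2 hr0]
    simp
  -- `Ψ` is minus `e^(-pr) / r` times this term plus corrections that arise on integrating by parts
  set Ψ : ℝ → ℂ := fun p => -(Complex.exp (-(p * r)) *
    (((p : ℂ) ^ 2 / r + 2 * p / (r : ℂ) ^ 2 + 2 / (r : ℂ) ^ 3) * P 0 p + P 2 p / r)) with hΨ
  set f' : ℝ → ℂ := fun p => (K 2 p + Complex.exp w * K 1 p) / M - Q p -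
    (2 / r * K 2 p + 2 / (r : ℂ) ^ 2 * K 1 p + 2 / (r : ℂ) ^ 3 * K 0 p) with hf'
  have hΨd : ∀ p ∈ Ioi (0 : ℝ), HasDerivAt Ψ (f' p) p := by
    intro p hp
    have hvol := borel_volterra hM hw hp
    have hX : ∫ q in Ioo 0 p, ((p : ℂ) ^ 2 + (q : ℂ) ^ 2) * borel M w q =
        (p : ℂ) ^ 2 * P 0 p + P 2 p := by
      rw [hP]
      simp only
      rw [← intervalIntegral.integral_const_mul, ← intervalIntegral.integral_add
        ((hint 0 p (le_of_lt hp)).const_mul _) (hint 2 p (le_of_lt hp)),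
        intervalIntegral.integral_of_le (le_of_lt hp), integral_Ioc_eq_integral_Ioo]
      refine setIntegral_congr_fun measurableSet_Ioo fun q _ => ?_
      simp only [hB]
      ring
    rw [hX] at hvol
    have hid : HasDerivAt (fun p : ℝ => (p : ℂ)) 1 p := Complex.ofRealCLM.hasDerivAt
    have h1 : HasDerivAt (fun p : ℝ => Complex.exp (-((p : ℂ) * r)))
        (Complex.exp (-(p * r)) * (-(1 * (r : ℂ)))) p := ((hid.mul_const (r : ℂ)).neg).cexp
    have h2 : HasDerivAt (fun p : ℝ => (p : ℂ) ^ 2 / r + 2 * p / (r : ℂ) ^ 2 + 2 / (r : ℂ) ^ 3)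
        (2 * p / r + 2 / (r : ℂ) ^ 2) p := by
      have := (((hid.fun_pow 2).div_const (r : ℂ)).add
        ((hid.const_mul (2 : ℂ)).div_const ((r : ℂ) ^ 2))).add_const (2 / (r : ℂ) ^ 3)
      refine this.congr_deriv ?_
      simp
    have h3 := (h1.mul ((h2.mul (hPd 0 p hp)).add ((hPd 2 p hp).div_const (r : ℂ)))).neg
    refine h3.congr_deriv ?_
    have e : (K 2 p + Complex.exp w * K 1 p) / M =
        Q p + Complex.exp (-(p * r)) * ((p : ℂ) ^ 2 * P 0 p + P 2 p) := by
      rw [div_eq_iff hMc]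
      simp only [hK, hQ]
      linear_combination (Complex.exp (-(p * r))) * hvol
    rw [hf']
    simp only [e]
    simp only [hK, Pi.add_apply, Pi.mul_apply]
    field_simp
    ring
  have hf'int : IntegrableOn f' (Ioi 0) :=
    ((((hKint 2).add ((hKint 1).const_mul _)).div_const _).sub hQint).sub
      ((((hKint 2).const_mul _).add ((hKint 1).const_mul _)).add ((hKint 0).const_mul _))
  have hΨn : ∀ p : ℝ, 0 ≤ p → ‖Ψ p‖ ≤ M * Real.exp (-((r - 2 * M) * p)) *
      ((p ^ 2 / r + 2 * p / r ^ 2 + 2 / r ^ 3) * p + p ^ 3 / r) := by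
    intro p hp
    have h1 : ‖Complex.exp (-((p : ℂ) * r))‖ = Real.exp (-(p * r)) := by
      rw [Complex.norm_exp]; simp
    have h2 : Real.exp (-((r - 2 * M) * p)) = Real.exp (-(p * r)) * Real.exp (2 * M * p) := by
      rw [← Real.exp_add]; congr 1; ring
    have h3 : ‖((p : ℂ) ^ 2 / r + 2 * p / (r : ℂ) ^ 2 + 2 / (r : ℂ) ^ 3)‖ =
        p ^ 2 / r + 2 * p / r ^ 2 + 2 / r ^ 3 := by
      have : ((p : ℂ) ^ 2 / r + 2 * p / (r : ℂ) ^ 2 + 2 / (r : ℂ) ^ 3) =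
          ((p ^ 2 / r + 2 * p / r ^ 2 + 2 / r ^ 3 : ℝ) : ℂ) := by push_cast; ring
      rw [this, Complex.norm_real, Real.norm_eq_abs, abs_of_nonneg (by positivity)]
    rw [hΨ]
    simp only
    rw [norm_neg, norm_mul, h1, h2]
    have h4 : ‖((p : ℂ) ^ 2 / r + 2 * p / (r : ℂ) ^ 2 + 2 / (r : ℂ) ^ 3) * P 0 p + P 2 p / r‖ ≤
        (p ^ 2 / r + 2 * p / r ^ 2 + 2 / r ^ 3) * (M * Real.exp (2 * M * p) * p ^ 1) +
          M * Real.exp (2 * M * p) * p ^ 3 / r := by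
      refine (norm_add_le _ _).trans ?_
      rw [norm_mul, h3, norm_div, Complex.norm_real, Real.norm_eq_abs, abs_of_pos hr0]
      gcongr
      · exact hPn 0 p hp
      · exact hPn 2 p hp
    calc _ ≤ Real.exp (-(p * r)) * ((p ^ 2 / r + 2 * p / r ^ 2 + 2 / r ^ 3) *
          (M * Real.exp (2 * M * p) * p ^ 1) + M * Real.exp (2 * M * p) * p ^ 3 / r) := by
            gcongr
      _ = _ := by ring
  have hΨ0 : Ψ 0 = 0 := by simp [hΨ, hP]
  have hΨc : ContinuousWithinAt Ψ (Ici 0) 0 := by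
    rw [ContinuousWithinAt, hΨ0]
    have hc : Continuous fun p : ℝ => M * Real.exp (-((r - 2 * M) * p)) *
      ((p ^ 2 / r + 2 * p / r ^ 2 + 2 / r ^ 3) * p + p ^ 3 / r) := by fun_prop
    have h0 := (hc.tendsto 0).mono_left (nhdsWithin_le_nhds (s := Ici 0))
    simp only [mul_zero, ne_eq, OfNat.ofNat_ne_zero, not_false_eq_true, zero_pow, zero_div,
      add_zero] at h0
    refine squeeze_zero_norm' ?_ h0
    filter_upwards [self_mem_nhdsWithin] with p hp using hΨn p hp
  have hΨlim : Tendsto Ψ atTop (𝓝 0) := by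
    have hpow : ∀ j : ℕ, Tendsto (fun p : ℝ => p ^ j * Real.exp (-((r - 2 * M) * p))) atTop
        (𝓝 0) := by
      intro j
      have := tendsto_rpow_mul_exp_neg_mul_atTop_nhds_zero j (r - 2 * M) (by linarith)
      simpa only [Real.rpow_natCast, neg_mul] using this
    have h0 : Tendsto (fun p : ℝ => M * Real.exp (-((r - 2 * M) * p)) *
        ((p ^ 2 / r + 2 * p / r ^ 2 + 2 / r ^ 3) * p + p ^ 3 / r)) atTop (𝓝 0) := by
      have := (((hpow 3).const_mul (2 * M / r)).add ((hpow 2).const_mul (2 * M / r ^ 2))).add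
        ((hpow 1).const_mul (2 * M / r ^ 3))
      simp only [mul_zero, add_zero] at this
      refine this.congr fun p => ?_
      field_simp
      ring
    refine squeeze_zero_norm' ?_ h0
    filter_upwards [Ici_mem_atTop 0] with p hp using hΨn p hp
  have hI := integral_Ioi_of_hasDerivAt_of_tendsto hΨc hΨd hf'int hΨlim
  have i1 : Integrable (fun p => K 2 p + Complex.exp w * K 1 p) (volume.restrict (Ioi 0)) :=
    (hKint 2).add ((hKint 1).const_mul _)
  have i2 : Integrable (fun p => 2 / (r : ℂ) * K 2 p + 2 / (r : ℂ) ^ 2 * K 1 p)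
      (volume.restrict (Ioi 0)) := ((hKint 2).const_mul _).add ((hKint 1).const_mul _)
  have i3 : Integrable (fun p => 2 / (r : ℂ) * K 2 p + 2 / (r : ℂ) ^ 2 * K 1 p +
      2 / (r : ℂ) ^ 3 * K 0 p) (volume.restrict (Ioi 0)) := i2.add ((hKint 0).const_mul _)
  have i4 : Integrable (fun p => (K 2 p + Complex.exp w * K 1 p) / M - Q p)
      (volume.restrict (Ioi 0)) := (i1.div_const _).sub hQint
  have hI2 : ∫ p in Ioi (0 : ℝ), f' p =
      (laplaceBorel M w 2 r + Complex.exp w * laplaceBorel M w 1 r) / M - 2 / (r : ℂ) ^ 3 -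
      (2 / r * laplaceBorel M w 2 r + 2 / (r : ℂ) ^ 2 * laplaceBorel M w 1 r +
        2 / (r : ℂ) ^ 3 * laplaceBorel M w 0 r) := by
    rw [hf', integral_sub i4 i3, integral_sub (i1.div_const _) hQint, integral_div,
      integral_add (hKint 2) ((hKint 1).const_mul _), integral_add i2 ((hKint 0).const_mul _),
      integral_add ((hKint 2).const_mul _) ((hKint 1).const_mul _), integral_const_mul,
      integral_const_mul, integral_const_mul, integral_const_mul, hKI, hKI, hKI, hQI]
  rw [hI2, hΨ0, sub_zero] at hI
  have h5 : (laplaceBorel M w 2 r + Complex.exp w * laplaceBorel M w 1 r) / M =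
      2 / (r : ℂ) ^ 3 + (2 / r * laplaceBorel M w 2 r + 2 / (r : ℂ) ^ 2 * laplaceBorel M w 1 r +
        2 / (r : ℂ) ^ 3 * laplaceBorel M w 0 r) := by
    linear_combination hI
  rw [div_eq_iff hMc] at h5
  rw [h5]
  field_simp
  ring

/-! ### The Schwarzschild radius and the potential -/

theorem strictMonoOn_reggeWheeler {M : ℝ} (hM : 0 < M) :
    StrictMonoOn (reggeWheeler M) (Ioi (2 * M)) := by
  intro r hr s _ hrs
  have h2M : 0 < 2 * M := by positivity
  have h1 : 0 < r / (2 * M) - 1 := by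
    rw [sub_pos, one_lt_div h2M]
    exact hr
  have h2 : r / (2 * M) - 1 < s / (2 * M) - 1 := by
    gcongr
  have h3 := Real.log_lt_log h1 h2
  unfold reggeWheeler
  gcongr

theorem strictMono_radius {M : ℝ} (hM : 0 < M) : StrictMono (radius M) := by
  intro u v huv
  by_contra! h
  have := (strictMonoOn_reggeWheeler hM).monotoneOn (two_mul_lt_radius hM v)
    (two_mul_lt_radius hM u) h
  rw [reggeWheeler_radius hM, reggeWheeler_radius hM] at this
  linarith

theorem radius_reggeWheeler {M r : ℝ} (hM : 0 < M) (hr : 2 * M < r) :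
    radius M (reggeWheeler M r) = r :=
  (bijOn_reggeWheeler hM).injOn (two_mul_lt_radius hM _) hr (reggeWheeler_radius hM _)

theorem radius_pos {M : ℝ} (hM : 0 < M) (u : ℝ) : 0 < radius M u := by
  have := two_mul_lt_radius hM u
  linarith

theorem continuous_radius {M : ℝ} (hM : 0 < M) : Continuous (radius M) := by
  have h : Continuous fun u => (⟨radius M u, two_mul_lt_radius hM u⟩ : Ioi (2 * M)) := by
    refine Monotone.continuous_of_surjective (fun u v huv => (strictMono_radius hM).monotone huv) ?_
    rintro ⟨r, hr⟩
    exact ⟨reggeWheeler M r, Subtype.ext (radius_reggeWheeler hM hr)⟩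
  exact continuous_subtype_val.comp h

theorem tendsto_radius {M : ℝ} (hM : 0 < M) : Tendsto (radius M) atTop atTop := by
  refine (strictMono_radius hM).monotone.tendsto_atTop_atTop fun b => ?_
  refine ⟨reggeWheeler M (max b (3 * M)), ?_⟩
  rw [radius_reggeWheeler hM (lt_max_of_lt_right (by linarith))]
  exact le_max_left _ _

theorem hasDerivAt_radius {M : ℝ} (hM : 0 < M) (u : ℝ) :
    HasDerivAt (radius M) (1 - 2 * M / radius M u) u := by
  set r := radius M u with hr
  have h1 : 2 * M < r := two_mul_lt_radius hM u
  have h0 : r - 2 * M ≠ 0 := by linarith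
  have hr0 : r ≠ 0 := (radius_pos hM u).ne'
  have h2 : r / (2 * M) - 1 ≠ 0 := by
    have : r / (2 * M) - 1 = (r - 2 * M) / (2 * M) := by field_simp
    rw [this]
    positivity
  have h3 : HasDerivAt (reggeWheeler M) (r / (r - 2 * M)) r := by
    have := (hasDerivAt_id r).add (((((hasDerivAt_id r).div_const (2 * M)).sub_const 1).log
      h2).const_mul (2 * M))
    refine this.congr_deriv ?_
    have h4 : (id r / (2 * M) - 1 : ℝ) = (r - 2 * M) / (2 * M) := by
      simp only [id]; field_simp
    rw [h4]
    field_simp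
    ring
  have h5 := HasDerivAt.of_local_left_inverse (continuous_radius hM).continuousAt h3
    (div_ne_zero hr0 h0) (Eventually.of_forall (reggeWheeler_radius hM))
  refine h5.congr_deriv ?_
  field_simp

theorem potential_zero_eq (M u : ℝ) :
    potential M 0 u = (1 - 2 * M / radius M u) * (2 * M / radius M u ^ 3) := by
  simp [potential]

theorem one_sub_div_radius_nonneg {M : ℝ} (hM : 0 < M) (u : ℝ) : 0 ≤ 1 - 2 * M / radius M u := by
  rw [sub_nonneg, div_le_one (radius_pos hM u)]
  exact (two_mul_lt_radius hM u).le

theorem potential_zero_nonneg {M : ℝ} (hM : 0 < M) (u : ℝ) : 0 ≤ potential M 0 u := by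
  rw [potential_zero_eq]
  have := radius_pos hM u
  exact mul_nonneg (one_sub_div_radius_nonneg hM u) (by positivity)

theorem continuous_potential_zero {M : ℝ} (hM : 0 < M) : Continuous (potential M 0) := by
  have h : potential M 0 = fun u => (1 - 2 * M / radius M u) * (2 * M / radius M u ^ 3) :=
    funext (potential_zero_eq M)
  have hr := continuous_radius hM
  have h0 : ∀ u, radius M u ≠ 0 := fun u => (radius_pos hM u).ne'
  rw [h]
  refine Continuous.mul (continuous_const.sub (continuous_const.div hr h0))
    (continuous_const.div (hr.pow 3) fun u => pow_ne_zero 3 (h0 u))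

/-- The tail `∫_u^∞ V₀` of the potential equals `M / r(u)²`. -/
noncomputable def potentialTail (M u : ℝ) : ℝ := M / radius M u ^ 2

theorem potentialTail_nonneg {M : ℝ} (hM : 0 < M) (u : ℝ) : 0 ≤ potentialTail M u := by
  unfold potentialTail; positivity

theorem hasDerivAt_potentialTail {M : ℝ} (hM : 0 < M) (u : ℝ) :
    HasDerivAt (potentialTail M) (-potential M 0 u) u := by
  have h0 : radius M u ≠ 0 := (radius_pos hM u).ne'
  have := (hasDerivAt_const u M).div ((hasDerivAt_radius hM u).pow 2) (pow_ne_zero 2 h0)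
  refine this.congr_deriv ?_
  rw [potential_zero_eq]
  simp only [Pi.pow_apply]
  field_simp
  ring

theorem tendsto_potentialTail {M : ℝ} (hM : 0 < M) : Tendsto (potentialTail M) atTop (𝓝 0) :=
  Tendsto.const_div_atTop ((tendsto_pow_atTop two_ne_zero).comp (tendsto_radius hM)) _

theorem potential_mul_tail_pow {M : ℝ} (hM : 0 < M) (m : ℕ) (u : ℝ) :
    IntegrableOn (fun v => potential M 0 v * potentialTail M v ^ m) (Ioi u) ∧
      ∫ v in Ioi u, potential M 0 v * potentialTail M v ^ m =
        potentialTail M u ^ (m + 1) / (m + 1) := by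
  have hd : ∀ v ∈ Ici u, HasDerivAt (fun v => -(potentialTail M v ^ (m + 1) / (m + 1)))
      (potential M 0 v * potentialTail M v ^ m) v := by
    intro v _
    have h := (((hasDerivAt_potentialTail hM v).fun_pow (m + 1)).div_const ((m : ℝ) + 1)).fun_neg
    refine h.congr_deriv ?_
    push_cast
    field_simp
  have hpos : ∀ v ∈ Ioi u, 0 ≤ potential M 0 v * potentialTail M v ^ m := fun v _ =>
    mul_nonneg (potential_zero_nonneg hM v) (pow_nonneg (potentialTail_nonneg hM v) m)
  have hlim : Tendsto (fun v => -(potentialTail M v ^ (m + 1) / (m + 1))) atTop (𝓝 0) := by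
    have := (((tendsto_potentialTail hM).pow (m + 1)).div_const ((m : ℝ) + 1)).neg
    simpa using this
  refine ⟨integrableOn_Ioi_deriv_of_nonneg' hd hpos hlim, ?_⟩
  rw [integral_Ioi_of_hasDerivAt_of_nonneg' hd hpos hlim]
  simp

/-! ### The Jost series as a Picard iteration -/

theorem norm_jost_kernel_le {ω : ℝ} (u v : ℝ) :
    ‖1 / (ω : ℂ) * Complex.sin (ω * ((u : ℂ) - v))‖ ≤ 1 / |ω| := by
  have h : Complex.sin (ω * ((u : ℂ) - v)) = ((Real.sin (ω * (u - v)) : ℝ) : ℂ) := by push_cast; rfl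
  rw [h, norm_mul, norm_div, norm_one, Complex.norm_real, Complex.norm_real, Real.norm_eq_abs,
    Real.norm_eq_abs]
  exact mul_le_of_le_one_right (by positivity) (Real.abs_sin_le_one _)

theorem integrableOn_jost_kernel_mul {M ω : ℝ} (hM : 0 < M) {h : ℝ → ℂ}
    (hh : StronglyMeasurable h) {u u₀ C : ℝ} (hu : u₀ ≤ u) (m : ℕ)
    (hb : ∀ v, u₀ ≤ v → ‖h v‖ ≤ C * potentialTail M v ^ m) :
    IntegrableOn (fun v : ℝ => 1 / (ω : ℂ) * Complex.sin (ω * ((u : ℂ) - v)) *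
      (potential M 0 v : ℂ) * h v) (Ioi u) ∧
    ‖∫ v in Ioi u, 1 / (ω : ℂ) * Complex.sin (ω * ((u : ℂ) - v)) *
      (potential M 0 v : ℂ) * h v‖ ≤ C / (|ω| * (m + 1)) * potentialTail M u ^ (m + 1) := by
  have hbd : ∀ v ∈ Ioi u, ‖1 / (ω : ℂ) * Complex.sin (ω * ((u : ℂ) - v)) *
      (potential M 0 v : ℂ) * h v‖ ≤
        C / |ω| * (potential M 0 v * potentialTail M v ^ m) := by
    intro v hv
    have hv' : u < v := hv
    rw [norm_mul, norm_mul _ (potential M 0 v : ℂ), Complex.norm_real, Real.norm_eq_abs,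
      abs_of_nonneg (potential_zero_nonneg hM v)]
    calc _ ≤ 1 / |ω| * potential M 0 v * (C * potentialTail M v ^ m) := by
          have := potential_zero_nonneg hM v
          gcongr
          · exact norm_jost_kernel_le u v
          · exact hb v (by linarith)
      _ = _ := by ring
  obtain ⟨hi, hv⟩ := potential_mul_tail_pow hM m u
  have hmeas : AEStronglyMeasurable (fun v : ℝ => 1 / (ω : ℂ) *
      Complex.sin (ω * ((u : ℂ) - v)) * (potential M 0 v : ℂ) * h v)
      (volume.restrict (Ioi u)) := by
    have hc : Continuous fun v : ℝ => 1 / (ω : ℂ) * Complex.sin (ω * ((u : ℂ) - v)) *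
        (potential M 0 v : ℂ) := by
      have := continuous_potential_zero hM
      fun_prop
    exact (hc.stronglyMeasurable.mul hh).aestronglyMeasurable
  constructor
  · refine Integrable.mono' (hi.const_mul (C / |ω|)) hmeas ?_
    filter_upwards [ae_restrict_mem measurableSet_Ioi] with v hv using hbd v hv
  · refine (norm_integral_le_of_norm_le (hi.const_mul (C / |ω|)) ?_).trans_eq ?_
    · filter_upwards [ae_restrict_mem measurableSet_Ioi] with v hv using hbd v hv
    · rw [integral_const_mul, hv]
      rw [div_mul_div_comm, div_mul_eq_mul_div]

theorem stronglyMeasurable_jostIterate {M ω : ℝ} (hM : 0 < M) (k : ℕ) :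
    StronglyMeasurable (jostIterate M 0 ω k) := by
  induction k with
  | zero =>
    have : Continuous fun u : ℝ => Complex.exp (-Complex.I * ω * u) := by fun_prop
    exact this.stronglyMeasurable
  | succ k ih =>
    have hV := continuous_potential_zero hM
    have h1 : StronglyMeasurable fun x : ℝ × ℝ => 1 / (ω : ℂ) *
        Complex.sin (ω * ((x.1 : ℂ) - x.2)) * (potential M 0 x.2 : ℂ) *
          jostIterate M 0 ω k x.2 := by
      have hc : Continuous fun x : ℝ × ℝ => 1 / (ω : ℂ) *
        Complex.sin (ω * ((x.1 : ℂ) - x.2)) * (potential M 0 x.2 : ℂ) := by fun_prop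
      exact hc.stronglyMeasurable.mul (ih.comp_measurable measurable_snd)
    have h2 : MeasurableSet {x : ℝ × ℝ | x.1 < x.2} :=
      measurableSet_lt measurable_fst measurable_snd
    have h3 := ((h1.indicator h2).integral_prod_right' (ν := volume)).neg
    convert h3 using 1
    funext u
    simp only [jostIterate, Pi.neg_apply]
    rw [← integral_indicator measurableSet_Ioi]
    rfl

theorem norm_jostIterate_le {M ω : ℝ} (hM : 0 < M) (k : ℕ) (u : ℝ) :
    ‖jostIterate M 0 ω k u‖ ≤ 1 / (|ω| ^ k * k.factorial) * potentialTail M u ^ k := by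
  induction k generalizing u with
  | zero =>
    have h : ‖Complex.exp (-Complex.I * ω * u)‖ = 1 := by
      rw [Complex.norm_exp]; simp
    simpa [jostIterate] using h.le
  | succ k ih =>
    have := (integrableOn_jost_kernel_mul (ω := ω) hM (stronglyMeasurable_jostIterate hM k)
      (le_refl u) k fun v _ => ih v).2
    rw [jostIterate, norm_neg]
    refine this.trans_eq ?_
    rw [Nat.factorial_succ, div_div]
    congr 2
    push_cast
    ring

/-- A bounded solution of the Jost integral equation is the sum of the Jost series: the `m`-th
remainder is the `m`-fold integral operator applied to the solution, hence of size
`(M / (r² |ω|)) ^ m / m!`. -/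
theorem hasSum_jostIterate {M ω : ℝ} (hM : 0 < M) {φ : ℝ → ℂ} (hφ : Continuous φ) {u₀ C : ℝ}
    (hC : ∀ v, u₀ ≤ v → ‖φ v‖ ≤ C)
    (heq : ∀ u, φ u = Complex.exp (-Complex.I * ω * u) -
      ∫ v in Ioi u, 1 / (ω : ℂ) * Complex.sin (ω * ((u : ℂ) - v)) *
        (potential M 0 v : ℂ) * φ v) :
    HasSum (fun k => jostIterate M 0 ω k u₀) (φ u₀) := by
  have hfact : ∀ x : ℝ, Summable fun k : ℕ => 1 / (|ω| ^ k * k.factorial) * x ^ k := by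
    intro x
    refine (Real.summable_pow_div_factorial (x / |ω|)).congr fun k => ?_
    rw [div_pow, div_div]
    ring
  set ρ : ℕ → ℝ → ℂ := fun m u => φ u - ∑ k ∈ Finset.range m, jostIterate M 0 ω k u with hρ
  have hρm : ∀ m, StronglyMeasurable (ρ m) := fun m =>
    hφ.stronglyMeasurable.sub
      (Finset.stronglyMeasurable_fun_sum _ fun k _ => stronglyMeasurable_jostIterate hM k)
  have hρb : ∀ m, ∀ u, u₀ ≤ u →
      ‖ρ m u‖ ≤ C / (|ω| ^ m * m.factorial) * potentialTail M u ^ m := by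
    intro m
    induction m with
    | zero => intro u hu; simpa [hρ] using hC u hu
    | succ m ih =>
      intro u hu
      have hstep : ρ (m + 1) u = -∫ v in Ioi u, 1 / (ω : ℂ) * Complex.sin (ω * ((u : ℂ) - v)) *
          (potential M 0 v : ℂ) * ρ m v := by
        have hint : ∀ k, IntegrableOn (fun v : ℝ => 1 / (ω : ℂ) *
            Complex.sin (ω * ((u : ℂ) - v)) * (potential M 0 v : ℂ) * jostIterate M 0 ω k v)
            (Ioi u) := fun k =>
          (integrableOn_jost_kernel_mul hM (stronglyMeasurable_jostIterate hM k) le_rfl k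
            fun v _ => norm_jostIterate_le hM k v).1
        have hintφ : IntegrableOn (fun v : ℝ => 1 / (ω : ℂ) *
            Complex.sin (ω * ((u : ℂ) - v)) * (potential M 0 v : ℂ) * φ v) (Ioi u) :=
          (integrableOn_jost_kernel_mul hM hφ.stronglyMeasurable hu 0
            fun v hv => by simpa using hC v hv).1
        have e : ∀ v : ℝ, 1 / (ω : ℂ) * Complex.sin (ω * ((u : ℂ) - v)) *
            (potential M 0 v : ℂ) * ρ m v = 1 / (ω : ℂ) * Complex.sin (ω * ((u : ℂ) - v)) *
            (potential M 0 v : ℂ) * φ v - ∑ k ∈ Finset.range m, 1 / (ω : ℂ) *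
            Complex.sin (ω * ((u : ℂ) - v)) * (potential M 0 v : ℂ) * jostIterate M 0 ω k v :=
          fun v => by rw [← Finset.mul_sum, ← mul_sub]
        simp_rw [e]
        simp only [hρ]
        rw [integral_sub hintφ (integrable_finsetSum _ fun k _ => hint k),
          integral_finsetSum _ fun k _ => hint k, heq u, Finset.sum_range_succ']
        simp only [jostIterate, Finset.sum_neg_distrib]
        ring
      rw [hstep, norm_neg]
      refine (integrableOn_jost_kernel_mul hM (hρm m) hu m ih).2.trans_eq ?_
      rw [Nat.factorial_succ, div_div]
      congr 2
      push_cast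
      ring
  have hsum : Summable fun k => jostIterate M 0 ω k u₀ :=
    Summable.of_norm_bounded (hfact (potentialTail M u₀)) fun k => norm_jostIterate_le hM k u₀
  rw [hsum.hasSum_iff_tendsto_nat]
  have hlim : Tendsto (fun m => ρ m u₀) atTop (𝓝 0) := by
    have h := ((hfact (potentialTail M u₀)).tendsto_atTop_zero).const_mul C
    rw [mul_zero] at h
    refine squeeze_zero_norm (fun m => (hρb m u₀ le_rfl).trans_eq ?_) h
    ring
  have h2 := hlim.const_sub (φ u₀)
  simpa [hρ] using h2

/-- A solution of the Schrödinger equation with the Jost asymptotics at `+∞` satisfies the Jost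
integral equation. -/
theorem jost_integral_equation {M ω : ℝ} (hM : 0 < M) (hω : ω ≠ 0) {φ φ' : ℝ → ℂ}
    (hd : ∀ u, HasDerivAt φ (φ' u) u)
    (hd' : ∀ u, HasDerivAt φ' (((potential M 0 u : ℂ) - (ω : ℂ) ^ 2) * φ u) u)
    (hlim : Tendsto (fun u : ℝ => Complex.exp (Complex.I * ω * u) * φ u) atTop (𝓝 1))
    (hlim' : Tendsto (fun u : ℝ => Complex.exp (Complex.I * ω * u) * φ' u) atTop
      (𝓝 (-Complex.I * ω)))
    {u C : ℝ} (hC : ∀ v, u ≤ v → ‖φ v‖ ≤ C) :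
    φ u = Complex.exp (-Complex.I * ω * u) -
      ∫ v in Ioi u, 1 / (ω : ℂ) * Complex.sin (ω * ((u : ℂ) - v)) *
        (potential M 0 v : ℂ) * φ v := by
  have hωc : (ω : ℂ) ≠ 0 := by exact_mod_cast hω
  have hφ : Continuous φ := continuous_iff_continuousAt.mpr fun u => (hd u).continuousAt
  have hint := (integrableOn_jost_kernel_mul (ω := ω) hM hφ.stronglyMeasurable (le_refl u) 0
    fun v hv => by simpa using hC v hv).1
  -- variation of constants: `Ψ u = φ u`, and `Ψ` is constant when the potential vanishes
  set Ψ : ℝ → ℂ := fun v => 1 / (ω : ℂ) * Complex.sin (ω * ((u : ℂ) - v)) * φ' v +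
    Complex.cos (ω * ((u : ℂ) - v)) * φ v with hΨ
  have hΨd : ∀ v ∈ Ici u, HasDerivAt Ψ (1 / (ω : ℂ) * Complex.sin (ω * ((u : ℂ) - v)) *
      (potential M 0 v : ℂ) * φ v) v := by
    intro v _
    have h1 : HasDerivAt (fun v : ℂ => (ω : ℂ) * ((u : ℂ) - v)) (-(ω : ℂ)) (v : ℂ) := by
      simpa using ((hasDerivAt_id (v : ℂ)).const_sub (u : ℂ)).const_mul (ω : ℂ)
    have h2 := (((h1.csin.comp_ofReal).const_mul (1 / (ω : ℂ))).mul (hd' v)).add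
      ((h1.ccos.comp_ofReal).mul (hd v))
    refine h2.congr_deriv ?_
    field_simp
    ring
  have hΨlim : Tendsto Ψ atTop (𝓝 (Complex.exp (-Complex.I * ω * u))) := by
    -- `Ψ - exp (-iωu)` is a bounded combination of the two quantities tending to zero
    have hb : Tendsto (fun v : ℝ => ‖1 / (ω : ℂ)‖ *
        ‖Complex.exp (Complex.I * ω * v) * φ' v - -Complex.I * ω‖ +
        ‖Complex.exp (Complex.I * ω * v) * φ v - 1‖) atTop (𝓝 0) := by
      have a1 := ((hlim'.sub_const (-Complex.I * ω)).norm).const_mul ‖1 / (ω : ℂ)‖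
      have a2 := (hlim.sub_const 1).norm
      simpa using a1.add a2
    rw [tendsto_iff_norm_sub_tendsto_zero]
    refine squeeze_zero (fun _ => norm_nonneg _) (fun v => ?_) hb
    have hs : Complex.sin (ω * ((u : ℂ) - v)) = ((Real.sin (ω * (u - v)) : ℝ) : ℂ) := by
      push_cast; rfl
    have hc : Complex.cos (ω * ((u : ℂ) - v)) = ((Real.cos (ω * (u - v)) : ℝ) : ℂ) := by
      push_cast; rfl
    have hns : ‖Complex.sin (ω * ((u : ℂ) - v))‖ ≤ 1 := by
      rw [hs, Complex.norm_real]; exact Real.abs_sin_le_one _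
    have hnc : ‖Complex.cos (ω * ((u : ℂ) - v))‖ ≤ 1 := by
      rw [hc, Complex.norm_real]; exact Real.abs_cos_le_one _
    have hne : ‖Complex.exp (-(Complex.I * ω * v))‖ = 1 := by
      rw [Complex.norm_exp]; simp
    have hexp : Complex.exp (-(Complex.I * ω * v)) * Complex.exp (Complex.I * ω * v) = 1 := by
      rw [← Complex.exp_add]; simp
    have hu : Complex.exp (-Complex.I * ω * u) = Complex.exp (-(Complex.I * ω * v)) *
        (Complex.cos (ω * ((u : ℂ) - v)) - Complex.I * Complex.sin (ω * ((u : ℂ) - v))) := by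
      have : -Complex.I * ω * u = -(Complex.I * ω * v) + (-((ω : ℂ) * (u - v))) * Complex.I := by
        ring
      rw [this, Complex.exp_add, Complex.exp_mul_I, Complex.cos_neg, Complex.sin_neg]
      ring
    have e : Ψ v - Complex.exp (-Complex.I * ω * u) = Complex.exp (-(Complex.I * ω * v)) *
        (1 / (ω : ℂ) * Complex.sin (ω * ((u : ℂ) - v)) *
          (Complex.exp (Complex.I * ω * v) * φ' v - -Complex.I * ω) +
        Complex.cos (ω * ((u : ℂ) - v)) * (Complex.exp (Complex.I * ω * v) * φ v - 1)) := by
      rw [hu, hΨ]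
      simp only
      have hw : 1 / (ω : ℂ) * ω = 1 := one_div_mul_cancel hωc
      linear_combination (-(1 / (ω : ℂ) * Complex.sin (ω * ((u : ℂ) - v)) * φ' v +
        Complex.cos (ω * ((u : ℂ) - v)) * φ v)) * hexp -
        (Complex.exp (-(Complex.I * ω * v)) * Complex.I *
          Complex.sin (ω * ((u : ℂ) - v))) * hw
    rw [e, norm_mul, hne, one_mul]
    refine (norm_add_le _ _).trans ?_
    rw [norm_mul, norm_mul, norm_mul (Complex.cos _)]
    gcongr
    · exact mul_le_of_le_one_right (norm_nonneg _) hns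
    · exact mul_le_of_le_one_left (norm_nonneg _) hnc
  have hI := integral_Ioi_of_hasDerivAt_of_tendsto' hΨd hint hΨlim
  rw [hI]
  simp [hΨ]

/-! ### The Laplace representation of the Jost solution -/

theorem two_I_mul_mem_slitPlane {ω : ℝ} (hω : ω ≠ 0) :
    2 * Complex.I * (ω : ℂ) ∈ Complex.slitPlane := by
  rw [Complex.mem_slitPlane_iff]
  right
  simpa using hω

theorem abs_im_log_two_I_mul (ω : ℝ) :
    |(Complex.log (2 * Complex.I * (ω : ℂ))).im| ≤ Real.pi / 2 := by
  rw [Complex.log_im, Complex.abs_arg_le_pi_div_two_iff]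
  simp

theorem exp_log_two_I_mul {ω : ℝ} (hω : ω ≠ 0) :
    Complex.exp (Complex.log (2 * Complex.I * (ω : ℂ))) = 2 * Complex.I * ω :=
  Complex.exp_log (Complex.slitPlane_ne_zero (two_I_mul_mem_slitPlane hω))

/-- The function `e^(-iωu) (1 + ∫₀^∞ e^(-p r(u)) B(p) dp)`. -/
noncomputable def jostLaplace (M ω u : ℝ) : ℂ :=
  Complex.exp (-Complex.I * ω * u) *
    (1 + laplaceBorel M (Complex.log (2 * Complex.I * ω)) 0 (radius M u))

/-- The derivative of `jostLaplace M ω`. -/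
noncomputable def jostLaplaceDeriv (M ω u : ℝ) : ℂ :=
  Complex.exp (-Complex.I * ω * u) *
    (-Complex.I * ω * (1 + laplaceBorel M (Complex.log (2 * Complex.I * ω)) 0 (radius M u)) -
      ((1 - 2 * M / radius M u : ℝ) : ℂ) *
        laplaceBorel M (Complex.log (2 * Complex.I * ω)) 1 (radius M u))

theorem hasDerivAt_laplaceBorel_radius {M : ℝ} (hM : 0 < M) (ω : ℝ) (j : ℕ) (u : ℝ) :
    HasDerivAt (fun u => laplaceBorel M (Complex.log (2 * Complex.I * ω)) j (radius M u))
      (-(((1 - 2 * M / radius M u : ℝ) : ℂ) *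
        laplaceBorel M (Complex.log (2 * Complex.I * ω)) (j + 1) (radius M u))) u := by
  have h := (hasDerivAt_laplaceBorel hM (abs_im_log_two_I_mul ω) j
    (two_mul_lt_radius hM u)).scomp u (hasDerivAt_radius hM u)
  refine h.congr_deriv ?_
  rw [Complex.real_smul]
  ring

theorem hasDerivAt_exp_neg_I_mul (ω u : ℝ) :
    HasDerivAt (fun u : ℝ => Complex.exp (-Complex.I * ω * u))
      (Complex.exp (-Complex.I * ω * u) * (-Complex.I * ω)) u := by
  have h : HasDerivAt (fun u : ℂ => -Complex.I * ω * u) (-Complex.I * ω) (u : ℂ) := by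
    simpa using (hasDerivAt_id (u : ℂ)).const_mul (-Complex.I * (ω : ℂ))
  exact h.cexp.comp_ofReal

theorem hasDerivAt_jostLaplace {M : ℝ} (hM : 0 < M) (ω u : ℝ) :
    HasDerivAt (jostLaplace M ω) (jostLaplaceDeriv M ω u) u := by
  have h := (hasDerivAt_exp_neg_I_mul ω u).mul
    ((hasDerivAt_laplaceBorel_radius hM ω 0 u).const_add 1)
  refine h.congr_deriv ?_
  simp only [jostLaplaceDeriv]
  ring

theorem hasDerivAt_jostLaplaceDeriv {M : ℝ} (hM : 0 < M) {ω : ℝ} (hω : ω ≠ 0) (u : ℝ) :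
    HasDerivAt (jostLaplaceDeriv M ω)
      (((potential M 0 u : ℂ) - (ω : ℂ) ^ 2) * jostLaplace M ω u) u := by
  set w := Complex.log (2 * Complex.I * (ω : ℂ)) with hw
  have hr0 : radius M u ≠ 0 := (radius_pos hM u).ne'
  have hrc : (radius M u : ℂ) ≠ 0 := by exact_mod_cast hr0
  have hf : HasDerivAt (fun u => ((1 - 2 * M / radius M u : ℝ) : ℂ))
      ((2 * M / radius M u ^ 2 * (1 - 2 * M / radius M u) : ℝ) : ℂ) u := by
    have h1 := (((hasDerivAt_const u (2 * M)).fun_div (hasDerivAt_radius hM u) hr0).const_sub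
      1).ofReal_comp
    refine h1.congr_deriv ?_
    congr 1
    field_simp
    ring
  have h := (hasDerivAt_exp_neg_I_mul ω u).mul
    ((((hasDerivAt_laplaceBorel_radius hM ω 0 u).const_add 1).const_mul (-Complex.I * ω)).sub
      (hf.mul (hasDerivAt_laplaceBorel_radius hM ω 1 u)))
  refine h.congr_deriv ?_
  have heq := laplace_equation hM (abs_im_log_two_I_mul ω) (two_mul_lt_radius hM u)
  rw [exp_log_two_I_mul hω] at heq
  simp only [Pi.sub_apply, Pi.mul_apply, jostLaplace, potential_zero_eq, zero_add,
    one_add_one_eq_two, ← hw] at heq ⊢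
  push_cast
  generalize laplaceBorel M w 0 (radius M u) = L0 at heq ⊢
  generalize laplaceBorel M w 1 (radius M u) = L1 at heq ⊢
  generalize laplaceBorel M w 2 (radius M u) = L2 at heq ⊢
  generalize Complex.exp (-Complex.I * ω * u) = e
  generalize (radius M u : ℂ) = r at heq hrc ⊢
  linear_combination (e * (1 - 2 * M / r)) * heq +
    (e * (ω : ℂ) ^ 2 * (1 + L0)) * Complex.I_sq

theorem tendsto_exp_mul_jostLaplace {M : ℝ} (hM : 0 < M) (ω : ℝ) :
    Tendsto (fun u : ℝ => Complex.exp (Complex.I * ω * u) * jostLaplace M ω u) atTop (𝓝 1) := by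
  have h := ((tendsto_laplaceBorel hM (abs_im_log_two_I_mul ω) 0).comp
    (tendsto_radius hM)).const_add 1
  rw [add_zero] at h
  refine h.congr fun u => ?_
  rw [jostLaplace, ← mul_assoc, ← Complex.exp_add]
  simp

theorem tendsto_one_sub_div_radius {M : ℝ} (hM : 0 < M) :
    Tendsto (fun u => ((1 - 2 * M / radius M u : ℝ) : ℂ)) atTop (𝓝 1) := by
  have h := ((tendsto_radius hM).const_div_atTop (2 * M)).const_sub 1
  rw [sub_zero] at h
  have := (Complex.continuous_ofReal.tendsto 1).comp h
  simpa [Function.comp_def] using this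

theorem tendsto_one_sub_mul_laplaceBorel {M : ℝ} (hM : 0 < M) (ω : ℝ) :
    Tendsto (fun u => ((1 - 2 * M / radius M u : ℝ) : ℂ) *
      laplaceBorel M (Complex.log (2 * Complex.I * ω)) 1 (radius M u)) atTop (𝓝 0) := by
  have h := (tendsto_one_sub_div_radius hM).mul
    ((tendsto_laplaceBorel hM (abs_im_log_two_I_mul ω) 1).comp (tendsto_radius hM))
  simpa [Function.comp_def] using h

theorem tendsto_exp_mul_jostLaplaceDeriv {M : ℝ} (hM : 0 < M) (ω : ℝ) :
    Tendsto (fun u : ℝ => Complex.exp (Complex.I * ω * u) * jostLaplaceDeriv M ω u) atTop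
      (𝓝 (-Complex.I * ω)) := by
  have h0 := (((tendsto_laplaceBorel hM (abs_im_log_two_I_mul ω) 0).comp
    (tendsto_radius hM)).const_add 1).const_mul (-Complex.I * ω)
  have h := h0.sub (tendsto_one_sub_mul_laplaceBorel hM ω)
  rw [add_zero, mul_one, sub_zero] at h
  refine h.congr fun u => ?_
  rw [jostLaplaceDeriv, ← mul_assoc, ← Complex.exp_add]
  simp

theorem continuous_jostLaplace {M : ℝ} (hM : 0 < M) (ω : ℝ) : Continuous (jostLaplace M ω) :=
  continuous_iff_continuousAt.mpr fun u => (hasDerivAt_jostLaplace hM ω u).continuousAt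

theorem norm_jostLaplace_le {M : ℝ} (hM : 0 < M) (ω : ℝ) {u v : ℝ} (huv : u ≤ v) :
    ‖jostLaplace M ω v‖ ≤ 1 + M * (1 / (radius M u - 2 * M)) := by
  have h1 : ‖Complex.exp (-Complex.I * ω * v)‖ = 1 := by
    rw [Complex.norm_exp]; simp
  rw [jostLaplace, norm_mul, h1, one_mul]
  refine (norm_add_le _ _).trans ?_
  rw [norm_one]
  gcongr
  refine (norm_laplaceBorel_le hM (abs_im_log_two_I_mul ω) 0 (two_mul_lt_radius hM v)).trans ?_
  have h2 := two_mul_lt_radius hM u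
  have h3 := (strictMono_radius hM).monotone huv
  have h4 : 0 < radius M u - 2 * M := by linarith
  simp only [Nat.factorial_zero, Nat.cast_one, zero_add, pow_one]
  gcongr

theorem jostSolution_eq_jostLaplace {M : ℝ} (hM : 0 < M) {ω : ℝ} (hω : ω ≠ 0) :
    jostSolution M 0 (ω : ℂ) = jostLaplace M ω := by
  funext u
  refine (hasSum_jostIterate hM (continuous_jostLaplace hM ω)
    (fun v hv => norm_jostLaplace_le hM ω hv) fun u => ?_).tsum_eq
  exact jost_integral_equation hM hω (hasDerivAt_jostLaplace hM ω)
    (hasDerivAt_jostLaplaceDeriv hM hω) (tendsto_exp_mul_jostLaplace hM ω)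
    (tendsto_exp_mul_jostLaplaceDeriv hM ω) fun v hv => norm_jostLaplace_le hM ω hv

theorem isJostSolution_jostSolution {M : ℝ} (hM : 0 < M) {ω : ℝ} (hω : ω ≠ 0) :
    IsJostSolution M 0 (ω : ℂ) (jostSolution M 0 (ω : ℂ)) := by
  rw [jostSolution_eq_jostLaplace hM hω]
  have hd : deriv (jostLaplace M ω) = jostLaplaceDeriv M ω :=
    funext fun u => (hasDerivAt_jostLaplace hM ω u).deriv
  have hd2 : deriv (jostLaplaceDeriv M ω) =
      fun u => ((potential M 0 u : ℂ) - (ω : ℂ) ^ 2) * jostLaplace M ω u :=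
    funext fun u => (hasDerivAt_jostLaplaceDeriv hM hω u).deriv
  refine ⟨?_, fun u => ?_, tendsto_exp_mul_jostLaplace hM ω, ?_⟩
  · rw [show (2 : WithTop ℕ∞) = 1 + 1 from (one_add_one_eq_two).symm, contDiff_succ_iff_deriv, hd]
    refine ⟨fun u => (hasDerivAt_jostLaplace hM ω u).differentiableAt, by simp, ?_⟩
    rw [contDiff_one_iff_deriv, hd2]
    refine ⟨fun u => (hasDerivAt_jostLaplaceDeriv hM hω u).differentiableAt, ?_⟩
    have h1 := continuous_potential_zero hM
    have h2 := continuous_jostLaplace hM ω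
    fun_prop
  · rw [hd, hd2]
    ring
  · have e : (fun u : ℝ => Complex.exp (Complex.I * ω * u) * jostLaplace M ω u) =
        fun u => 1 + laplaceBorel M (Complex.log (2 * Complex.I * ω)) 0 (radius M u) := by
      funext u
      rw [jostLaplace, ← mul_assoc, ← Complex.exp_add]
      simp
    rw [e]
    have h := (tendsto_one_sub_mul_laplaceBorel hM ω).neg
    rw [neg_zero] at h
    refine h.congr fun u => ?_
    exact (((hasDerivAt_laplaceBorel_radius hM ω 0 u).const_add 1).deriv).symm

/-! ### Holomorphic functions of `log z` that are flat at `z = 0` -/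

/-- `Q` is holomorphic on a strip larger than `|Im w| ≤ π / 2` and is `O(exp (γ Re w))` there, so
that `z ↦ Q (log z)` is holomorphic and `O(|z| ^ γ)` on a sector around the right half plane. -/
def IsFlat (γ : ℝ) (Q : ℂ → ℂ) : Prop :=
  ∃ b D : ℝ, Real.pi / 2 < b ∧ DifferentiableOn ℂ Q (strip b) ∧
    ∀ w ∈ strip b, ‖Q w‖ ≤ D * Real.exp (γ * w.re)

theorem IsFlat.deriv_sub {γ : ℝ} (hγ : 0 ≤ γ) {Q : ℂ → ℂ} (h : IsFlat γ Q) (c : ℂ) :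
    IsFlat γ fun w => deriv Q w - c * Q w := by
  obtain ⟨b, D, hb, hd, hD⟩ := h
  set ε := (b - Real.pi / 2) / 2 with hε
  have hε0 : 0 < ε := by rw [hε]; linarith
  have hD0 : 0 ≤ D := by
    have h0 := hD 0 (show |(0 : ℂ).im| < b by simp; linarith [Real.pi_pos])
    simp only [Complex.zero_re, mul_zero, Real.exp_zero, mul_one] at h0
    exact (norm_nonneg _).trans h0
  have hsub : strip (b - ε) ⊆ strip b := strip_mono (by linarith)
  refine ⟨b - ε, D * Real.exp (γ * ε) / ε + ‖c‖ * D, by rw [hε]; linarith, ?_, fun w hw => ?_⟩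
  · exact ((hd.deriv (isOpen_strip b)).mono hsub).sub ((hd.mono hsub).const_mul c)
  · have hw' : |w.im| < b - ε := hw
    have hin : |w.im| + ε < b := by linarith
    have h1 : ‖deriv Q w‖ ≤ D * Real.exp (γ * (w.re + ε)) / ε := by
      refine norm_deriv_le_of_closedBall_subset hd hε0 (fun v hv => ?_) hin
      refine (hD v (closedBall_subset_strip hin hv)).trans ?_
      have h2 : v.re ≤ w.re + ε := by
        rw [Metric.mem_closedBall, dist_eq_norm] at hv
        have := (Complex.re_le_norm (v - w)).trans hv
        rw [Complex.sub_re] at this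
        linarith
      gcongr
    have h3 := hD w (hsub hw)
    calc ‖deriv Q w - c * Q w‖ ≤ ‖deriv Q w‖ + ‖c‖ * ‖Q w‖ := by
          rw [← norm_mul]; exact norm_sub_le _ _
      _ ≤ D * Real.exp (γ * (w.re + ε)) / ε + ‖c‖ * (D * Real.exp (γ * w.re)) := by gcongr
      _ = _ := by rw [mul_add, Real.exp_add]; ring

/-- The function `ω ↦ ω ^ (-m) Q (log (2iω))`, extended by `0` to `ω = 0`. -/
noncomputable def logPullback (m : ℕ) (Q : ℂ → ℂ) (ω : ℝ) : ℂ :=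
  if ω = 0 then 0 else ((ω : ℂ) ^ m)⁻¹ * Q (Complex.log (2 * Complex.I * ω))

theorem log_two_I_mul_mem_strip {b : ℝ} (hb : Real.pi / 2 < b) (ω : ℝ) :
    Complex.log (2 * Complex.I * ω) ∈ strip b :=
  (abs_im_log_two_I_mul ω).trans_lt hb

theorem exp_mul_re_log {ω : ℝ} (hω : ω ≠ 0) (γ : ℝ) :
    Real.exp (γ * (Complex.log (2 * Complex.I * ω)).re) = 2 ^ γ * |ω| ^ γ := by
  have h : ‖2 * Complex.I * (ω : ℂ)‖ = 2 * |ω| := by simp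
  have hpos : 0 < |ω| := abs_pos.mpr hω
  rw [Complex.log_re, h, ← Real.mul_rpow (by norm_num) hpos.le, mul_comm,
    ← Real.rpow_def_of_pos (by positivity)]

theorem norm_logPullback_le {γ : ℝ} {Q : ℂ → ℂ} (h : IsFlat γ Q) (m : ℕ) :
    ∃ D, ∀ ω : ℝ, ω ≠ 0 → ‖logPullback m Q ω‖ ≤ D * |ω| ^ (γ - m) := by
  obtain ⟨b, D, hb, -, hD⟩ := h
  refine ⟨D * 2 ^ γ, fun ω hω => ?_⟩
  have hpos : 0 < |ω| := abs_pos.mpr hω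
  have h1 := hD _ (log_two_I_mul_mem_strip hb ω)
  rw [exp_mul_re_log hω] at h1
  rw [logPullback, if_neg hω, norm_mul, norm_inv, norm_pow, Complex.norm_real, Real.norm_eq_abs,
    Real.rpow_sub hpos, Real.rpow_natCast]
  calc (|ω| ^ m)⁻¹ * _ ≤ (|ω| ^ m)⁻¹ * (D * (2 ^ γ * |ω| ^ γ)) := by gcongr
    _ = _ := by ring

theorem hasDerivAt_logPullback {γ : ℝ} {Q : ℂ → ℂ} (h : IsFlat γ Q) (m : ℕ) {ω : ℝ} (hω : ω ≠ 0) :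
    HasDerivAt (logPullback m Q) (logPullback (m + 1) (fun w => deriv Q w - m * Q w) ω) ω := by
  obtain ⟨b, D, hb, hd, -⟩ := h
  have hωc : (ω : ℂ) ≠ 0 := by exact_mod_cast hω
  have h1 : HasDerivAt (fun x : ℂ => Complex.log (2 * Complex.I * x)) ((ω : ℂ)⁻¹) (ω : ℂ) := by
    have h2 : HasDerivAt (fun x : ℂ => 2 * Complex.I * x) (2 * Complex.I) (ω : ℂ) := by
      simpa using (hasDerivAt_id (ω : ℂ)).const_mul (2 * Complex.I)
    refine (h2.clog (two_I_mul_mem_slitPlane hω)).congr_deriv ?_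
    field_simp
  have h3 : HasDerivAt Q (deriv Q (Complex.log (2 * Complex.I * ω)))
      (Complex.log (2 * Complex.I * ω)) :=
    (hd.differentiableAt ((isOpen_strip b).mem_nhds (log_two_I_mul_mem_strip hb ω))).hasDerivAt
  have h4 : HasDerivAt (fun x : ℂ => (x ^ m)⁻¹) (-(m * (ω : ℂ) ^ (m - 1)) / ((ω : ℂ) ^ m) ^ 2)
      (ω : ℂ) := (hasDerivAt_pow m (ω : ℂ)).fun_inv (pow_ne_zero m hωc)
  have h5 := (h4.mul (HasDerivAt.comp (ω : ℂ) h3 h1)).comp_ofReal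
  have h6 : (fun ω : ℝ => ((ω : ℂ) ^ m)⁻¹ * Q (Complex.log (2 * Complex.I * ω))) =ᶠ[𝓝 ω]
      logPullback m Q := by
    filter_upwards [isOpen_ne.mem_nhds hω] with x hx
    rw [logPullback, if_neg hx]
  refine (HasDerivAt.congr_of_eventuallyEq h5 h6.symm).congr_deriv ?_
  rw [logPullback, if_neg hω]
  rcases m with _ | m
  · simp
    ring
  · simp only [Nat.add_sub_cancel, Function.comp]
    field_simp
    ring

theorem tendsto_const_mul_abs_rpow {s : ℝ} (hs : 0 < s) (D : ℝ) :
    Tendsto (fun ω : ℝ => D * |ω| ^ s) (𝓝 0) (𝓝 0) := by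
  have h : Continuous fun ω : ℝ => D * |ω| ^ s :=
    continuous_const.mul (continuous_abs.rpow_const fun _ => Or.inr hs.le)
  simpa [Real.zero_rpow hs.ne'] using h.tendsto 0

theorem contDiff_logPullback {γ : ℝ} (hγ : 0 ≤ γ) (N : ℕ) {Q : ℂ → ℂ} (h : IsFlat γ Q) (m : ℕ)
    (hm : (m : ℝ) + N < γ) : ContDiff ℝ N (logPullback m Q) := by
  induction N generalizing m Q with
  | zero =>
    obtain ⟨D, hD⟩ := norm_logPullback_le h m
    rw [Nat.cast_zero, contDiff_zero, continuous_iff_continuousAt]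
    intro ω
    rcases eq_or_ne ω 0 with rfl | hω
    · have h0 : logPullback m Q 0 = 0 := if_pos rfl
      rw [ContinuousAt, h0]
      refine squeeze_zero_norm (fun x => ?_) (tendsto_const_mul_abs_rpow (s := γ - m)
        (by simpa using hm) |D|)
      rcases eq_or_ne x 0 with rfl | hx
      · rw [h0, norm_zero]; positivity
      · refine (hD x hx).trans ?_
        gcongr
        exact le_abs_self D
    · exact (hasDerivAt_logPullback h m hω).continuousAt
  | succ N ih =>
    have hder : ∀ ω, HasDerivAt (logPullback m Q)
        (logPullback (m + 1) (fun w => deriv Q w - m * Q w) ω) ω := by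
      intro ω
      rcases eq_or_ne ω 0 with rfl | hω
      · obtain ⟨D, hD⟩ := norm_logPullback_le h m
        have h0 : logPullback m Q 0 = 0 := if_pos rfl
        rw [show logPullback (m + 1) (fun w => deriv Q w - m * Q w) 0 = 0 from if_pos rfl,
          hasDerivAt_iff_tendsto_slope_zero]
        have hs : 0 < γ - m - 1 := by
          push_cast at hm
          have : (0 : ℝ) ≤ N := N.cast_nonneg
          linarith
        have hlim := (tendsto_const_mul_abs_rpow hs D).mono_left
          (nhdsWithin_le_nhds (s := {(0 : ℝ)}ᶜ))
        refine squeeze_zero_norm' ?_ hlim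
        filter_upwards [self_mem_nhdsWithin] with x hx
        have hx0 : x ≠ 0 := hx
        have hpos : 0 < |x| := abs_pos.mpr hx0
        rw [zero_add, h0, sub_zero, norm_smul, norm_inv, Real.norm_eq_abs,
          Real.rpow_sub_one hpos.ne']
        calc |x|⁻¹ * ‖logPullback m Q x‖ ≤ |x|⁻¹ * (D * |x| ^ (γ - m)) := by
              gcongr
              exact hD x hx0
          _ = _ := by ring
      · exact hasDerivAt_logPullback h m hω
    push_cast
    rw [contDiff_succ_iff_deriv]
    refine ⟨fun ω => (hder ω).differentiableAt, by simp, ?_⟩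
    rw [funext fun ω => (hder ω).deriv]
    refine ih (h.deriv_sub hγ m) (m + 1) ?_
    push_cast at hm ⊢
    linarith

/-! ### Logarithmic expansions -/

/-- The exponents `(i, j)` of the monomials `z ^ i log ^ j z` with `i ≤ n` and `j ≤ min i k`. -/
def logIdx (n k : ℕ) : Finset (ℕ × ℕ) :=
  (Finset.range (n + 1) ×ˢ Finset.range (n + 1)).filter fun x => x.2 ≤ x.1 ∧ x.2 ≤ k

theorem mem_logIdx {n k : ℕ} {x : ℕ × ℕ} : x ∈ logIdx n k ↔ x.1 ≤ n ∧ x.2 ≤ x.1 ∧ x.2 ≤ k := by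
  simp only [logIdx, Finset.mem_filter, Finset.mem_product, Finset.mem_range]
  omega

/-- The monomial `z ^ i log ^ j z` in the variable `w = log z`. -/
noncomputable def logMon (x : ℕ × ℕ) (w : ℂ) : ℂ := Complex.exp (x.1 * w) * w ^ x.2

/-- The weight of the monomial `z ^ i log ^ j z`. The factor `(2n) ^ j` makes a rescaling
`z ↦ z / p` cost no more than the factor `rescaleBound n p`. -/
noncomputable def logWt (n : ℕ) (W : ℕ → ℝ) (x : ℕ × ℕ) : ℝ := W x.1 * (2 * n) ^ x.2

/-- `f` has on the strip `|Im w| < b` an expansion `∑ c_{ij} z ^ i log ^ j z + O(|z| ^ (n + 1/2))`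
in `z = exp w`, over `i ≤ n` and `j ≤ min i k`, where the weighted sum of the `|c_{ij}|` plus the
constant in the remainder is at most `N`. -/
def HasLogExp (b : ℝ) (n k : ℕ) (W : ℕ → ℝ) (N : ℝ) (f : ℂ → ℂ) : Prop :=
  ∃ (c : ℕ × ℕ → ℂ) (D : ℝ), 0 ≤ D ∧ ∑ x ∈ logIdx n k, logWt n W x * ‖c x‖ + D ≤ N ∧
    ∀ w ∈ strip b, ‖f w - ∑ x ∈ logIdx n k, c x * logMon x w‖ ≤
      D * Real.exp ((n + 1 / 2) * w.re)

section Basic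

variable {b : ℝ} {n k : ℕ} {W : ℕ → ℝ} {N : ℝ} {f g : ℂ → ℂ}

theorem logWt_nonneg (hW : ∀ i, 0 < W i) (x : ℕ × ℕ) : 0 ≤ logWt n W x :=
  mul_nonneg (hW _).le (by positivity)

theorem logWt_pos (hn : 1 ≤ n) (hW : ∀ i, 0 < W i) (x : ℕ × ℕ) : 0 < logWt n W x := by
  have : (0 : ℝ) < n := by exact_mod_cast hn
  exact mul_pos (hW _) (by positivity)

theorem HasLogExp.mono {N' : ℝ} (hf : HasLogExp b n k W N f) (h : N ≤ N') :
    HasLogExp b n k W N' f := by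
  obtain ⟨c, D, h0, h1, h2⟩ := hf
  exact ⟨c, D, h0, h1.trans h, h2⟩

theorem HasLogExp.congr (hf : HasLogExp b n k W N f) (h : ∀ w ∈ strip b, g w = f w) :
    HasLogExp b n k W N g := by
  obtain ⟨c, D, h0, h1, h2⟩ := hf
  exact ⟨c, D, h0, h1, fun w hw => by rw [h w hw]; exact h2 w hw⟩

theorem HasLogExp.nonneg (hW : ∀ i, 0 < W i) (hf : HasLogExp b n k W N f) : 0 ≤ N := by
  obtain ⟨c, D, h0, h1, -⟩ := hf
  refine le_trans (add_nonneg (Finset.sum_nonneg fun x _ => ?_) h0) h1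
  exact mul_nonneg (logWt_nonneg hW x) (norm_nonneg _)

theorem logIdx_subset {k' : ℕ} (h : k ≤ k') : logIdx n k ⊆ logIdx n k' := fun x hx => by
  rw [mem_logIdx] at hx ⊢
  omega

theorem HasLogExp.mono_deg {k' : ℕ} (hf : HasLogExp b n k W N f) (h : k ≤ k') :
    HasLogExp b n k' W N f := by
  obtain ⟨c, D, h0, h1, h2⟩ := hf
  refine ⟨fun x => if x ∈ logIdx n k then c x else 0, D, h0, ?_, fun w hw => ?_⟩
  · rw [← Finset.sum_subset (logIdx_subset h)
      (fun x _ hx => by simp only [if_neg hx, norm_zero, mul_zero])]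
    refine le_trans (le_of_eq ?_) h1
    congr 1
    exact Finset.sum_congr rfl fun x hx => by simp only [if_pos hx]
  · have : ∑ x ∈ logIdx n k', (if x ∈ logIdx n k then c x else 0) * logMon x w =
        ∑ x ∈ logIdx n k, c x * logMon x w := by
      rw [← Finset.sum_subset (logIdx_subset h) (fun x _ hx => by rw [if_neg hx, zero_mul])]
      exact Finset.sum_congr rfl fun x hx => by rw [if_pos hx]
    rw [this]
    exact h2 w hw

theorem HasLogExp.add {N' : ℝ} (hW : ∀ i, 0 < W i) (hf : HasLogExp b n k W N f)
    (hg : HasLogExp b n k W N' g) : HasLogExp b n k W (N + N') fun w => f w + g w := by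
  obtain ⟨c, D, h0, h1, h2⟩ := hf
  obtain ⟨c', D', h0', h1', h2'⟩ := hg
  refine ⟨fun x => c x + c' x, D + D', add_nonneg h0 h0', ?_, fun w hw => ?_⟩
  · have : ∑ x ∈ logIdx n k, logWt n W x * ‖c x + c' x‖ ≤
        ∑ x ∈ logIdx n k, logWt n W x * ‖c x‖ + ∑ x ∈ logIdx n k, logWt n W x * ‖c' x‖ := by
      rw [← Finset.sum_add_distrib]
      refine Finset.sum_le_sum fun x _ => ?_
      rw [← mul_add]
      exact mul_le_mul_of_nonneg_left (norm_add_le _ _) (logWt_nonneg hW x)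
    linarith
  · have e : f w + g w - ∑ x ∈ logIdx n k, (c x + c' x) * logMon x w =
        (f w - ∑ x ∈ logIdx n k, c x * logMon x w) +
          (g w - ∑ x ∈ logIdx n k, c' x * logMon x w) := by
      simp only [add_mul, Finset.sum_add_distrib]
      ring
    rw [e, add_mul]
    exact (norm_add_le _ _).trans (add_le_add (h2 w hw) (h2' w hw))

theorem HasLogExp.const_mul (hf : HasLogExp b n k W N f) (a : ℂ) :
    HasLogExp b n k W (‖a‖ * N) fun w => a * f w := by
  obtain ⟨c, D, h0, h1, h2⟩ := hf
  refine ⟨fun x => a * c x, ‖a‖ * D, by positivity, ?_, fun w hw => ?_⟩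
  · have : ∑ x ∈ logIdx n k, logWt n W x * ‖a * c x‖ =
        ‖a‖ * ∑ x ∈ logIdx n k, logWt n W x * ‖c x‖ := by
      rw [Finset.mul_sum]
      refine Finset.sum_congr rfl fun x _ => ?_
      rw [norm_mul]
      ring
    rw [this, ← mul_add]
    exact mul_le_mul_of_nonneg_left h1 (norm_nonneg _)
  · have e : a * f w - ∑ x ∈ logIdx n k, a * c x * logMon x w =
        a * (f w - ∑ x ∈ logIdx n k, c x * logMon x w) := by
      rw [mul_sub, Finset.mul_sum]
      simp only [mul_assoc]
    rw [e, norm_mul, mul_assoc]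
    exact mul_le_mul_of_nonneg_left (h2 w hw) (norm_nonneg _)

theorem hasLogExp_of_norm_le {D : ℝ} (hD : 0 ≤ D)
    (h : ∀ w ∈ strip b, ‖f w‖ ≤ D * Real.exp ((n + 1 / 2) * w.re)) : HasLogExp b n k W D f :=
  ⟨fun _ => 0, D, hD, by simp, fun w hw => by simpa using h w hw⟩

theorem HasLogExp.sum (hW : ∀ i, 0 < W i) {ι : Type*} (s : Finset ι) {F : ι → ℂ → ℂ} {K : ι → ℝ}
    (h : ∀ i ∈ s, HasLogExp b n k W (K i) (F i)) :
    HasLogExp b n k W (∑ i ∈ s, K i) fun w => ∑ i ∈ s, F i w := by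
  classical
  induction s using Finset.induction_on with
  | empty => exact hasLogExp_of_norm_le le_rfl (by simp)
  | insert a s ha ih =>
    have h1 := (h a (Finset.mem_insert_self a s)).add hW
      (ih fun i hi => h i (Finset.mem_insert_of_mem hi))
    rw [Finset.sum_insert ha]
    exact h1.congr fun w _ => Finset.sum_insert ha

theorem hasLogExp_logMon {x : ℕ × ℕ} (hx : x ∈ logIdx n k) :
    HasLogExp b n k W (logWt n W x) (logMon x) := by
  refine ⟨fun y => if y = x then 1 else 0, 0, le_rfl, ?_, fun w _ => ?_⟩
  · rw [add_zero, Finset.sum_eq_single x]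
    · simp
    · intro y _ hy; simp [hy]
    · intro h; exact absurd hx h
  · rw [Finset.sum_eq_single x]
    · simp
    · intro y _ hy; simp [hy]
    · intro h; exact absurd hx h

/-- To bound a linear operator on expansions it suffices to bound it on monomials and on
remainders. -/
theorem HasLogExp.of_decomposition (hW : ∀ i, 0 < W i) {k' : ℕ} {K D N : ℝ} (hK : 0 ≤ K)
    {c : ℕ × ℕ → ℂ} {T : ℕ × ℕ → ℂ → ℂ} {R : ℂ → ℂ}
    (hN : ∑ x ∈ logIdx n k, logWt n W x * ‖c x‖ + D ≤ N)
    (hT : ∀ x ∈ logIdx n k, HasLogExp b n k' W (K * logWt n W x) (T x))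
    (hR : HasLogExp b n k' W (K * D) R)
    (hg : ∀ w ∈ strip b, g w = ∑ x ∈ logIdx n k, c x * T x w + R w) :
    HasLogExp b n k' W (K * N) g := by
  have h1 := (HasLogExp.sum hW (logIdx n k) fun x hx => (hT x hx).const_mul (c x)).add hW hR
  refine (h1.congr hg).mono ?_
  calc _ = K * (∑ x ∈ logIdx n k, logWt n W x * ‖c x‖ + D) := by
        rw [mul_add, Finset.mul_sum]
        congr 1
        refine Finset.sum_congr rfl fun x _ => ?_
        ring
    _ ≤ _ := mul_le_mul_of_nonneg_left hN hK

/-- Expansions with summable norms may be summed term by term. -/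
theorem HasLogExp.tsum (hn : 1 ≤ n) (hW : ∀ i, 0 < W i) {F : ℕ → ℂ → ℂ} {K : ℕ → ℝ}
    (h : ∀ m, HasLogExp b n k W (K m) (F m)) (hK : Summable K)
    (hf : ∀ w ∈ strip b, HasSum (fun m => F m w) (f w)) :
    HasLogExp b n k W (∑' m, K m) f := by
  choose c D h0 h1 h2 using h
  have hc0 : ∀ m x, 0 ≤ logWt n W x * ‖c m x‖ := fun m x =>
    mul_nonneg (logWt_nonneg hW x) (norm_nonneg _)
  have hDK : ∀ m, D m ≤ K m := fun m =>
    (le_add_of_nonneg_left (Finset.sum_nonneg fun x _ => hc0 m x)).trans (h1 m)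
  have hDs : Summable D := Summable.of_nonneg_of_le h0 hDK hK
  have hcs' : ∀ x ∈ logIdx n k, Summable fun m => logWt n W x * ‖c m x‖ := by
    intro x hx
    refine Summable.of_nonneg_of_le (fun m => hc0 m x) (fun m => ?_) hK
    refine le_trans ?_ (h1 m)
    exact (Finset.single_le_sum (f := fun x => logWt n W x * ‖c m x‖) (fun y _ => hc0 m y) hx).trans
      (le_add_of_nonneg_right (h0 m))
  have hcs : ∀ x ∈ logIdx n k, Summable fun m => ‖c m x‖ := by
    intro x hx
    have := (hcs' x hx).mul_left (logWt n W x)⁻¹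
    refine this.congr fun m => ?_
    rw [inv_mul_cancel_left₀ (logWt_pos hn hW x).ne']
  refine ⟨fun x => ∑' m, c m x, ∑' m, D m, tsum_nonneg h0, ?_, fun w hw => ?_⟩
  · have e1 : ∑ x ∈ logIdx n k, logWt n W x * ‖∑' m, c m x‖ ≤
        ∑ x ∈ logIdx n k, ∑' m, logWt n W x * ‖c m x‖ := by
      refine Finset.sum_le_sum fun x hx => ?_
      rw [tsum_mul_left]
      exact mul_le_mul_of_nonneg_left (norm_tsum_le_tsum_norm (hcs x hx)) (logWt_nonneg hW x)
    have e2 : ∑ x ∈ logIdx n k, ∑' m, logWt n W x * ‖c m x‖ =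
        ∑' m, ∑ x ∈ logIdx n k, logWt n W x * ‖c m x‖ := (Summable.tsum_finsetSum hcs').symm
    have e3 : Summable fun m => ∑ x ∈ logIdx n k, logWt n W x * ‖c m x‖ := summable_sum hcs'
    calc _ ≤ ∑' m, ∑ x ∈ logIdx n k, logWt n W x * ‖c m x‖ + ∑' m, D m := by
          rw [← e2]; exact add_le_add_left e1 _
      _ = ∑' m, (∑ x ∈ logIdx n k, logWt n W x * ‖c m x‖ + D m) := (e3.tsum_add hDs).symm
      _ ≤ ∑' m, K m := (e3.add hDs).tsum_le_tsum h1 hK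
  · have s1 : HasSum (fun m => ∑ x ∈ logIdx n k, c m x * logMon x w)
        (∑ x ∈ logIdx n k, (∑' m, c m x) * logMon x w) :=
      hasSum_sum fun x hx => ((hcs x hx).of_norm.hasSum).mul_right _
    have s2 := (hf w hw).sub s1
    rw [← s2.tsum_eq]
    refine tsum_of_norm_bounded (hDs.hasSum.mul_right _) fun m => h2 m w hw

end Basic

/-! ### Multiplicative convolutions of logarithmic expansions -/

/-- Bound for the effect of the rescaling `z ↦ z / p` on expansions of order `n`. -/
noncomputable def rescaleBound (n : ℕ) (p : ℝ) : ℝ :=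
  max (p ^ (-((n : ℝ) + 1 / 2))) (p ^ (1 / 2 : ℝ))

theorem rescaleBound_nonneg (n : ℕ) {p : ℝ} (hp : 0 < p) : 0 ≤ rescaleBound n p :=
  le_max_of_le_left (by positivity)

theorem inv_pow_mul_log_pow_le {n i j : ℕ} (hn : 1 ≤ n) (hi : i ≤ n) (hj : j ≤ n) {p : ℝ}
    (hp : 0 < p) : (p ^ i)⁻¹ * (2 * n + |Real.log p|) ^ j ≤ (2 * n) ^ j * rescaleBound n p := by
  have hn0 : (0 : ℝ) < n := by exact_mod_cast hn
  have hjn : (j : ℝ) ≤ n := by exact_mod_cast hj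
  have hin : (i : ℝ) ≤ n := by exact_mod_cast hi
  have h1 : (2 * (n : ℝ) + |Real.log p|) ^ j ≤ (2 * n) ^ j * Real.exp (|Real.log p| / 2) := by
    have e : 2 * (n : ℝ) + |Real.log p| = 2 * n * (|Real.log p| / (2 * n) + 1) := by
      field_simp
      ring
    rw [e, mul_pow]
    gcongr
    calc (|Real.log p| / (2 * n) + 1) ^ j ≤ Real.exp (|Real.log p| / (2 * n)) ^ j := by
          gcongr
          exact Real.add_one_le_exp _
      _ = Real.exp (j * (|Real.log p| / (2 * n))) := (Real.exp_nat_mul _ _).symm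
      _ ≤ Real.exp (|Real.log p| / 2) := by
          gcongr
          rw [mul_div_assoc', div_le_div_iff₀ (by positivity) two_pos]
          nlinarith [abs_nonneg (Real.log p)]
  have h2 : (p ^ i)⁻¹ = Real.exp (-(i * Real.log p)) := by
    rw [Real.exp_neg, Real.exp_nat_mul, Real.exp_log hp]
  have h3 : (p ^ i)⁻¹ * Real.exp (|Real.log p| / 2) ≤ rescaleBound n p := by
    rw [h2, ← Real.exp_add, rescaleBound, Real.rpow_def_of_pos hp, Real.rpow_def_of_pos hp]
    rcases le_total 0 (Real.log p) with h | h
    · refine le_max_of_le_right (Real.exp_le_exp.mpr ?_)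
      rw [abs_of_nonneg h]
      nlinarith [mul_nonneg (Nat.cast_nonneg (α := ℝ) i) h]
    · refine le_max_of_le_left (Real.exp_le_exp.mpr ?_)
      rw [abs_of_nonpos h]
      nlinarith
  calc (p ^ i)⁻¹ * (2 * n + |Real.log p|) ^ j
      ≤ (p ^ i)⁻¹ * ((2 * n) ^ j * Real.exp (|Real.log p| / 2)) := by gcongr
    _ = (2 * n) ^ j * ((p ^ i)⁻¹ * Real.exp (|Real.log p| / 2)) := by ring
    _ ≤ _ := by gcongr

theorem logMon_sub_log (x : ℕ × ℕ) (w : ℂ) {p : ℝ} (hp : 0 < p) :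
    logMon x (w - (Real.log p : ℝ)) = ∑ l ∈ Finset.range (x.2 + 1),
      (((p ^ x.1)⁻¹ * (-Real.log p) ^ (x.2 - l) * (x.2.choose l : ℝ) : ℝ) : ℂ) *
        logMon (x.1, l) w := by
  have h1 : Complex.exp (x.1 * (w - (Real.log p : ℝ))) =
      Complex.exp (x.1 * w) * ((p : ℂ) ^ x.1)⁻¹ := by
    rw [mul_sub, Complex.exp_sub, Complex.exp_nat_mul (Real.log p : ℝ), ← Complex.ofReal_exp,
      Real.exp_log hp, div_eq_mul_inv]
  simp only [logMon]
  rw [h1, sub_eq_add_neg, add_pow, Finset.mul_sum]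
  refine Finset.sum_congr rfl fun l _ => ?_
  push_cast
  ring

section Mellin

variable {b : ℝ} {n k : ℕ} {W : ℕ → ℝ} {N : ℝ} {f : ℂ → ℂ}

theorem continuous_logMon (x : ℕ × ℕ) : Continuous (logMon x) := by
  unfold logMon
  fun_prop

theorem hasLogExp_mellinOp_logMon (hn : 1 ≤ n) (hW : ∀ i, 0 < W i) {G H : ℝ → ℝ}
    (hG : AEStronglyMeasurable G (volume.restrict (Ioi 0))) (hH : IntegrableOn H (Ioi 0))
    (hGH : ∀ p, 0 < p → |G p| * rescaleBound n p ≤ H p) {x : ℕ × ℕ} (hx : x ∈ logIdx n k) :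
    (∀ w, IntegrableOn (fun p : ℝ => (G p : ℂ) * logMon x (w - (Real.log p : ℝ))) (Ioi 0)) ∧
      HasLogExp b n k W ((∫ p in Ioi (0 : ℝ), H p) * logWt n W x) (mellinOp G (logMon x)) := by
  obtain ⟨i, j⟩ := x
  obtain ⟨hi, hji, hjk⟩ := mem_logIdx.mp hx
  simp only at hi hji hjk
  have hn0 : (0 : ℝ) < n := by exact_mod_cast hn
  set a : ℕ → ℝ → ℝ := fun l p => G p * ((p ^ i)⁻¹ * (-Real.log p) ^ (j - l) * (j.choose l : ℝ))
    with ha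
  have hbound : ∀ p, 0 < p → ∑ l ∈ Finset.range (j + 1), (2 * (n : ℝ)) ^ l * |a l p| ≤
      (2 * n) ^ j * H p := by
    intro p hp
    calc ∑ l ∈ Finset.range (j + 1), (2 * (n : ℝ)) ^ l * |a l p|
        = |G p| * ((p ^ i)⁻¹ * (2 * n + |Real.log p|) ^ j) := by
          rw [add_pow, Finset.mul_sum, Finset.mul_sum]
          refine Finset.sum_congr rfl fun l _ => ?_
          rw [ha]
          simp only [abs_mul, abs_inv, abs_pow, abs_neg, abs_of_pos hp, Nat.abs_cast]
          ring
      _ ≤ |G p| * ((2 * n) ^ j * rescaleBound n p) := by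
          exact mul_le_mul_of_nonneg_left (inv_pow_mul_log_pow_le hn hi (hji.trans hi) hp)
            (abs_nonneg _)
      _ = (2 * n) ^ j * (|G p| * rescaleBound n p) := by ring
      _ ≤ _ := by
          gcongr
          exact hGH p hp
  have ham : ∀ l, AEStronglyMeasurable (a l) (volume.restrict (Ioi 0)) := by
    intro l
    refine hG.mul (Measurable.aestronglyMeasurable ?_)
    exact ((measurable_id.pow_const i).inv.mul ((Real.measurable_log.neg).pow_const _)).mul_const _
  have hai : ∀ l ∈ Finset.range (j + 1), IntegrableOn (a l) (Ioi 0) := by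
    intro l hl
    refine Integrable.mono' (hH.const_mul (((2 * (n : ℝ)) ^ l)⁻¹ * (2 * n) ^ j)) (ham l) ?_
    filter_upwards [ae_restrict_mem measurableSet_Ioi] with p hp
    have h1 := (Finset.single_le_sum (f := fun l => (2 * (n : ℝ)) ^ l * |a l p|)
      (fun l _ => by positivity) hl).trans (hbound p hp)
    rw [Real.norm_eq_abs, mul_assoc, ← div_eq_inv_mul, le_div_iff₀ (by positivity), mul_comm]
    exact h1
  have hexp : ∀ (w : ℂ), ∀ p ∈ Ioi (0 : ℝ), (G p : ℂ) * logMon (i, j) (w - (Real.log p : ℝ)) =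
      ∑ l ∈ Finset.range (j + 1), (a l p : ℂ) * logMon (i, l) w := by
    intro w p hp
    rw [logMon_sub_log _ _ hp, Finset.mul_sum]
    refine Finset.sum_congr rfl fun l _ => ?_
    rw [ha]
    push_cast
    ring
  have hint : ∀ w, ∀ l ∈ Finset.range (j + 1),
      Integrable (fun p => (a l p : ℂ) * logMon (i, l) w) (volume.restrict (Ioi 0)) :=
    fun w l hl => (hai l hl).ofReal.mul_const _
  constructor
  · intro w
    exact IntegrableOn.congr_fun (integrable_finsetSum _ (hint w))
      (fun p hp => (hexp w p hp).symm) measurableSet_Ioi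
  · have heq : ∀ w, mellinOp G (logMon (i, j)) w = ∑ l ∈ Finset.range (j + 1),
        ((∫ p in Ioi (0 : ℝ), a l p : ℝ) : ℂ) * logMon (i, l) w := by
      intro w
      rw [mellinOp, setIntegral_congr_fun measurableSet_Ioi (hexp w), integral_finsetSum _ (hint w)]
      refine Finset.sum_congr rfl fun l _ => ?_
      rw [integral_mul_const, integral_complex_ofReal]
    have hmem : ∀ l ∈ Finset.range (j + 1), (i, l) ∈ logIdx n k := by
      intro l hl
      rw [Finset.mem_range] at hl
      rw [mem_logIdx]
      simp only
      omega
    refine ((HasLogExp.sum hW _ fun l hl => (hasLogExp_logMon (hmem l hl)).const_mul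
      ((∫ p in Ioi (0 : ℝ), a l p : ℝ) : ℂ)).congr fun w _ => heq w).mono ?_
    calc ∑ l ∈ Finset.range (j + 1), ‖((∫ p in Ioi (0 : ℝ), a l p : ℝ) : ℂ)‖ * logWt n W (i, l)
        ≤ ∑ l ∈ Finset.range (j + 1), (∫ p in Ioi (0 : ℝ), |a l p|) * logWt n W (i, l) := by
          refine Finset.sum_le_sum fun l _ => ?_
          refine mul_le_mul_of_nonneg_right ?_ (logWt_nonneg hW _)
          rw [Complex.norm_real]
          exact norm_integral_le_integral_norm _
      _ = W i * ∫ p in Ioi (0 : ℝ), ∑ l ∈ Finset.range (j + 1), (2 * (n : ℝ)) ^ l * |a l p| := by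
          rw [integral_finsetSum _ fun l hl => (hai l hl).abs.const_mul _, Finset.mul_sum]
          refine Finset.sum_congr rfl fun l _ => ?_
          rw [integral_const_mul, logWt]
          ring
      _ ≤ W i * ∫ p in Ioi (0 : ℝ), (2 * n) ^ j * H p := by
          refine mul_le_mul_of_nonneg_left ?_ (hW i).le
          refine setIntegral_mono_on (integrable_finsetSum _ fun l hl => (hai l hl).abs.const_mul _)
            (hH.const_mul _) measurableSet_Ioi hbound
      _ = _ := by rw [integral_const_mul, logWt]; ring

/-- Convolution with a kernel `G` that is integrable against `rescaleBound n` is bounded on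
expansions, because a rescaling `z ↦ z / p` is. -/
theorem HasLogExp.mellinOp (hn : 1 ≤ n) (hW : ∀ i, 0 < W i) (hf : HasLogExp b n k W N f)
    (hc : ContinuousOn f (strip b)) {G H : ℝ → ℝ}
    (hG : AEStronglyMeasurable G (volume.restrict (Ioi 0))) (hH : IntegrableOn H (Ioi 0))
    (hGH : ∀ p, 0 < p → |G p| * rescaleBound n p ≤ H p) :
    HasLogExp b n k W ((∫ p in Ioi (0 : ℝ), H p) * N) (mellinOp G f) := by
  obtain ⟨c, D, h0, h1, h2⟩ := hf
  have hH0 : 0 ≤ ∫ p in Ioi (0 : ℝ), H p := setIntegral_nonneg measurableSet_Ioi fun p hp =>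
    (mul_nonneg (abs_nonneg _) (rescaleBound_nonneg n hp)).trans (hGH p hp)
  set ρ : ℂ → ℂ := fun w => f w - ∑ x ∈ logIdx n k, c x * logMon x w with hρ
  have hρb : ∀ w ∈ strip b, ∀ p, 0 < p → ‖(G p : ℂ) * ρ (w - (Real.log p : ℝ))‖ ≤
      D * Real.exp ((n + 1 / 2) * w.re) * H p := by
    intro w hw p hp
    have h3 := h2 _ (sub_ofReal_mem_strip hw (Real.log p))
    have h4 : Real.exp ((n + 1 / 2) * (w - (Real.log p : ℝ)).re) =
        Real.exp ((n + 1 / 2) * w.re) * p ^ (-((n : ℝ) + 1 / 2)) := by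
      rw [Real.rpow_def_of_pos hp, ← Real.exp_add]
      congr 1
      simp only [Complex.sub_re, Complex.ofReal_re]
      ring
    rw [h4] at h3
    rw [norm_mul, Complex.norm_real, Real.norm_eq_abs]
    calc |G p| * ‖ρ (w - (Real.log p : ℝ))‖
        ≤ |G p| * (D * (Real.exp ((n + 1 / 2) * w.re) * rescaleBound n p)) := by
          refine mul_le_mul_of_nonneg_left (h3.trans ?_) (abs_nonneg _)
          gcongr
          exact le_max_left _ _
      _ = D * Real.exp ((n + 1 / 2) * w.re) * (|G p| * rescaleBound n p) := by ring
      _ ≤ _ := by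
          gcongr
          exact hGH p hp
  have hρc : ContinuousOn ρ (strip b) := hc.sub
    (continuous_finsetSum _ fun x _ => continuous_const.mul (continuous_logMon x)).continuousOn
  have hρi : ∀ w ∈ strip b,
      Integrable (fun p : ℝ => (G p : ℂ) * ρ (w - (Real.log p : ℝ))) (volume.restrict (Ioi 0)) := by
    intro w hw
    refine Integrable.mono' (hH.const_mul (D * Real.exp ((n + 1 / 2) * w.re))) ?_ ?_
    · exact (Complex.continuous_ofReal.comp_aestronglyMeasurable hG).mul
        (aestronglyMeasurable_comp_sub_log hρc hw)
    · filter_upwards [ae_restrict_mem measurableSet_Ioi] with p hp using hρb w hw p hp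
  refine HasLogExp.of_decomposition hW (c := c) (D := D)
    (T := fun x => JostBorel.mellinOp G (logMon x))
    (R := JostBorel.mellinOp G ρ) hH0 h1
    (fun x hx => (hasLogExp_mellinOp_logMon hn hW hG hH hGH hx).2) ?_ fun w hw => ?_
  · refine hasLogExp_of_norm_le (by positivity) fun w hw => ?_
    refine (norm_integral_le_of_norm_le
      (hH.const_mul (D * Real.exp ((n + 1 / 2) * w.re))) ?_).trans_eq ?_
    · filter_upwards [ae_restrict_mem measurableSet_Ioi] with p hp using hρb w hw p hp
    · rw [integral_const_mul]
      ring
  · have hi : ∀ x ∈ logIdx n k, Integrable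
        (fun p : ℝ => c x * ((G p : ℂ) * logMon x (w - (Real.log p : ℝ))))
        (volume.restrict (Ioi 0)) := fun x hx =>
      ((hasLogExp_mellinOp_logMon (b := b) hn hW hG hH hGH hx).1 w).const_mul _
    simp only [JostBorel.mellinOp]
    simp_rw [← integral_const_mul]
    rw [← integral_finsetSum _ hi, ← integral_add (integrable_finsetSum _ hi) (hρi w hw)]
    refine integral_congr_ae (ae_of_all _ fun p => ?_)
    simp only [hρ, mul_sub, Finset.mul_sum]
    have : ∀ x, c x * ((G p : ℂ) * logMon x (w - (Real.log p : ℝ))) =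
        (G p : ℂ) * (c x * logMon x (w - (Real.log p : ℝ))) := fun x => by ring
    simp_rw [this]
    ring

end Mellin

/-! ### Division by `1 + z` and resonant averages -/

section Operators

variable {b : ℝ} {n k : ℕ} {W : ℕ → ℝ} {N : ℝ} {f : ℂ → ℂ}

theorem logMon_mul_exp_pow (i j l : ℕ) (w : ℂ) :
    logMon (i, j) w * Complex.exp w ^ l = logMon (i + l, j) w := by
  simp only [logMon]
  rw [← Complex.exp_nat_mul, mul_right_comm, ← Complex.exp_add]
  push_cast
  ring_nf

/-- Division by `1 + z` on expansions. A monomial is divided by the finite geometric series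
`∑ (-z) ^ l` up to total degree `n`, and `C₀` bounds what is left over. -/
theorem HasLogExp.div_one_add_exp {κ C₀ Λ : ℝ} (hn : 1 ≤ n) (hW : ∀ i, 0 < W i)
    (hκ0 : 0 < κ) (hκ : ∀ w ∈ strip b, κ ≤ ‖1 + Complex.exp w‖) (hC0 : 0 ≤ C₀)
    (hC : ∀ j ≤ n, ∀ w ∈ strip b, ‖Complex.exp w * w ^ j / (1 + Complex.exp w)‖ ≤
      C₀ * Real.exp (w.re / 2))
    (h1 : 1 / κ ≤ Λ) (h2 : ∀ i ≤ n, ∑ l ∈ Finset.range (n - i + 1), W (i + l) + C₀ ≤ Λ * W i)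
    (hf : HasLogExp b n k W N f) :
    HasLogExp b n k W (Λ * N) fun w => f w / (1 + Complex.exp w) := by
  obtain ⟨c, D, hD0, hcD, hρ⟩ := hf
  have hΛ : 0 ≤ Λ := le_trans (by positivity) h1
  refine HasLogExp.of_decomposition hW (c := c) (D := D)
    (T := fun x w => logMon x w / (1 + Complex.exp w))
    (R := fun w => (f w - ∑ x ∈ logIdx n k, c x * logMon x w) / (1 + Complex.exp w))
    hΛ hcD (fun x hx => ?_) ?_ fun w hw => ?_
  · obtain ⟨i, j⟩ := x
    obtain ⟨hi, hji, hjk⟩ := mem_logIdx.mp hx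
    simp only at hi hji hjk
    -- the remainder of the geometric series of `1 / (1 + z)`, cut at total degree `n`
    have htail : HasLogExp b n k W C₀ fun w => (-1) ^ (n - i + 1) *
        (Complex.exp (n * w) * (Complex.exp w * w ^ j / (1 + Complex.exp w))) := by
      refine hasLogExp_of_norm_le hC0 fun w hw => ?_
      rw [norm_mul, norm_pow, norm_neg, norm_one, one_pow, one_mul, norm_mul, Complex.norm_exp]
      have e : Real.exp ((n + 1 / 2) * w.re) = Real.exp ((n * w).re) * Real.exp (w.re / 2) := by
        have hre : ((n : ℂ) * w).re = n * w.re := by simp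
        rw [← Real.exp_add, hre]
        ring_nf
      rw [e]
      calc _ ≤ Real.exp ((n * w).re) * (C₀ * Real.exp (w.re / 2)) := by
            gcongr
            exact hC j (hji.trans hi) w hw
        _ = _ := by ring
    have hmem : ∀ l ∈ Finset.range (n - i + 1), (i + l, j) ∈ logIdx n k := by
      intro l hl
      rw [Finset.mem_range] at hl
      rw [mem_logIdx]
      simp only
      omega
    have hsum := (HasLogExp.sum hW _ fun l hl =>
      (hasLogExp_logMon (b := b) (W := W) (hmem l hl)).const_mul ((-1) ^ l)).add hW htail
    refine (hsum.congr fun w hw => ?_).mono ?_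
    · have hne : 1 + Complex.exp w ≠ 0 := norm_pos_iff.mp (hκ0.trans_le (hκ w hw))
      have hgeom := mul_neg_geom_sum (-Complex.exp w) (n - i + 1)
      rw [sub_neg_eq_add] at hgeom
      have hs : ∑ l ∈ Finset.range (n - i + 1), (-1) ^ l * logMon (i + l, j) w =
          logMon (i, j) w * ∑ l ∈ Finset.range (n - i + 1), (-Complex.exp w) ^ l := by
        rw [Finset.mul_sum]
        refine Finset.sum_congr rfl fun l _ => ?_
        rw [← logMon_mul_exp_pow, neg_pow (Complex.exp w)]
        ring
      have ht : Complex.exp (n * w) * (Complex.exp w * w ^ j) =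
          logMon (i, j) w * Complex.exp w ^ (n - i + 1) := by
        rw [logMon_mul_exp_pow, logMon]
        have : i + (n - i + 1) = n + 1 := by omega
        simp only [this]
        push_cast
        rw [add_mul, one_mul, Complex.exp_add]
        ring
      have hi : (1 + Complex.exp w) * (1 + Complex.exp w)⁻¹ = 1 := mul_inv_cancel₀ hne
      rw [neg_pow] at hgeom
      rw [hs, div_eq_mul_inv, div_eq_mul_inv]
      linear_combination (-logMon (i, j) w * (1 + Complex.exp w)⁻¹) * hgeom +
        logMon (i, j) w * (∑ l ∈ Finset.range (n - i + 1), (-Complex.exp w) ^ l) * hi -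
        (-1) ^ (n - i + 1) * (1 + Complex.exp w)⁻¹ * ht
    · have hp : (1 : ℝ) ≤ (2 * n) ^ j := by
        refine one_le_pow₀ ?_
        have : (1 : ℝ) ≤ n := by exact_mod_cast hn
        linarith
      have h3 := h2 i hi
      calc ∑ l ∈ Finset.range (n - i + 1), ‖((-1 : ℂ)) ^ l‖ * logWt n W (i + l, j) + C₀
          = (∑ l ∈ Finset.range (n - i + 1), W (i + l)) * (2 * n) ^ j + C₀ := by
            rw [Finset.sum_mul]
            simp [logWt]
        _ ≤ (∑ l ∈ Finset.range (n - i + 1), W (i + l)) * (2 * n) ^ j + C₀ * (2 * n) ^ j := by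
            gcongr
            exact le_mul_of_one_le_right hC0 hp
        _ = (∑ l ∈ Finset.range (n - i + 1), W (i + l) + C₀) * (2 * n) ^ j := by ring
        _ ≤ (Λ * W i) * (2 * n) ^ j := by gcongr
        _ = _ := by rw [logWt]; ring
  · refine hasLogExp_of_norm_le (by positivity) fun w hw => ?_
    rw [norm_div]
    calc _ ≤ D * Real.exp ((n + 1 / 2) * w.re) / κ := by
          gcongr
          · exact hρ w hw
          · exact hκ w hw
      _ = 1 / κ * (D * Real.exp ((n + 1 / 2) * w.re)) := by ring
      _ ≤ Λ * (D * Real.exp ((n + 1 / 2) * w.re)) := by gcongr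
      _ = _ := by ring
  · simp only [sub_div, Finset.sum_div, mul_div_assoc]
    ring

theorem exists_norm_exp_mul_pow_div_le {κ : ℝ} (hb : 0 < b) (hκ0 : 0 < κ)
    (hκ : ∀ w ∈ strip b, κ ≤ ‖1 + Complex.exp w‖) (n : ℕ) :
    ∃ C₀, 0 ≤ C₀ ∧ ∀ j ≤ n, ∀ w ∈ strip b,
      ‖Complex.exp w * w ^ j / (1 + Complex.exp w)‖ ≤ C₀ * Real.exp (w.re / 2) := by
  set A : ℝ := 2 ^ n * n.factorial * Real.exp ((1 + b) / 2) with hA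
  have hA0 : 0 ≤ A := by positivity
  refine ⟨A * (1 + 1 / κ), by positivity, fun j hj w hw => ?_⟩
  have hw' : |w.im| < b := hw
  have hpow : ‖w‖ ^ j ≤ A * Real.exp (|w.re| / 2) := by
    have h1 : ‖w‖ ≤ 1 + b + |w.re| := by
      have := Complex.norm_le_abs_re_add_abs_im w
      linarith
    have h2 : (1 : ℝ) ≤ 1 + b + |w.re| := by
      have := abs_nonneg w.re
      linarith
    have h3 := Real.pow_div_factorial_le_exp ((1 + b + |w.re|) / 2) (by positivity) n
    rw [div_le_iff₀ (by positivity), div_pow, div_le_iff₀ (by positivity)] at h3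
    calc ‖w‖ ^ j ≤ (1 + b + |w.re|) ^ j := by gcongr
      _ ≤ (1 + b + |w.re|) ^ n := pow_le_pow_right₀ h2 hj
      _ ≤ _ := h3
      _ = _ := by
        rw [hA, add_div, Real.exp_add]
        ring
  have hpos : 0 < ‖1 + Complex.exp w‖ := hκ0.trans_le (hκ w hw)
  have hinv : ‖1 + Complex.exp w‖⁻¹ ≤ 1 / κ := by
    rw [one_div]
    exact inv_anti₀ hκ0 (hκ w hw)
  have hquot : ‖Complex.exp w / (1 + Complex.exp w)‖ * Real.exp (|w.re| / 2) ≤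
      (1 + 1 / κ) * Real.exp (w.re / 2) := by
    rcases le_total 0 w.re with h | h
    · rw [abs_of_nonneg h]
      gcongr
      have e : Complex.exp w / (1 + Complex.exp w) = 1 - (1 + Complex.exp w)⁻¹ := by
        have := norm_pos_iff.mp hpos
        field_simp
        ring
      rw [e]
      refine (norm_sub_le _ _).trans ?_
      rw [norm_one, norm_inv]
      gcongr
    · rw [abs_of_nonpos h, norm_div, Complex.norm_exp, div_eq_mul_inv]
      have e : Real.exp (w.re / 2) = Real.exp w.re * Real.exp (-w.re / 2) := by
        rw [← Real.exp_add]; ring_nf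
      rw [e]
      have : ‖1 + Complex.exp w‖⁻¹ ≤ 1 + 1 / κ := by linarith
      calc _ ≤ Real.exp w.re * (1 + 1 / κ) * Real.exp (-w.re / 2) := by gcongr
        _ = _ := by ring
  rw [mul_div_right_comm, norm_mul, norm_pow]
  calc _ ≤ ‖Complex.exp w / (1 + Complex.exp w)‖ * (A * Real.exp (|w.re| / 2)) := by gcongr
    _ = A * (‖Complex.exp w / (1 + Complex.exp w)‖ * Real.exp (|w.re| / 2)) := by ring
    _ ≤ A * ((1 + 1 / κ) * Real.exp (w.re / 2)) := by gcongr
    _ = _ := by ring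

theorem hasDerivAt_logMon (i j : ℕ) (w : ℂ) :
    HasDerivAt (logMon (i, j)) (i * logMon (i, j) w + j * logMon (i, j - 1) w) w := by
  have h1 : HasDerivAt (fun w : ℂ => (i : ℂ) * w) i w := by
    simpa using (hasDerivAt_id w).const_mul (i : ℂ)
  have h2 := h1.cexp.mul (hasDerivAt_pow j w)
  refine h2.congr_deriv ?_
  simp only [logMon]
  ring

/-- The equation `Y' = a Y - z ^ i log ^ j z` is solved by a combination of monomials; at the
resonance `i = a` the power of the logarithm goes up by one. -/
theorem exists_hasDerivAt_logMon (b : ℝ) (W : ℕ → ℝ) (hW : ∀ i, 0 < W i) {a i j : ℕ} (hka : k < a)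
    (hx : (i, j) ∈ logIdx n k) :
    ∃ (Y : ℂ → ℂ) (N' : ℝ), HasLogExp b n (k + 1) W N' Y ∧
      ∀ w, HasDerivAt Y (a * Y w - logMon (i, j) w) w := by
  obtain ⟨hi, hji, hjk⟩ := mem_logIdx.mp hx
  simp only at hi hji hjk
  rcases eq_or_ne i a with rfl | hia
  · have hmem : (i, j + 1) ∈ logIdx n (k + 1) := by
      rw [mem_logIdx]
      simp only
      omega
    refine ⟨_, _, (hasLogExp_logMon hmem).const_mul (-((j : ℂ) + 1)⁻¹), fun w => ?_⟩
    have h := (hasDerivAt_logMon i (j + 1) w).const_mul (-((j : ℂ) + 1)⁻¹)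
    refine h.congr_deriv ?_
    have : (j : ℂ) + 1 ≠ 0 := by exact_mod_cast Nat.succ_ne_zero j
    push_cast
    field_simp
    ring
  · have hne : (a : ℂ) - i ≠ 0 := by
      rw [sub_ne_zero]
      exact_mod_cast hia.symm
    induction j with
    | zero =>
      have hmem : (i, 0) ∈ logIdx n (k + 1) := logIdx_subset (Nat.le_succ k) hx
      refine ⟨_, _, (hasLogExp_logMon hmem).const_mul ((a : ℂ) - i)⁻¹, fun w => ?_⟩
      have h := (hasDerivAt_logMon i 0 w).const_mul ((a : ℂ) - i)⁻¹
      refine h.congr_deriv ?_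
      push_cast
      field_simp
      ring
    | succ j ih =>
      have hx' : (i, j) ∈ logIdx n k := by
        rw [mem_logIdx]
        simp only
        omega
      obtain ⟨Y, N', hY, hYd⟩ := ih hx' (by omega) (by omega)
      have hmem : (i, j + 1) ∈ logIdx n (k + 1) := logIdx_subset (Nat.le_succ k) hx
      refine ⟨_, _, ((hasLogExp_logMon hmem).add hW (hY.const_mul ((j : ℂ) + 1))).const_mul
        ((a : ℂ) - i)⁻¹, fun w => ?_⟩
      have h := ((hasDerivAt_logMon i (j + 1) w).add ((hYd w).const_mul ((j : ℂ) + 1))).const_mul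
        ((a : ℂ) - i)⁻¹
      refine h.congr_deriv ?_
      push_cast
      field_simp
      ring

/-- A function whose derivative decays exponentially as `Re w → -∞` in a strip has a limit there,
and approaches it at the same rate. -/
theorem exists_limit_of_deriv_le {H H' : ℂ → ℂ} {D β : ℝ} (hb : 0 < b) (hβ : 0 < β)
    (hD0 : 0 ≤ D) (hd : ∀ w ∈ strip b, HasDerivAt H (H' w) w)
    (hD : ∀ w ∈ strip b, ‖H' w‖ ≤ D * Real.exp (β * w.re)) :
    ∃ L C, 0 ≤ C ∧ ∀ w ∈ strip b, ‖H w - L‖ ≤ C * Real.exp (β * w.re) := by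
  have hmv : ∀ x : ℝ, ∀ v ∈ strip b, ∀ w ∈ strip b, v.re ≤ x → w.re ≤ x →
      ‖H w - H v‖ ≤ D * Real.exp (β * x) * ‖w - v‖ := by
    intro x v hv w hw hvx hwx
    have hconv : Convex ℝ (strip b ∩ {w : ℂ | w.re ≤ x}) :=
      (convex_strip b).inter (convex_halfSpace_re_le x)
    refine hconv.norm_image_sub_le_of_norm_hasDerivWithin_le (f' := H')
      (fun u hu => (hd u hu.1).hasDerivWithinAt) (fun u hu => (hD u hu.1).trans ?_) ⟨hv, hvx⟩
      ⟨hw, hwx⟩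
    have : u.re ≤ x := hu.2
    gcongr
  have hq : Real.exp (-β) < 1 := by
    rw [Real.exp_lt_one_iff]
    linarith
  have hmem : ∀ w ∈ strip b, ∀ m : ℕ, w - m ∈ strip b := by
    intro w hw m
    have := sub_ofReal_mem_strip hw (m : ℝ)
    simpa using this
  have hexp : ∀ (x : ℝ) (m : ℕ), Real.exp (β * (x - m)) =
      Real.exp (β * x) * Real.exp (-β) ^ m := by
    intro x m
    rw [← Real.exp_nat_mul, ← Real.exp_add]
    ring_nf
  have hgeo : ∀ w ∈ strip b, ∀ m : ℕ, dist (H (w - m)) (H (w - (m + 1 : ℕ))) ≤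
      D * Real.exp (β * w.re) * Real.exp (-β) ^ m := by
    intro w hw m
    rw [dist_eq_norm]
    refine (hmv (w.re - m) _ (hmem w hw (m + 1)) _ (hmem w hw m) ?_ ?_).trans ?_
    · simp only [Complex.sub_re, Complex.natCast_re]
      push_cast
      linarith
    · simp
    · rw [hexp]
      have : w - m - (w - (m + 1 : ℕ)) = 1 := by push_cast; ring
      rw [this, norm_one, mul_one, mul_assoc]
  have h0 : (0 : ℂ) ∈ strip b := by simpa [strip] using hb
  obtain ⟨L, hL⟩ := cauchySeq_tendsto_of_complete (cauchySeq_of_le_geometric _ _ hq (hgeo 0 h0))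
  have hlim : ∀ w ∈ strip b, Tendsto (fun m : ℕ => H (w - m)) atTop (𝓝 L) := by
    intro w hw
    have hdiff : Tendsto (fun m : ℕ => H (w - m) - H (0 - m)) atTop (𝓝 0) := by
      have hlim0 : Tendsto (fun m : ℕ => D * (Real.exp (β * max w.re 0) * Real.exp (-β) ^ m) *
          ‖w‖) atTop (𝓝 0) := by
        have := tendsto_pow_atTop_nhds_zero_of_lt_one (Real.exp_pos (-β)).le hq
        simpa using (((this.const_mul (Real.exp (β * max w.re 0))).const_mul D).mul_const ‖w‖)
      refine squeeze_zero_norm (fun m => ?_) hlim0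
      have h := hmv (max w.re 0 - m) _ (hmem 0 h0 m) _ (hmem w hw m) (by simp) (by simp)
      rw [hexp] at h
      have e : w - m - (0 - m) = w := by ring
      rwa [e] at h
    have := hdiff.add hL
    simpa using this
  refine ⟨L, D / (1 - Real.exp (-β)), div_nonneg hD0 (by linarith), fun w hw => ?_⟩
  have h := dist_le_of_le_geometric_of_tendsto₀ _ _ hq (hgeo w hw) (hlim w hw)
  rw [dist_eq_norm, Nat.cast_zero, sub_zero] at h
  refine h.trans_eq ?_
  ring

/-- Solutions of `y' = a y - f` inherit logarithmic expansions from `f`, one power of the logarithm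
being added at the resonant exponent `z ^ a`. The homogeneous solution `z ^ a` enters with a
coefficient that is the same on the whole strip. -/
theorem HasLogExp.of_hasDerivAt (hb : 0 < b) (hW : ∀ i, 0 < W i) {a : ℕ} (hka : k < a)
    (han : a ≤ n) (hf : HasLogExp b n k W N f) {y : ℂ → ℂ}
    (hy : ∀ w ∈ strip b, HasDerivAt y (a * y w - f w) w) :
    ∃ N', HasLogExp b n (k + 1) W N' y := by
  classical
  obtain ⟨c, D, hD0, -, hρ⟩ := hf
  have hY : ∀ x : ℕ × ℕ, ∃ (Y : ℂ → ℂ) (N' : ℝ), x ∈ logIdx n k →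
      (HasLogExp b n (k + 1) W N' Y ∧ ∀ w, HasDerivAt Y (a * Y w - logMon x w) w) := by
    intro x
    by_cases hx : x ∈ logIdx n k
    · obtain ⟨Y, N', h⟩ := exists_hasDerivAt_logMon b W hW hka hx
      exact ⟨Y, N', fun _ => h⟩
    · exact ⟨0, 0, fun h => absurd h hx⟩
  choose Y NY hY using hY
  set S : ℂ → ℂ := fun w => ∑ x ∈ logIdx n k, c x * Y x w with hS
  have hSd : ∀ w, HasDerivAt S (a * S w - ∑ x ∈ logIdx n k, c x * logMon x w) w := by
    intro w
    have h := HasDerivAt.fun_sum (u := logIdx n k) fun x hx =>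
      ((hY x hx).2 w).const_mul (c x)
    refine h.congr_deriv ?_
    rw [hS]
    simp only
    rw [Finset.mul_sum, ← Finset.sum_sub_distrib]
    refine Finset.sum_congr rfl fun x _ => ?_
    ring
  set ρ : ℂ → ℂ := fun w => f w - ∑ x ∈ logIdx n k, c x * logMon x w with hρdef
  -- `H` is the coefficient of the homogeneous solution `z ^ a` by variation of constants
  set H : ℂ → ℂ := fun w => Complex.exp (-(a * w)) * (y w - S w) with hH
  have hHd : ∀ w ∈ strip b, HasDerivAt H (-(Complex.exp (-(a * w)) * ρ w)) w := by
    intro w hw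
    have h1 : HasDerivAt (fun w : ℂ => -((a : ℂ) * w)) (-a) w := by
      simpa using ((hasDerivAt_id w).const_mul (a : ℂ)).fun_neg
    refine (h1.cexp.mul ((hy w hw).sub (hSd w))).congr_deriv ?_
    simp only [hρdef, Pi.sub_apply]
    ring
  have han' : (a : ℝ) ≤ n := by exact_mod_cast han
  obtain ⟨L, C, hC0, hL⟩ := exists_limit_of_deriv_le (β := (n : ℝ) + 1 / 2 - a) hb (by linarith)
    hD0 hHd fun w hw => by
      rw [norm_neg, norm_mul, Complex.norm_exp]
      have e : (-((a : ℂ) * w)).re = -(a * w.re) := by simp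
      rw [e]
      calc _ ≤ Real.exp (-(a * w.re)) * (D * Real.exp ((n + 1 / 2) * w.re)) := by
            gcongr
            exact hρ w hw
        _ = D * (Real.exp (-(a * w.re)) * Real.exp ((n + 1 / 2) * w.re)) := by ring
        _ = _ := by rw [← Real.exp_add]; ring_nf
  have hmem : (a, 0) ∈ logIdx n (k + 1) := by
    rw [mem_logIdx]
    simp only
    omega
  have hrem : HasLogExp b n (k + 1) W C fun w => Complex.exp (a * w) * (H w - L) := by
    refine hasLogExp_of_norm_le hC0 fun w hw => ?_
    have hre : ((a : ℂ) * w).re = a * w.re := by simp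
    rw [norm_mul, Complex.norm_exp, hre]
    calc _ ≤ Real.exp (a * w.re) * (C * Real.exp (((n : ℝ) + 1 / 2 - a) * w.re)) := by
          gcongr
          exact hL w hw
      _ = C * (Real.exp (a * w.re) * Real.exp (((n : ℝ) + 1 / 2 - a) * w.re)) := by ring
      _ = _ := by rw [← Real.exp_add]; ring_nf
  refine ⟨_, (((HasLogExp.sum hW (logIdx n k) fun x hx => (hY x hx).1.const_mul (c x)).add hW
    ((hasLogExp_logMon hmem).const_mul L)).add hW hrem).congr fun w _ => ?_⟩
  have hexp : Complex.exp (a * w) * Complex.exp (-(a * w)) = 1 := by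
    rw [← Complex.exp_add]; simp
  have hlog : logMon (a, 0) w = Complex.exp (a * w) := by simp [logMon]
  rw [hlog]
  simp only [hH]
  simp only [hS]
  linear_combination (-(y w - ∑ x ∈ logIdx n k, c x * Y x w)) * hexp

end Operators

/-! ### Expansions of the components of the Jost solution -/

section PowAvg

variable {b : ℝ} {n k : ℕ} {W : ℕ → ℝ} {N : ℝ} {f : ℂ → ℂ}

theorem rescaleBound_eq {n : ℕ} {p : ℝ} (hp : 0 < p) (hp1 : p ≤ 1) :
    rescaleBound n p = p ^ (-((n : ℝ) + 1 / 2)) := by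
  refine max_eq_left (Real.rpow_le_rpow_of_exponent_ge hp hp1 ?_)
  have : (0 : ℝ) ≤ n := n.cast_nonneg
  linarith

theorem rescaleBound_le {n : ℕ} {p : ℝ} (hp : 1 ≤ p) : rescaleBound n p ≤ p ^ (1 / 2 : ℝ) := by
  refine max_le (Real.rpow_le_rpow_of_exponent_le hp ?_) le_rfl
  have : (0 : ℝ) ≤ n := n.cast_nonneg
  linarith

theorem integrableOn_indicator_rpow {s : ℝ} (hs : -1 < s) :
    IntegrableOn ((Iio (1 : ℝ)).indicator fun p => p ^ s) (Ioi 0) ∧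
      ∫ p in Ioi (0 : ℝ), (Iio (1 : ℝ)).indicator (fun p => p ^ s) p = 1 / (s + 1) := by
  constructor
  · rw [IntegrableOn, integrable_indicator_iff measurableSet_Iio, IntegrableOn,
      Measure.restrict_restrict measurableSet_Iio, inter_comm, Ioi_inter_Iio]
    have := intervalIntegral.intervalIntegrable_rpow' (a := 0) (b := 1) hs
    rwa [intervalIntegrable_iff_integrableOn_Ioo_of_le zero_le_one] at this
  · rw [setIntegral_indicator measurableSet_Iio, Ioi_inter_Iio, ← integral_Ioc_eq_integral_Ioo,
      ← intervalIntegral.integral_of_le zero_le_one, integral_rpow (Or.inl hs), Real.one_rpow,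
      Real.zero_rpow (by linarith), sub_zero]

theorem HasLogExp.powAvg_of_le (hn : 1 ≤ n) (hW : ∀ i, 0 < W i) (hf : HasLogExp b n k W N f)
    (hc : ContinuousOn f (strip b)) {q : ℕ} (hq : n ≤ q) :
    HasLogExp b n k W (1 / ((q : ℝ) - n + 1 / 2) * N) (powAvg q f) := by
  have hq' : (n : ℝ) ≤ q := by exact_mod_cast hq
  obtain ⟨hi, hv⟩ := integrableOn_indicator_rpow (s := (q : ℝ) - n - 1 / 2) (by linarith)
  have h := hf.mellinOp hn hW hc (G := powKer q) (integrableOn_powKer q).aestronglyMeasurable hi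
    fun p hp => ?_
  · rw [hv, show (q : ℝ) - n - 1 / 2 + 1 = q - n + 1 / 2 by ring] at h
    exact h
  · by_cases hp1 : p < 1
    · have hm : p ∈ Iio (1 : ℝ) := hp1
      rw [powKer, indicator_of_mem hm, indicator_of_mem hm, rescaleBound_eq hp hp1.le,
        abs_of_nonneg (by positivity), ← Real.rpow_natCast, ← Real.rpow_add hp]
      refine le_of_eq ?_
      congr 1
      ring
    · have hm : p ∉ Iio (1 : ℝ) := hp1
      rw [powKer, indicator_of_notMem hm, indicator_of_notMem hm, abs_zero, zero_mul]

/-- An average with `q ≥ k` keeps the class of expansions and raises the degree in the logarithm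
by at most one. -/
theorem HasLogExp.powAvg {C : ℝ} (hb : 0 < b) (hn : 1 ≤ n) (hW : ∀ i, 0 < W i)
    (hf : HasLogExp b n k W N f) (hd : DifferentiableOn ℂ f (strip b))
    (hC : ∀ v ∈ strip b, ‖f v‖ ≤ C) {q : ℕ} (hq : k ≤ q) :
    ∃ N', HasLogExp b n (k + 1) W N' (powAvg q f) := by
  rcases le_or_gt n q with h | h
  · exact ⟨_, (hf.powAvg_of_le hn hW hd.continuousOn h).mono_deg (Nat.le_succ k)⟩
  · refine hf.of_hasDerivAt hb hW (a := q + 1) (by omega) (by omega) fun w hw => ?_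
    refine (hasDerivAt_powAvg q hd hC hw).congr_deriv ?_
    push_cast
    ring

end PowAvg

/-- The contribution of the `k`-th component of the Borel transform to its Laplace transform at
`r`, as a function of `w = log z`. -/
noncomputable def jostComponent (M r : ℝ) (k : ℕ) : ℂ → ℂ :=
  mellinOp (fun p => p ^ k * Real.exp (-(r * p))) (borelCoeff M k)

/-- Data fixing a strip and weights for which division by `1 + z` is bounded by `Λ` on
expansions. -/
structure Calibration (n : ℕ) (δ Λ : ℝ) (W : ℕ → ℝ) : Prop where
  pos : 0 < δ
  lt : δ < Real.pi / 2
  one_le : 1 ≤ n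
  weight_pos : ∀ i, 0 < W i
  inv_cos_le : 1 / Real.cos δ ≤ Λ
  div_one_add_exp : ∀ (k : ℕ) (N : ℝ) (f : ℂ → ℂ), HasLogExp (Real.pi / 2 + δ) n k W N f →
    HasLogExp (Real.pi / 2 + δ) n k W (Λ * N) fun w => f w / (1 + Complex.exp w)

/-- For every `Λ > 1` there are a strip and weights such that division by `1 + z` is bounded by
`Λ`: take the opening with `cos δ = 1 / Λ` and weights `A η ^ i` with `η` small and `A` large. -/
theorem exists_calibration {n : ℕ} (hn : 1 ≤ n) {Λ : ℝ} (hΛ : 1 < Λ) :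
    ∃ δ W, Calibration n δ Λ W := by
  have hΛ0 : 0 < Λ := by linarith
  set δ := Real.arccos (1 / Λ) with hδ
  have hinv1 : 1 / Λ < 1 := by rw [div_lt_one hΛ0]; exact hΛ
  have hinv0 : 0 < 1 / Λ := by positivity
  have hδ0 : 0 < δ := Real.arccos_pos.mpr hinv1
  have hδ1 : δ < Real.pi / 2 := by rw [hδ, Real.arccos_lt_pi_div_two]; exact hinv0
  have hcos : Real.cos δ = 1 / Λ := Real.cos_arccos (by linarith) hinv1.le
  have hb : 0 < Real.pi / 2 + δ := by positivity
  have hκ : ∀ w ∈ strip (Real.pi / 2 + δ), 1 / Λ ≤ ‖1 + Complex.exp w‖ := fun w hw => by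
    have := cos_le_norm_of_mem_strip hδ1 hw 0
    rw [hcos] at this
    simpa using this
  obtain ⟨C₀, hC0, hC⟩ := exists_norm_exp_mul_pow_div_le hb hinv0 hκ n
  set η := (Λ - 1) / (2 * Λ) with hη
  have hη0 : 0 < η := div_pos (by linarith) (by positivity)
  have hη1 : η < 1 := by rw [hη, div_lt_one (by positivity)]; linarith
  have h1η : 1 / (1 - η) < Λ := by
    have : 1 - η = (Λ + 1) / (2 * Λ) := by rw [hη]; field_simp; ring
    rw [this, one_div_div, div_lt_iff₀ (by positivity)]
    nlinarith
  set g := Λ - 1 / (1 - η) with hg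
  have hg0 : 0 < g := by rw [hg]; linarith
  set A := C₀ / (η ^ n * g) + 1 with hA
  have hA0 : 0 < A := by positivity
  have hAC : C₀ ≤ A * η ^ n * g := by
    rw [hA, add_mul, add_mul, div_mul_eq_mul_div, div_mul_eq_mul_div, one_mul, mul_assoc,
      mul_div_assoc, div_self (by positivity), mul_one]
    exact le_add_of_nonneg_right (by positivity)
  have hW : ∀ i, 0 < A * η ^ i := fun i => by positivity
  refine ⟨δ, fun i => A * η ^ i, hδ0, hδ1, hn, hW, by rw [hcos, one_div_one_div],
    fun k N f hf => hf.div_one_add_exp hn hW hinv0 hκ hC0 hC (by rw [one_div_one_div])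
      fun i hi => ?_⟩
  have hgeom : ∑ l ∈ Finset.range (n - i + 1), A * η ^ (i + l) ≤ A * η ^ i * (1 / (1 - η)) := by
    have h1 : ∑ l ∈ Finset.range (n - i + 1), A * η ^ (i + l) =
        A * η ^ i * ∑ l ∈ Finset.range (n - i + 1), η ^ l := by
      rw [Finset.mul_sum]
      refine Finset.sum_congr rfl fun l _ => ?_
      rw [pow_add]
      ring
    rw [h1, one_div, ← tsum_geometric_of_lt_one hη0.le hη1]
    gcongr
    exact (summable_geometric_of_lt_one hη0.le hη1).sum_le_tsum _ fun l _ => by positivity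
  have hpow : A * η ^ n * g ≤ A * η ^ i * g := by
    have := pow_le_pow_of_le_one hη0.le hη1.le hi
    gcongr
  calc _ ≤ A * η ^ i * (1 / (1 - η)) + A * η ^ i * g := add_le_add hgeom (hAC.trans hpow)
    _ = _ := by rw [hg]; ring

section Components

variable {n : ℕ} {δ Λ : ℝ} {W : ℕ → ℝ} {M : ℝ}

theorem hasLogExp_borelCoeff_succ (h : Calibration n δ Λ W) (hM : 0 < M) {k k' : ℕ} {N₁ N₂ : ℝ}
    (h1 : HasLogExp (Real.pi / 2 + δ) n k' W N₁ (powAvg k (borelCoeff M k)))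
    (h2 : HasLogExp (Real.pi / 2 + δ) n k' W N₂ (powAvg (k + 2) (borelCoeff M k))) :
    HasLogExp (Real.pi / 2 + δ) n k' W (M * (Λ * (N₁ + N₂))) (borelCoeff M (k + 1)) := by
  have h3 := (h.div_one_add_exp _ _ _ (h1.add h.weight_pos h2)).const_mul (M : ℂ)
  rw [Complex.norm_real, Real.norm_eq_abs, abs_of_pos hM] at h3
  refine h3.congr fun w _ => ?_
  rw [borelCoeff]
  ring

theorem exists_hasLogExp_borelCoeff (h : Calibration n δ Λ W) (hM : 0 < M) (k : ℕ) :
    ∃ N, HasLogExp (Real.pi / 2 + δ) n k W N (borelCoeff M k) := by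
  induction k with
  | zero =>
    have h0 : (0, 0) ∈ logIdx n 0 := by simp [mem_logIdx]
    have h1 := (h.div_one_add_exp _ _ _ (hasLogExp_logMon h0)).const_mul (M : ℂ)
    refine ⟨_, h1.congr fun w _ => ?_⟩
    simp only [borelCoeff, logMon]
    simp
    ring
  | succ k ih =>
    obtain ⟨N, hN⟩ := ih
    have hb : 0 < Real.pi / 2 + δ := by
      have := h.pos
      positivity
    have hav : ∀ q, k ≤ q → ∃ N',
        HasLogExp (Real.pi / 2 + δ) n (k + 1) W N' (powAvg q (borelCoeff M k)) := fun q hq =>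
      hN.powAvg hb h.one_le h.weight_pos (differentiableOn_borelCoeff hM h.pos.le h.lt k)
        (fun v hv => norm_borelCoeff_le_of_mem_strip hM h.pos.le h.lt k hv) hq
    obtain ⟨N₁, h1⟩ := hav k le_rfl
    obtain ⟨N₂, h2⟩ := hav (k + 2) (by omega)
    exact ⟨_, hasLogExp_borelCoeff_succ h hM h1 h2⟩

/-- Beyond `k = n` no resonance occurs, and the averages improve the constants by a factor
`1 / (m + 1)`. -/
theorem exists_hasLogExp_borelCoeff_factorial (h : Calibration n δ Λ W) (hM : 0 < M) :
    ∃ N₀, ∀ m : ℕ, HasLogExp (Real.pi / 2 + δ) n (n + 1) W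
      (N₀ * ((2 * M * Λ) ^ m / m.factorial)) (borelCoeff M (n + 1 + m)) := by
  obtain ⟨N₀, hN⟩ := exists_hasLogExp_borelCoeff h hM (n + 1)
  refine ⟨N₀, fun m => ?_⟩
  induction m with
  | zero => simpa using hN
  | succ m ih =>
    have hN0 := ih.nonneg h.weight_pos
    have hc := (differentiableOn_borelCoeff hM h.pos.le h.lt (n + 1 + m)).continuousOn
    have hav : ∀ q, n + 1 + m ≤ q → HasLogExp (Real.pi / 2 + δ) n (n + 1) W
        (1 / ((m : ℝ) + 1) * (N₀ * ((2 * M * Λ) ^ m / m.factorial)))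
        (powAvg q (borelCoeff M (n + 1 + m))) := by
      intro q hq
      refine (ih.powAvg_of_le h.one_le h.weight_pos hc (by omega)).mono ?_
      have hq' : (n : ℝ) + 1 + m ≤ q := by exact_mod_cast hq
      exact mul_le_mul_of_nonneg_right (one_div_le_one_div_of_le (by positivity) (by linarith)) hN0
    have h3 := hasLogExp_borelCoeff_succ h hM (hav _ le_rfl) (hav (n + 1 + m + 2) (by omega))
    refine h3.mono (le_of_eq ?_)
    rw [Nat.factorial_succ, pow_succ]
    push_cast
    field_simp
    ring

/-- For `k > n` the weight `p ^ k` compensates the singularity of the rescaling bound at `p = 0`;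
replacing `r` by `r' < r` leaves room for the polynomial factors at `p = ∞`. -/
theorem hasLogExp_jostComponent_of_lt (h : Calibration n δ Λ W) (hM : 0 < M) {r r' : ℝ}
    (hr' : 0 < r') (hr : r' < r) :
    ∃ C, ∀ (m : ℕ) (N : ℝ), HasLogExp (Real.pi / 2 + δ) n (n + 1) W N (borelCoeff M (n + 1 + m)) →
      HasLogExp (Real.pi / 2 + δ) n (n + 1) W (m.factorial / r' ^ m * C * N)
        (jostComponent M r (n + 1 + m)) := by
  set H₀ : ℝ → ℝ := fun p => p ^ (1 / 2 : ℝ) * Real.exp (-((r - r') * p)) +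
    p ^ ((n : ℝ) + 3 / 2) * Real.exp (-((r - r') * p)) with hH0
  have hn0 : (0 : ℝ) ≤ n := n.cast_nonneg
  have hint : ∀ s : ℝ, -1 < s →
      IntegrableOn (fun p : ℝ => p ^ s * Real.exp (-((r - r') * p))) (Ioi 0) := by
    intro s hs
    have := integrableOn_rpow_mul_exp_neg_mul_rpow (p := 1) (b := r - r') hs one_pos (by linarith)
    refine this.congr_fun (fun p _ => ?_) measurableSet_Ioi
    simp only [Real.rpow_one, neg_mul]
  have hH0i : IntegrableOn H₀ (Ioi 0) :=
    (hint _ (by norm_num)).add (hint _ (by linarith))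
  refine ⟨∫ p in Ioi (0 : ℝ), H₀ p, fun m N hN => ?_⟩
  have hres := hN.mellinOp h.one_le h.weight_pos
    (differentiableOn_borelCoeff hM h.pos.le h.lt (n + 1 + m)).continuousOn
    (G := fun p => p ^ (n + 1 + m) * Real.exp (-(r * p)))
    (H := fun p => m.factorial / r' ^ m * H₀ p)
    (Continuous.aestronglyMeasurable (by fun_prop)) (hH0i.const_mul _) fun p hp => ?_
  · rw [integral_const_mul] at hres
    exact hres
  · have h1 : p ^ m * Real.exp (-(r' * p)) ≤ m.factorial / r' ^ m := by
      have := Real.pow_div_factorial_le_exp (r' * p) (by positivity) m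
      rw [div_le_iff₀ (by positivity), mul_pow] at this
      rw [Real.exp_neg, ← div_eq_mul_inv, div_le_div_iff₀ (Real.exp_pos _) (by positivity)]
      linarith
    have h2 : rescaleBound n p ≤ p ^ (-((n : ℝ) + 1 / 2)) + p ^ (1 / 2 : ℝ) :=
      max_le (le_add_of_nonneg_right (by positivity)) (le_add_of_nonneg_left (by positivity))
    have h3 : p ^ (n + 1) * (p ^ (-((n : ℝ) + 1 / 2)) + p ^ (1 / 2 : ℝ)) =
        p ^ (1 / 2 : ℝ) + p ^ ((n : ℝ) + 3 / 2) := by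
      rw [mul_add, ← Real.rpow_natCast, ← Real.rpow_add hp, ← Real.rpow_add hp]
      push_cast
      ring_nf
    have h4 : Real.exp (-(r * p)) = Real.exp (-(r' * p)) * Real.exp (-((r - r') * p)) := by
      rw [← Real.exp_add]; ring_nf
    rw [abs_of_nonneg (by positivity), h4, pow_add]
    calc _ ≤ p ^ (n + 1) * p ^ m * (Real.exp (-(r' * p)) * Real.exp (-((r - r') * p))) *
          (p ^ (-((n : ℝ) + 1 / 2)) + p ^ (1 / 2 : ℝ)) := by gcongr
      _ = p ^ m * Real.exp (-(r' * p)) * (Real.exp (-((r - r') * p)) *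
          (p ^ (n + 1) * (p ^ (-((n : ℝ) + 1 / 2)) + p ^ (1 / 2 : ℝ)))) := by ring
      _ ≤ m.factorial / r' ^ m * (Real.exp (-((r - r') * p)) *
          (p ^ (n + 1) * (p ^ (-((n : ℝ) + 1 / 2)) + p ^ (1 / 2 : ℝ)))) := by gcongr
      _ = _ := by rw [h3, hH0]; ring

theorem abs_exp_sub_taylor_le {r p : ℝ} (hr : 0 ≤ r) (hp : 0 ≤ p) (n : ℕ) :
    |Real.exp (-(r * p)) - ∑ l ∈ Finset.range (n + 1), (-r) ^ l / l.factorial * p ^ l| ≤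
      (r * p) ^ (n + 1) * Real.exp (r * p) := by
  have h := Complex.norm_exp_sub_sum_le_norm_mul_exp ((-(r * p) : ℝ) : ℂ) (n + 1)
  have e : Complex.exp ((-(r * p) : ℝ) : ℂ) -
      ∑ l ∈ Finset.range (n + 1), (((-(r * p) : ℝ) : ℂ)) ^ l / l.factorial =
      ((Real.exp (-(r * p)) - ∑ l ∈ Finset.range (n + 1), (-r) ^ l / l.factorial * p ^ l :
        ℝ) : ℂ) := by
    push_cast
    congr 1
    refine Finset.sum_congr rfl fun l _ => ?_
    rw [← neg_mul, mul_pow]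
    ring
  rw [e, Complex.norm_real, Complex.norm_real, Real.norm_eq_abs, Real.norm_eq_abs, abs_neg,
    abs_of_nonneg (mul_nonneg hr hp)] at h
  exact h

/-- For `k ≤ n` the weight `e ^ (-p r)` is replaced near `p = 0` by its Taylor polynomial, whose
terms are averages `powAvg`; the rest vanishes to order `n + 1` at `p = 0`. -/
theorem exists_hasLogExp_jostComponent (h : Calibration n δ Λ W) (hM : 0 < M) {r : ℝ}
    (hr : 0 < r) {k : ℕ} (hk : k ≤ n) :
    ∃ N, HasLogExp (Real.pi / 2 + δ) n (n + 1) W N (jostComponent M r k) := by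
  obtain ⟨N, hN⟩ := exists_hasLogExp_borelCoeff h hM k
  have hb : 0 < Real.pi / 2 + δ := by
    have := h.pos
    positivity
  have hd := differentiableOn_borelCoeff hM h.pos.le h.lt k
  have hC := fun v hv => norm_borelCoeff_le_of_mem_strip hM h.pos.le h.lt k (w := v) hv
  set G : ℝ → ℝ := fun p => p ^ k * Real.exp (-(r * p)) with hG
  set G₁ : ℝ → ℝ := fun p => G p - ∑ l ∈ Finset.range (n + 1), (-r) ^ l / l.factorial *
    powKer (k + l) p with hG1
  have hGi : IntegrableOn G (Ioi 0) := integrableOn_pow_mul_exp_neg k hr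
  have hsi : ∀ l, IntegrableOn (fun p => (-r) ^ l / l.factorial * powKer (k + l) p) (Ioi 0) :=
    fun l => (integrableOn_powKer _).const_mul _
  have hG1i : IntegrableOn G₁ (Ioi 0) := hGi.sub (integrable_finsetSum _ fun l _ => hsi l)
  set C := r ^ (n + 1) * Real.exp r with hCdef
  have hrem := hN.mellinOp h.one_le h.weight_pos hd.continuousOn (G := G₁)
    (H := fun p => C * powKer 0 p + p ^ (k + 1) * Real.exp (-(r * p)))
    hG1i.aestronglyMeasurable
    (((integrableOn_powKer 0).const_mul C).add (integrableOn_pow_mul_exp_neg (k + 1) hr))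
    fun p hp => ?_
  · have hav : ∀ l ∈ Finset.range (n + 1), ∃ N',
        HasLogExp (Real.pi / 2 + δ) n (k + 1) W N' (powAvg (k + l) (borelCoeff M k)) :=
      fun l _ => hN.powAvg hb h.one_le h.weight_pos hd hC (by omega)
    choose! Nl hNl using hav
    have hsum := ((HasLogExp.sum h.weight_pos _ fun l hl => (hNl l hl).const_mul
      (((-r) ^ l / l.factorial : ℝ) : ℂ)).add h.weight_pos (hrem.mono_deg (Nat.le_succ k))).mono_deg
        (show k + 1 ≤ n + 1 by omega)
    refine ⟨_, hsum.congr fun w hw => ?_⟩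
    have hCw : ∀ p : ℝ, 0 < p → ‖borelCoeff M k (w - (Real.log p : ℝ))‖ ≤ _ :=
      fun p _ => hC _ (sub_ofReal_mem_strip hw _)
    have i1 : ∀ l ∈ Finset.range (n + 1), Integrable (fun p : ℝ =>
        (((-r) ^ l / l.factorial : ℝ) : ℂ) * ((powKer (k + l) p : ℂ) *
          borelCoeff M k (w - (Real.log p : ℝ))))
        (volume.restrict (Ioi 0)) := fun l _ =>
      (integrable_mellinOp (integrableOn_powKer (k + l)) hd.continuousOn hw hCw).const_mul _
    have i2 := integrable_mellinOp hG1i hd.continuousOn hw hCw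
    simp only [powAvg, jostComponent, mellinOp]
    simp_rw [← integral_const_mul]
    rw [← integral_finsetSum _ i1, ← integral_add (integrable_finsetSum _ i1) i2]
    refine integral_congr_ae (ae_of_all _ fun p => ?_)
    simp only [hG1, hG]
    push_cast
    rw [sub_mul, Finset.sum_mul]
    simp only [mul_assoc]
    ring
  · have hH1 : 0 ≤ p ^ (k + 1) * Real.exp (-(r * p)) := by positivity
    have hC0 : 0 ≤ C := by positivity
    by_cases hp1 : p < 1
    · have hm : p ∈ Iio (1 : ℝ) := hp1
      have e : G₁ p = p ^ k * (Real.exp (-(r * p)) -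
          ∑ l ∈ Finset.range (n + 1), (-r) ^ l / l.factorial * p ^ l) := by
        simp only [hG1, hG, powKer, indicator_of_mem hm]
        rw [mul_sub, Finset.mul_sum]
        congr 1
        refine Finset.sum_congr rfl fun l _ => ?_
        rw [pow_add]
        ring
      have h0 : powKer 0 p = 1 := by simp [powKer, indicator_of_mem hm]
      rw [e, abs_mul, abs_of_nonneg (by positivity : (0 : ℝ) ≤ p ^ k), h0, mul_one]
      have h1 : |Real.exp (-(r * p)) -
          ∑ l ∈ Finset.range (n + 1), (-r) ^ l / l.factorial * p ^ l| ≤ C * p ^ (n + 1) := by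
        refine (abs_exp_sub_taylor_le hr.le hp.le n).trans ?_
        rw [hCdef, mul_pow]
        have : Real.exp (r * p) ≤ Real.exp r := Real.exp_le_exp.mpr (by nlinarith)
        calc _ ≤ r ^ (n + 1) * p ^ (n + 1) * Real.exp r := by gcongr
          _ = _ := by ring
      have h2 : p ^ (n + 1) * rescaleBound n p ≤ 1 := by
        rw [rescaleBound_eq hp hp1.le, ← Real.rpow_natCast, ← Real.rpow_add hp]
        refine Real.rpow_le_one hp.le hp1.le ?_
        push_cast
        linarith
      have h3 : p ^ k ≤ 1 := pow_le_one₀ hp.le hp1.le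
      have h4 := rescaleBound_nonneg n hp
      calc _ ≤ 1 * (C * p ^ (n + 1)) * rescaleBound n p := by gcongr
        _ = C * (p ^ (n + 1) * rescaleBound n p) := by ring
        _ ≤ C * 1 := by gcongr
        _ ≤ _ := by linarith
    · have hm : p ∉ Iio (1 : ℝ) := hp1
      have hp1' : 1 ≤ p := not_lt.mp hp1
      have e : G₁ p = G p := by simp [hG1, powKer, indicator_of_notMem hm]
      have h0 : powKer 0 p = 0 := by simp [powKer, indicator_of_notMem hm]
      rw [e, h0, mul_zero, zero_add, hG]
      simp only
      rw [abs_of_nonneg (by positivity)]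
      have h1 : rescaleBound n p ≤ p := by
        refine (rescaleBound_le hp1').trans ?_
        calc p ^ (1 / 2 : ℝ) ≤ p ^ (1 : ℝ) := Real.rpow_le_rpow_of_exponent_le hp1' (by norm_num)
          _ = p := Real.rpow_one p
      calc _ ≤ p ^ k * Real.exp (-(r * p)) * p := by gcongr
        _ = _ := by ring

end Components

/-! ### The expansion of the Jost solution at low frequency -/

/-- The Laplace integral `1 + ∫₀^∞ e^(-p r) B(p) dp` as a function of `w = log z`. -/
noncomputable def jostProfile (M r : ℝ) (w : ℂ) : ℂ := 1 + ∑' k, jostComponent M r k w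

section Profile

variable {M δ r : ℝ}

theorem norm_jostComponent_le (hM : 0 < M) (h0 : 0 ≤ δ) (h1 : δ < Real.pi / 2) (hr : 0 < r)
    (k : ℕ) {w : ℂ} (hw : w ∈ strip (Real.pi / 2 + δ)) :
    ‖jostComponent M r k w‖ ≤ M / Real.cos δ / r * (2 * M / Real.cos δ / r) ^ k := by
  refine (norm_mellinOp_le (integrableOn_pow_mul_exp_neg k hr) fun p _ =>
    norm_borelCoeff_le_of_mem_strip hM h0 h1 k (sub_ofReal_mem_strip hw _)).trans_eq ?_
  have : ∫ p in Ioi (0 : ℝ), |p ^ k * Real.exp (-(r * p))| = k.factorial / r ^ (k + 1) := by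
    rw [← integral_pow_mul_exp_neg k hr]
    refine setIntegral_congr_fun measurableSet_Ioi fun p hp => abs_of_nonneg ?_
    have hp0 : (0 : ℝ) < p := hp
    positivity
  rw [this, div_pow _ r, pow_succ]
  field_simp

theorem differentiableOn_jostComponent (hM : 0 < M) (h0 : 0 ≤ δ) (h1 : δ < Real.pi / 2)
    (hr : 0 < r) (k : ℕ) :
    DifferentiableOn ℂ (jostComponent M r k) (strip (Real.pi / 2 + δ)) := fun _ hw =>
  (hasDerivAt_mellinOp (integrableOn_pow_mul_exp_neg k hr) (differentiableOn_borelCoeff hM h0 h1 k)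
    (fun _ hv => norm_borelCoeff_le_of_mem_strip hM h0 h1 k hv)
    hw).2.differentiableAt.differentiableWithinAt

theorem summable_jostComponent_bound (hM : 0 < M) (h0 : 0 ≤ δ) (h1 : δ < Real.pi / 2)
    (hr : 2 * M / Real.cos δ < r) :
    Summable fun k : ℕ => M / Real.cos δ / r * (2 * M / Real.cos δ / r) ^ k := by
  have hc : 0 < Real.cos δ := Real.cos_pos_of_mem_Ioo ⟨by linarith [Real.pi_pos], h1⟩
  have hq : 0 < 2 * M / Real.cos δ := by positivity
  refine (summable_geometric_of_lt_one ?_ ?_).mul_left _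
  · have := hq.trans hr
    positivity
  · rw [div_lt_one (hq.trans hr)]
    exact hr

theorem differentiableOn_jostProfile (hM : 0 < M) (h0 : 0 ≤ δ) (h1 : δ < Real.pi / 2)
    (hr0 : 0 < r) (hr : 2 * M / Real.cos δ < r) :
    DifferentiableOn ℂ (jostProfile M r) (strip (Real.pi / 2 + δ)) := by
  refine DifferentiableOn.const_add 1 ?_
  exact Complex.differentiableOn_tsum_of_summable_norm (summable_jostComponent_bound hM h0 h1 hr)
    (differentiableOn_jostComponent hM h0 h1 hr0) (isOpen_strip _)
    fun k w hw => norm_jostComponent_le hM h0 h1 hr0 k hw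

theorem jostProfile_eq (hM : 0 < M) (hr : 2 * M < r) {w : ℂ} (hw : |w.im| ≤ Real.pi / 2) :
    jostProfile M r w = 1 + laplaceBorel M w 0 r := by
  have hr0 : 0 < r := by linarith
  set F : ℕ → ℝ → ℂ := fun k p => ((p ^ k * Real.exp (-(r * p)) : ℝ) : ℂ) *
    borelCoeff M k (w - (Real.log p : ℝ)) with hF
  have hbound : ∀ (k : ℕ) (p : ℝ), p ∈ Ioi (0 : ℝ) →
      ‖F k p‖ ≤ M * ((2 * M) ^ k / k.factorial) * (p ^ k * Real.exp (-(r * p))) := by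
    intro k p hp
    have hp0 : (0 : ℝ) < p := hp
    rw [hF]
    simp only
    rw [norm_mul, Complex.norm_real, Real.norm_eq_abs, abs_of_nonneg (by positivity), mul_comm]
    gcongr
    exact norm_borelCoeff_sub_log_le hM k hw _
  have hint : ∀ k, Integrable (F k) (volume.restrict (Ioi 0)) := by
    intro k
    refine Integrable.mono' ((integrableOn_pow_mul_exp_neg k hr0).const_mul
      (M * ((2 * M) ^ k / k.factorial))) ?_ ?_
    · exact (Continuous.aestronglyMeasurable (by fun_prop)).mul
        ((continuousOn_borelCoeff_sub_log hM k hw).aestronglyMeasurable measurableSet_Ioi)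
    · filter_upwards [ae_restrict_mem measurableSet_Ioi] with p hp using hbound k p hp
  have hsum : Summable fun k => ∫ p in Ioi (0 : ℝ), ‖F k p‖ := by
    have hq : 2 * M / r < 1 := by rw [div_lt_one hr0]; exact hr
    refine Summable.of_nonneg_of_le (fun k => integral_nonneg fun p => norm_nonneg _) (fun k => ?_)
      ((summable_geometric_of_lt_one (by positivity) hq).mul_left (M / r))
    refine (setIntegral_mono_on (hint k).norm
      ((integrableOn_pow_mul_exp_neg k hr0).const_mul (M * ((2 * M) ^ k / k.factorial)))
      measurableSet_Ioi (hbound k)).trans_eq ?_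
    rw [integral_const_mul, integral_pow_mul_exp_neg k hr0, div_pow, pow_succ]
    field_simp
  have h := hasSum_integral_of_summable_integral_norm hint hsum
  have e : ∫ p in Ioi (0 : ℝ), ∑' k, F k p = laplaceBorel M w 0 r := by
    refine setIntegral_congr_fun measurableSet_Ioi fun p hp => ?_
    have hb := (hasSum_borel hM hw (le_of_lt hp)).mul_left (Complex.exp (-(p * r)))
    simp only [pow_zero, one_mul]
    rw [← hb.tsum_eq]
    refine tsum_congr fun k => ?_
    rw [hF]
    push_cast
    rw [mul_comm (r : ℂ)]
    ring
  rw [e] at h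
  rw [jostProfile, ← h.tsum_eq]
  rfl

theorem exists_hasLogExp_jostProfile {n : ℕ} {Λ : ℝ} {W : ℕ → ℝ} (h : Calibration n δ Λ W)
    (hM : 0 < M) (hr : 2 * M * Λ < r) :
    ∃ N, HasLogExp (Real.pi / 2 + δ) n (n + 1) W N (jostProfile M r) := by
  have hc : 0 < Real.cos δ :=
    Real.cos_pos_of_mem_Ioo ⟨by linarith [Real.pi_pos, h.pos], h.lt⟩
  have hΛ0 : 0 < Λ := lt_of_lt_of_le (by positivity) h.inv_cos_le
  have hlam : 0 < 2 * M * Λ := by positivity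
  have hr0 : 0 < r := hlam.trans hr
  have hrc : 2 * M / Real.cos δ < r := by
    refine lt_of_le_of_lt ?_ hr
    rw [div_eq_mul_one_div]
    have := h.inv_cos_le
    gcongr
  obtain ⟨r', hr1, hr2⟩ := exists_between hr
  have hr'0 : 0 < r' := hlam.trans hr1
  obtain ⟨C, hC⟩ := hasLogExp_jostComponent_of_lt (n := n) h hM hr'0 hr2
  obtain ⟨N₀, hN₀⟩ := exists_hasLogExp_borelCoeff_factorial h hM
  have htail : ∀ m : ℕ, HasLogExp (Real.pi / 2 + δ) n (n + 1) W
      (C * N₀ * (2 * M * Λ / r') ^ m) (jostComponent M r (m + (n + 1))) := by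
    intro m
    rw [add_comm m]
    refine (hC m _ (hN₀ m)).mono (le_of_eq ?_)
    rw [div_pow]
    field_simp
  have hgeo : Summable fun m : ℕ => C * N₀ * (2 * M * Λ / r') ^ m :=
    (summable_geometric_of_lt_one (by positivity) ((div_lt_one hr'0).mpr hr1)).mul_left _
  have hhead : ∀ k ∈ Finset.range (n + 1), ∃ N,
      HasLogExp (Real.pi / 2 + δ) n (n + 1) W N (jostComponent M r k) := fun k hk =>
    exists_hasLogExp_jostComponent h hM hr0 (by rw [Finset.mem_range] at hk; omega)
  choose! Nk hNk using hhead
  have hsummable : ∀ w ∈ strip (Real.pi / 2 + δ), Summable fun k => jostComponent M r k w :=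
    fun w hw => Summable.of_norm_bounded (summable_jostComponent_bound hM h.pos.le h.lt hrc)
      fun k => norm_jostComponent_le hM h.pos.le h.lt hr0 k hw
  have hT := HasLogExp.tsum h.one_le h.weight_pos htail hgeo
    (f := fun w => ∑' m, jostComponent M r (m + (n + 1)) w) fun w hw =>
      ((summable_nat_add_iff (n + 1)).mpr (hsummable w hw)).hasSum
  have h0 : (0, 0) ∈ logIdx n (n + 1) := by simp [mem_logIdx]
  refine ⟨_, (((hasLogExp_logMon h0).add h.weight_pos
    ((HasLogExp.sum h.weight_pos _ hNk).add h.weight_pos hT))).congr fun w hw => ?_⟩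
  rw [jostProfile, ← (hsummable w hw).sum_add_tsum_nat_add (n + 1)]
  simp [logMon]

end Profile

theorem sum_logIdx (n : ℕ) (F : ℕ × ℕ → ℂ) :
    ∑ x ∈ logIdx n (n + 1), F x = ∑ i ∈ Finset.range (n + 1), F (i, 0) +
      ∑ i ∈ Finset.Icc 1 n, ∑ j ∈ Finset.Icc 1 i, F (i, j) := by
  rw [Finset.sum_finset_product (logIdx n (n + 1)) (Finset.range (n + 1))
    (fun i => Finset.range (i + 1)) (fun x => by
      rw [mem_logIdx, Finset.mem_range, Finset.mem_range]; omega)]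
  have h1 : ∀ i, ∑ j ∈ Finset.range (i + 1), F (i, j) =
      F (i, 0) + ∑ j ∈ Finset.Icc 1 i, F (i, j) := by
    intro i
    rw [Finset.range_eq_Ico, Finset.sum_eq_sum_Ico_succ_bot (Nat.succ_pos i)]
    rfl
  simp_rw [h1]
  rw [Finset.sum_add_distrib]
  congr 1
  rw [Finset.range_eq_Ico, Finset.sum_eq_sum_Ico_succ_bot (Nat.succ_pos n)]
  simp
  rfl

theorem logMon_log (i j : ℕ) {ω : ℝ} (hω : ω ≠ 0) :
    logMon (i, j) (Complex.log (2 * Complex.I * ω)) =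
      (2 * Complex.I * (ω : ℂ)) ^ i * Complex.log (2 * Complex.I * ω) ^ j := by
  rw [logMon, Complex.exp_nat_mul, exp_log_two_I_mul hω]

/-- The low frequency expansion of the Laplace integral at a fixed radius: powers of `2iω` and
`log (2iω)`, up to a remainder of class `C ^ n`. -/
theorem exists_expansion_laplaceBorel {M r : ℝ} (hM : 0 < M) (hr : 2 * M < r) {n : ℕ}
    (hn : 1 ≤ n) :
    ∃ (c : ℕ × ℕ → ℂ) (R : ℝ → ℂ), ContDiff ℝ (n : WithTop ℕ∞) R ∧ ∀ ω : ℝ, ω ≠ 0 →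
      1 + laplaceBorel M (Complex.log (2 * Complex.I * ω)) 0 r =
        ∑ x ∈ logIdx n (n + 1), c x * ((2 * Complex.I * (ω : ℂ)) ^ x.1 *
          Complex.log (2 * Complex.I * ω) ^ x.2) + R ω := by
  have hΛ : ∃ Λ : ℝ, 1 < Λ ∧ 2 * M * Λ < r := by
    obtain ⟨s, hs1, hs2⟩ := exists_between hr
    refine ⟨s / (2 * M), by rwa [one_lt_div (by positivity)], ?_⟩
    rwa [mul_div_cancel₀ _ (by positivity)]
  obtain ⟨Λ, hΛ1, hΛr⟩ := hΛ
  obtain ⟨δ, W, h⟩ := exists_calibration hn hΛ1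
  have hc : 0 < Real.cos δ :=
    Real.cos_pos_of_mem_Ioo ⟨by linarith [Real.pi_pos, h.pos], h.lt⟩
  have hrc : 2 * M / Real.cos δ < r := by
    refine lt_of_le_of_lt ?_ hΛr
    rw [div_eq_mul_one_div]
    have := h.inv_cos_le
    gcongr
  obtain ⟨N, c, D, -, -, hD⟩ := exists_hasLogExp_jostProfile h hM hΛr
  set Q : ℂ → ℂ := fun w => jostProfile M r w - ∑ x ∈ logIdx n (n + 1), c x * logMon x w with hQ
  have hflat : IsFlat ((n : ℝ) + 1 / 2) Q := by
    refine ⟨Real.pi / 2 + δ, D, by linarith [h.pos], ?_, hD⟩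
    refine (differentiableOn_jostProfile hM h.pos.le h.lt (by linarith) hrc).sub ?_
    refine DifferentiableOn.fun_sum fun x _ => DifferentiableOn.const_mul ?_ _
    exact fun w _ => (hasDerivAt_logMon x.1 x.2 w).differentiableAt.differentiableWithinAt
  refine ⟨c, logPullback 0 Q, contDiff_logPullback (by positivity) n hflat 0 (by norm_num),
    fun ω hω => ?_⟩
  rw [← jostProfile_eq hM hr (abs_im_log_two_I_mul ω), logPullback, if_neg hω, pow_zero, inv_one,
    one_mul]
  simp only [hQ]
  have : ∀ x : ℕ × ℕ, logMon x (Complex.log (2 * Complex.I * ω)) =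
      (2 * Complex.I * (ω : ℂ)) ^ x.1 * Complex.log (2 * Complex.I * ω) ^ x.2 :=
    fun x => logMon_log x.1 x.2 hω
  simp_rw [this]
  ring

end JostBorel

open JostBorel in
theorem mainTheorem2 (M : ℝ) (hM : 0 < M) (n : ℕ) (hn : 3 ≤ n) :
    (∀ ω : ℝ, ω ≠ 0 →
      Schwarzschild.IsJostSolution M 0 (ω : ℂ) (Schwarzschild.jostSolution M 0 (ω : ℂ))) ∧
    ∀ u : ℝ, 0 < u →
      ∃ (g₀ : ℝ → ℂ) (g : ℕ → ℕ → ℕ → ℝ → ℂ),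
        ContDiff ℝ (n : WithTop ℕ∞) g₀ ∧
        (∀ i j k : ℕ, 1 ≤ j + k → j + k ≤ i → i ≤ n →
          ContDiff ℝ (n : WithTop ℕ∞) (g i j k)) ∧
        ∀ ω : ℝ, ω ≠ 0 →
          Schwarzschild.jostSolution M 0 (ω : ℂ) u =
            Complex.exp (-Complex.I * ω * u) + g₀ ω +
              ∑ i ∈ Finset.Icc 1 n, ∑ m ∈ Finset.Icc 1 i, ∑ jk ∈ Finset.HasAntidiagonal.antidiagonal m,
                (2 * Complex.I * (ω : ℂ)) ^ i *
                  Complex.log (2 * Complex.I * (ω : ℂ)) ^ jk.1 *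
                  Complex.log (-2 * Complex.I * (ω : ℂ)) ^ jk.2 *
                  g i jk.1 jk.2 ω := by
  refine ⟨fun ω hω => isJostSolution_jostSolution hM hω, fun u _ => ?_⟩
  obtain ⟨c, R, hR, hexp⟩ := exists_expansion_laplaceBorel hM
    (Schwarzschild.two_mul_lt_radius hM u) (show 1 ≤ n by omega)
  have hof : ContDiff ℝ (n : WithTop ℕ∞) fun ω : ℝ => (ω : ℂ) := Complex.ofRealCLM.contDiff
  have he : ContDiff ℝ (n : WithTop ℕ∞) fun ω : ℝ => Complex.exp (-Complex.I * ω * u) :=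
    ((contDiff_const.mul hof).mul contDiff_const).cexp
  -- `φ` continues to the sector around `Re (2iω) ≥ 0`, so powers of `log (2iω)` suffice (`k = 0`)
  refine ⟨fun ω => Complex.exp (-Complex.I * ω * u) * (∑ i ∈ Finset.range (n + 1),
      c (i, 0) * (2 * Complex.I * (ω : ℂ)) ^ i + R ω - 1),
    fun i j k ω => if k = 0 then c (i, j) * Complex.exp (-Complex.I * ω * u) else 0, ?_, ?_, ?_⟩
  · refine he.mul (((ContDiff.sum fun i _ => ?_).add hR).sub contDiff_const)
    exact contDiff_const.mul ((contDiff_const.mul hof).pow i)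
  · intro i j k _ _ _
    by_cases hk : k = 0
    · simp only [hk, if_true]
      exact contDiff_const.mul he
    · simp only [hk, if_false]
      exact contDiff_const
  · intro ω hω
    have hin : ∀ i m : ℕ, ∑ jk ∈ Finset.HasAntidiagonal.antidiagonal m,
        (2 * Complex.I * (ω : ℂ)) ^ i * Complex.log (2 * Complex.I * (ω : ℂ)) ^ jk.1 *
          Complex.log (-2 * Complex.I * (ω : ℂ)) ^ jk.2 *
          (if jk.2 = 0 then c (i, jk.1) * Complex.exp (-Complex.I * ω * u) else 0) =
        Complex.exp (-Complex.I * ω * u) * (c (i, m) * ((2 * Complex.I * (ω : ℂ)) ^ i *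
          Complex.log (2 * Complex.I * (ω : ℂ)) ^ m)) := by
      intro i m
      rw [Finset.sum_eq_single (m, 0)]
      · simp only [pow_zero, mul_one, if_true]
        ring
      · rintro ⟨a, b⟩ hab hne
        have hb : b ≠ 0 := by
          rintro rfl
          rw [Finset.HasAntidiagonal.mem_antidiagonal, add_zero] at hab
          exact hne (by rw [← hab])
        simp [hb]
      · intro hm
        exact absurd (Finset.HasAntidiagonal.mem_antidiagonal.mpr (add_zero m)) hm
    simp_rw [hin, ← Finset.mul_sum]
    rw [jostSolution_eq_jostLaplace hM hω, jostLaplace, hexp ω hω, sum_logIdx]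
    simp only [pow_zero, mul_one]
    ring
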